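/- **Theorem (Interpolation operator $\mathcal I_X$ on irregular meshes).** Let $d,k,\ell\ge 1$, $\mathcal J=[0,T]$ with $T>0$, let $\Omega\subset\mathbb R^d$ be a bounded Lipschitz domain (connected), $Q=\mathcal J\times\Omega$, and $X=L^2(\mathcal J;H^1_0(\Omega))\cap H^1(\mathcal J;H^{-1}(\Omega))$. Let $\mathcal T$ be a finite partition of $\overline Q$ into closed cells $K=K_t\times K_x$ with intervals $K_t$ of length $h_t(K)>0$ and nondegenerate $d$-simplices $K_x$ of diameter $h_x(K)$; hanging vertices are allowed. Let $S_h$ be the space of continuous functions on $\overline Q$ with restrictions in $\mathbb P_k(K_t)\otimes\mathbb P_\ell(K_x)$ for all $K\in\mathcal T$, and let $X_h=S_h\cap X$. Let $\mathcal N\subset\overline Q$ be a finite set of nodes for $S_h$ with nodal basis $(\phi_j)_{j\in\mathcal N}$ of $S_h$, $\phi_j(i)=\delta_{ij}$, such that $\phi_j\in X_h$ for all $j\in\mathcal N$ that are not on the lateral boundary $\mathcal J\times\partial\Omega$. For $K\in\mathcal T$ set $\mathcal N(K)=\{j\in\mathcal N: K\subset\operatorname{supp}\phi_j\}$, and let $\omega_K=\omega_{K,t}\times\omega_{K,x}$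 be the smallest product set that contains $\operatorname{supp}\phi_j$ for all $j\in\mathcal N(K)$. Suppose that for some $\kappa\ge1$ and all $K\in\mathcal T$ * (shape regularity) $K_x$ contains a ball of radius $h_x(K)/\kappa$; * (local grading) all $K'\in\mathcal T$ with $K'\subset\omega_K$ satisfy $\kappa^{-1}h_t(K)\le h_t(K')\le\kappa h_t(K)$ and $\kappa^{-1}h_x(K)\le h_x(K')\le\kappa h_x(K)$, and $|\omega_{K,t}|\le\kappa h_t(K)$, $|\omega_{K,x}|\le(\kappa h_x(K))^d$; * (bounded basis) $|\phi_j|\le\kappa$ on $\overline Q$ for all $j\in\mathcal N$; * (no bottlenecks) there is a connected set $\Gamma\subset\mathbb R^d$ that meets $K'_x$ for every $K'\in\mathcal T$ with $K'\subset\omega_K$ and such that the closed ball of radius $h_x(K)/\kappa$ around each point of $\Gamma$ is contained in $\omega_{K,x}$; * (resolved boundary) each facet $F$ of $K_x$ satisfies $F\subset\partial\Omega$ or $\mathcal H^{d-1}(F\cap\partial\Omega)=0$. Assign to each $j\in\mathcal N$ some $K(j)\in\mathcal T$ with $j\in K(j)$. Let $\Pi_K$ be the $L^2(K)$-orthogonal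 projection onto $\mathbb P_k(K_t)\otimes\mathbb P_\ell(K_x)$, and for $v\in X$ let $\mathcal I_Xv\in S_h$ be the function with nodal values $(\mathcal I_Xv)(j)=(\Pi_{K(j)}v)(j)$ for $j\in\mathcal N\setminus(\mathcal J\times\partial\Omega)$ and $(\mathcal I_Xv)(j)=0$ for $j\in\mathcal N\cap(\mathcal J\times\partial\Omega)$. Then $\mathcal I_X$ is a well-defined linear projection from $X$ onto $X_h$, and there is a constant $C$ that depends only on $d,k,\ell,\kappa$ such that for all $v\in X$ and $K\in\mathcal T$ $$\|\nabla_x(v-\mathcal I_Xv)\|_{L^2(K)}\le C\min_{v_h\in X_h}\Big(\|\nabla_x(v-v_h)\|_{L^2(\omega_K)}+\frac{h_t(K)}{h_x(K)}\|\partial_t(v-v_h)\|_{L^2(\omega_K)}\Big),$$ $$\|\partial_t(v-\mathcal I_Xv)\|_{L^2(K)}\le C\min_{v_h\in X_h}\Big(\|\partial_t(v-v_h)\|_{L^2(\omega_K)}+\frac{h_x(K)}{h_t(K)}\|\nabla_x(v-v_h)\|_{L^2(\omega_K)}\Big),$$ where the $L^2$ norm of a weak derivative that is not in $L^2$ is $\infty$.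 -/

import Mathlib

open Set Filter Topology MeasureTheory
open scoped NNReal ENNReal ContDiff

noncomputable section

namespace SpaceTime

/-- The spatial Euclidean space `ℝᵈ`. Points of the time-space domain are pairs `(t, x)`. -/
abbrev Space (d : ℕ) := EuclideanSpace ℝ (Fin d)

/-! ### Domains and function spaces -/

/-- Bounded Lipschitz domain: bounded, open, connected, nonempty, and near each boundary point the
set lies below the graph of a Lipschitz function in a suitable direction `e` (the function `g`
depends only on the component orthogonal to `e`). -/
structure IsLipschitzDomain {d : ℕ} (Ω : Set (Space d)) : Prop where
  isOpen : IsOpen Ω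
  isConnected : IsConnected Ω
  isBounded : Bornology.IsBounded Ω
  graph : ∀ p ∈ frontier Ω, ∃ (e : Space d) (g : Space d → ℝ) (L : ℝ≥0) (r : ℝ),
    ‖e‖ = 1 ∧ LipschitzWith L g ∧ (∀ (x : Space d) (c : ℝ), g (x + c • e) = g x) ∧ 0 < r ∧
      ∀ x ∈ Metric.ball p r, x ∈ Ω ↔ inner ℝ x e < g x

/-- `φ ∈ C_c^∞(U)`. -/
structure IsTestFun {F : Type*} [NormedAddCommGroup F] [NormedSpace ℝ F]
    (U : Set F) (φ : F → ℝ) : Prop where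
  contDiff : ContDiff ℝ ∞ φ
  hasCompactSupport : HasCompactSupport φ
  tsupport_subset : tsupport φ ⊆ U

/-- `u ∈ H¹₀(Ω)` with (weak) gradient `g`: the pair `(u, g)` is the limit in `L²(Ω)` of
`(ψₙ, ∇ψₙ)` with `ψₙ ∈ C_c^∞(Ω)`. -/
def HasH10Grad {d : ℕ} (Ω : Set (Space d)) (u : Space d → ℝ) (g : Space d → Space d) : Prop :=
  MemLp u 2 (volume.restrict Ω) ∧ MemLp g 2 (volume.restrict Ω) ∧
    ∃ ψ : ℕ → Space d → ℝ, (∀ n, IsTestFun Ω (ψ n)) ∧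
      Tendsto (fun n => eLpNorm (fun x => u x - ψ n x) 2 (volume.restrict Ω)) atTop (𝓝 0) ∧
      Tendsto (fun n => eLpNorm (fun x => g x - gradient (ψ n) x) 2 (volume.restrict Ω))
        atTop (𝓝 0)

/-- `ξ ∈ H⁻¹(Ω)` with `‖ξ‖_{H⁻¹(Ω)} ≤ N`, where `H⁻¹(Ω)` is the dual of `H¹₀(Ω)` with the norm
`‖∇ ·‖_{L²(Ω)}`; a functional is given by its values on the dense subspace `C_c^∞(Ω)`. -/
structure IsHMinusOne {d : ℕ} (Ω : Set (Space d)) (ξ : (Space d → ℝ) → ℝ) (N : ℝ) : Prop where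
  map_add : ∀ ψ χ, IsTestFun Ω ψ → IsTestFun Ω χ → ξ (ψ + χ) = ξ ψ + ξ χ
  map_smul : ∀ (c : ℝ) (ψ), IsTestFun Ω ψ → ξ (c • ψ) = c * ξ ψ
  bound : ∀ ψ, IsTestFun Ω ψ →
    |ξ ψ| ≤ N * (eLpNorm (gradient ψ) 2 (volume.restrict Ω)).toReal

/-- `v ∈ L²(J; H¹₀(Ω))` with `J = [0, T]`. -/
def MemL2H10 {d : ℕ} (T : ℝ) (Ω : Set (Space d)) (v : ℝ × Space d → ℝ) : Prop :=
  MemLp v 2 (volume.restrict (Icc 0 T ×ˢ Ω)) ∧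
    ∃ G : ℝ × Space d → Space d, MemLp G 2 (volume.restrict (Icc 0 T ×ˢ Ω)) ∧
      ∀ᵐ t ∂(volume.restrict (Icc 0 T)),
        HasH10Grad Ω (fun x => v (t, x)) (fun x => G (t, x))

/-- `∂ₜ v ∈ L²(J; H⁻¹(Ω))` with `J = [0, T]`: the weak time derivative of the function
`t ↦ v(t, ·)` is a function `ξ` with values in `H⁻¹(Ω)` whose norm is square integrable. -/
def HasDtL2HMinusOne {d : ℕ} (T : ℝ) (Ω : Set (Space d)) (v : ℝ × Space d → ℝ) : Prop :=
  ∃ (ξ : ℝ → (Space d → ℝ) → ℝ) (N : ℝ → ℝ),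
    MemLp N 2 (volume.restrict (Icc 0 T)) ∧
    (∀ t ∈ Icc 0 T, IsHMinusOne Ω (ξ t) (N t)) ∧
    ∀ ψ, IsTestFun Ω ψ →
      AEStronglyMeasurable (fun t => ξ t ψ) (volume.restrict (Icc 0 T)) ∧
      ∀ η, IsTestFun (Ioo 0 T) η →
        ∫ t in Icc 0 T, (∫ x in Ω, v (t, x) * ψ x) * deriv η t =
          - ∫ t in Icc 0 T, ξ t ψ * η t

/-- `X = L²(J; H¹₀(Ω)) ∩ H¹(J; H⁻¹(Ω))`. -/
def MemX {d : ℕ} (T : ℝ) (Ω : Set (Space d)) (v : ℝ × Space d → ℝ) : Prop :=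
  MemL2H10 T Ω v ∧ HasDtL2HMinusOne T Ω v

/-- `g` is the weak spatial gradient of `w` on the open set `U`. -/
def HasWeakGradX {d : ℕ} (U : Set (ℝ × Space d)) (w : ℝ × Space d → ℝ)
    (g : ℝ × Space d → Space d) : Prop :=
  LocallyIntegrableOn w U ∧ LocallyIntegrableOn g U ∧
    ∀ φ, IsTestFun U φ → ∀ i : Fin d,
      ∫ z in U, w z * fderiv ℝ φ z (0, EuclideanSpace.single i 1) = - ∫ z in U, g z i * φ z

/-- `g` is the weak time derivative of `w` on the open set `U`. -/
def HasWeakDt {d : ℕ} (U : Set (ℝ × Space d)) (w g : ℝ × Space d → ℝ) : Prop :=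
  LocallyIntegrableOn w U ∧ LocallyIntegrableOn g U ∧
    ∀ φ, IsTestFun U φ →
      ∫ z in U, w z * fderiv ℝ φ z (1, 0) = - ∫ z in U, g z * φ z

/-- `‖∇ₓ w‖_{L²(S)}`, which is `∞` if there is no weak gradient in `L²`. -/
def gradXNorm {d : ℕ} (S : Set (ℝ × Space d)) (w : ℝ × Space d → ℝ) : ℝ≥0∞ :=
  ⨅ (g : ℝ × Space d → Space d) (_ : HasWeakGradX (interior S) w g),
    eLpNorm g 2 (volume.restrict S)

/-- `‖∂ₜ w‖_{L²(S)}`, which is `∞` if there is no weak time derivative in `L²`. -/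
def dtNorm {d : ℕ} (S : Set (ℝ × Space d)) (w : ℝ × Space d → ℝ) : ℝ≥0∞ :=
  ⨅ (g : ℝ × Space d → ℝ) (_ : HasWeakDt (interior S) w g),
    eLpNorm g 2 (volume.restrict S)

/-! ### Polynomials and local projections -/

/-- `ℙ_k ⊗ ℙ_ℓ`: span of the products of a polynomial of degree at most `k` in time and a
polynomial of total degree at most `ℓ` in space. -/
def tensorPoly (d k ℓ : ℕ) : Submodule ℝ (ℝ × Space d → ℝ) :=
  Submodule.span ℝ {f | ∃ (p : Polynomial ℝ) (q : MvPolynomial (Fin d) ℝ),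
    p.natDegree ≤ k ∧ q.totalDegree ≤ ℓ ∧
      f = fun z => p.eval z.1 * MvPolynomial.eval (fun i => z.2 i) q}

open Classical in
/-- The `L²(S)`-orthogonal projection of `v` onto `ℙ_k ⊗ ℙ_ℓ`. -/
def l2Proj {d : ℕ} (k ℓ : ℕ) (S : Set (ℝ × Space d)) (v : ℝ × Space d → ℝ) :
    ℝ × Space d → ℝ :=
  if h : ∃ p ∈ tensorPoly d k ℓ, ∀ q ∈ tensorPoly d k ℓ,
      ∫ z in S, (v z - p z) * q z = 0 then h.choose else 0

/-! ### Cylindrical meshes -/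

/-- A time-space cell `K = K_t × K_x` with a nondegenerate interval `K_t = [a, b]` and a
nondegenerate `d`-simplex `K_x`. -/
structure Cell (d : ℕ) where
  a : ℝ
  b : ℝ
  lt : a < b
  simplex : Affine.Simplex ℝ (Space d) d

namespace Cell

variable {d : ℕ} (K : Cell d)

/-- `K_t` -/
def timeSet : Set ℝ := Icc K.a K.b

/-- `K_x` -/
def spaceSet : Set (Space d) := convexHull ℝ (range K.simplex.points)

/-- The facet of `K_x` opposite to the vertex with index `i`. -/
def facet (i : Fin (d + 1)) : Set (Space d) := convexHull ℝ (K.simplex.points '' {i}ᶜ)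

/-- `K = K_t × K_x` -/
def toSet : Set (ℝ × Space d) := K.timeSet ×ˢ K.spaceSet

/-- `h_t(K) = |K_t|` -/
def ht : ℝ := K.b - K.a

/-- `h_x(K) = diam K_x` -/
def hx : ℝ := Metric.diam K.spaceSet

end Cell

/-- A finite partition of `[0, T] × Ω` into closed time-space cells (no conformity is required,
hanging vertices are allowed). -/
structure Mesh (d : ℕ) (T : ℝ) (Ω : Set (Space d)) where
  cells : Finset (Cell d)
  cover : ⋃ K ∈ cells, K.toSet = Icc 0 T ×ˢ closure Ω
  disjoint : ∀ K ∈ cells, ∀ K' ∈ cells, K ≠ K' → Disjoint (interior K.toSet) (interior K'.toSet)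

namespace Mesh

variable {d : ℕ} {T : ℝ} {Ω : Set (Space d)} (M : Mesh d T Ω)

/-- The piecewise polynomials that have one value at each point of the closed time-space cylinder.
As the cells are closed, these are the continuous piecewise polynomials, without boundary
conditions. -/
def Sh (k ℓ : ℕ) : Set (ℝ × Space d → ℝ) :=
  {w | ∀ K ∈ M.cells, ∃ p ∈ tensorPoly d k ℓ, EqOn w p K.toSet}

/-- `X_h = {v_h ∈ X : v_h|_K ∈ ℙ_k(K_t) ⊗ ℙ_ℓ(K_x) for all K}`, each element being represented by
its continuous representative. -/
def Xh (k ℓ : ℕ) : Set (ℝ × Space d → ℝ) :=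
  {w | w ∈ M.Sh k ℓ ∧ MemX T Ω w}

/-- Degrees of freedom: a finite set of nodes with a nodal basis. The nodes on the lateral
boundary `[0, T] × ∂Ω` belong to the set, the basis functions of the remaining nodes lie in `X_h`
(and hence form a basis of `X_h`). -/
structure Dofs (k ℓ : ℕ) where
  nodes : Finset (ℝ × Space d)
  nodes_subset : ∀ j ∈ nodes, j ∈ Icc 0 T ×ˢ closure Ω
  /-- the nodal basis function `φ_j` of the node `j` -/
  basis : ℝ × Space d → ℝ × Space d → ℝ
  basis_mem : ∀ j ∈ nodes, basis j ∈ M.Sh k ℓ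
  basis_self : ∀ j ∈ nodes, basis j j = 1
  basis_ne : ∀ i ∈ nodes, ∀ j ∈ nodes, i ≠ j → basis j i = 0
  expand : ∀ w ∈ M.Sh k ℓ, ∀ z ∈ Icc 0 T ×ˢ closure Ω, w z = ∑ j ∈ nodes, w j * basis j z
  basis_mem_Xh : ∀ j ∈ nodes, j.2 ∉ frontier Ω → basis j ∈ M.Xh k ℓ

namespace Dofs

variable {M} {k ℓ : ℕ} (D : M.Dofs k ℓ)

/-- `supp φ_j`, as a subset of the closed time-space cylinder. -/
def supp (j : ℝ × Space d) : Set (ℝ × Space d) :=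
  closure {z | z ∈ Icc 0 T ×ˢ closure Ω ∧ D.basis j z ≠ 0}

/-- The union of the supports of the `φ_j` with `j ∈ 𝒩(K)`, that is, with `K ⊆ supp φ_j`. -/
def suppUnion (K : Cell d) : Set (ℝ × Space d) :=
  ⋃ j ∈ {j | j ∈ D.nodes ∧ K.toSet ⊆ D.supp j}, D.supp j

/-- `ω_{K,t}` -/
def patchT (K : Cell d) : Set ℝ := Prod.fst '' D.suppUnion K

/-- `ω_{K,x}` -/
def patchX (K : Cell d) : Set (Space d) := Prod.snd '' D.suppUnion K

/-- `ω_K = ω_{K,t} × ω_{K,x}`, the smallest cylinder that contains the supports of all `φ_j` with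
`j ∈ 𝒩(K)`. -/
def patch (K : Cell d) : Set (ℝ × Space d) := D.patchT K ×ˢ D.patchX K

/-- The quantitative assumptions on mesh and degrees of freedom, with constant `κ`. In
`patchT_le` and `patchX_le` the reverse bounds hold as `K ⊆ ω_K`. -/
structure IsRegular (κ : ℝ) : Prop where
  /-- shape regularity of the simplices -/
  shape : ∀ K ∈ M.cells, ∃ c, Metric.closedBall c (K.hx / κ) ⊆ K.spaceSet
  /-- local grading in time -/
  grading_t : ∀ K ∈ M.cells, ∀ K' ∈ M.cells, K'.toSet ⊆ D.patch K →
    K'.ht ≤ κ * K.ht ∧ K.ht ≤ κ * K'.ht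
  /-- local grading in space -/
  grading_x : ∀ K ∈ M.cells, ∀ K' ∈ M.cells, K'.toSet ⊆ D.patch K →
    K'.hx ≤ κ * K.hx ∧ K.hx ≤ κ * K'.hx
  /-- size of the patch in time -/
  patchT_le : ∀ K ∈ M.cells, volume (D.patchT K) ≤ ENNReal.ofReal (κ * K.ht)
  /-- size of the patch in space -/
  patchX_le : ∀ K ∈ M.cells, volume (D.patchX K) ≤ ENNReal.ofReal ((κ * K.hx) ^ d)
  /-- the nodal basis functions are uniformly bounded -/
  basis_le : ∀ j ∈ D.nodes, ∀ z ∈ Icc 0 T ×ˢ closure Ω, |D.basis j z| ≤ κ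
  /-- the spatial patches have no degenerating bottlenecks: the simplices in a patch are joined by
  a connected set that stays away from the boundary of the patch -/
  joined : ∀ K ∈ M.cells, ∃ Γ : Set (Space d), IsConnected Γ ∧
    (∀ x ∈ Γ, Metric.closedBall x (K.hx / κ) ⊆ D.patchX K) ∧
    ∀ K' ∈ M.cells, K'.toSet ⊆ D.patch K → (Γ ∩ K'.spaceSet).Nonempty
  /-- the boundary of `Ω` is resolved by facets: no facet lies partly on `∂Ω` -/
  boundary : ∀ K ∈ M.cells, ∀ i : Fin (d + 1), K.facet i ⊆ frontier Ω ∨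
    Measure.hausdorffMeasure ((d : ℝ) - 1) (K.facet i ∩ frontier Ω) = 0

open Classical in
/-- The value that is prescribed at the node `j`: zero on the lateral boundary and
`(Π_{K(j)} v)(j)` otherwise, where `K(j) = loc j`. -/
def nodalValue (D : M.Dofs k ℓ) (loc : ℝ × Space d → Cell d) (v : ℝ × Space d → ℝ)
    (j : ℝ × Space d) : ℝ :=
  if j ∈ D.nodes ∧ j.2 ∉ frontier Ω then l2Proj k ℓ (loc j).toSet v j else 0

/-- The operator `I_X`: the discrete function with the prescribed nodal values. -/
def interp (loc : ℝ × Space d → Cell d) (v : ℝ × Space d → ℝ) : ℝ × Space d → ℝ :=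
  fun z => ∑ j ∈ D.nodes, D.nodalValue loc v j * D.basis j z

end Dofs

end Mesh

end SpaceTime

end

noncomputable section

namespace SpaceTime

/-! ### Tensor product polynomials -/

/-! The operator reproduces `X_h`. A function in `X_h` is a polynomial on `K(j)`, so the local
projection returns its value at `j`. At lateral nodes it is zero: it is continuous up to the
boundary and almost all its time slices lie in `H¹₀(Ω)` (`HasH10Grad.eq_zero_of_mem_frontier`).
Expansion in the nodal basis gives `Mesh.Dofs.interp_eqOn`. Hence `v - I v = w - I w` on the
cylinder for `w = v - v_h`, and only stability is left: the derivatives of `I w` on `K` have to be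
bounded by the anisotropic energy `h_t ‖∂ₜw‖ + h_x ‖∇ₓw‖` on `ω_K`.

Constants belong to `S_h`, so the `φ_j` with `j ∈ 𝒩(K)` sum to one on `K`, and there `I w - c = ∑
(a_j - c) φ_j` for every constant `c`, where `a_j` are the nodal values. The inverse estimate
`exists_inverse_estimate` reduces the derivatives to the numbers `|a_j - c|`. At a node off the
lateral boundary, the same estimate on `K(j)` and the contraction property of the `L²` projection
bound `|a_j - c|²` by the mean of `|w - c|²` over `K(j)`. This cell lies in `ω_K`: as `φ_j(j) = 1`,
the polynomial `φ_j` does not vanish on any open part of `K(j)`. The number of terms is bounded by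
counting volumes and dimensions. At a lateral node `a_j = 0`, so `c = 0` is forced once `𝒩(K)`
contains such a node. What remains is a Poincaré–Friedrichs inequality on `ω_K`
(`exists_const_approx`).

The patch need not be convex. The inequality is therefore stated for the mean square difference
`msd` of `w` between two sets, which obeys a triangle inequality with factor 2. If both sets lie in
a convex set, it follows from the fundamental theorem of calculus along translations. Cylinders over
the time patch, whose spatial balls are centred on the connected set `Γ`, are linked by a chain
whose length is bounded by a packing argument. A cell is linked to such a cylinder by moving its
inscribed ball close to a point of `Γ` in the cell (`exists_msd_cells_le`). Convexity of these
cylinders needs `ω_{K,t}` to be an interval. It is one, since a part of `φ_j` separated from `j` by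
a gap in time would be a nonzero discrete function that vanishes at all nodes.

If `𝒩(K)` has a lateral node `j`, some cell of the patch has a facet on `∂Ω`: near `j`, facets of
the cells containing `j` cover `∂Ω`, and `∂Ω` has positive `(d-1)`-dimensional measure there because
its projection to a hyperplane contains a ball. On that cell Friedrichs' inequality holds, by
sliding points along one edge direction until they reach the facet. -/

theorem tensorPoly_induction {d k ℓ : ℕ} {P : (ℝ × Space d → ℝ) → Prop}
    (hgen : ∀ (p : Polynomial ℝ) (q : MvPolynomial (Fin d) ℝ), p.natDegree ≤ k →
      q.totalDegree ≤ ℓ → P (fun z => p.eval z.1 * MvPolynomial.eval (fun i => z.2 i) q))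
    (hzero : P 0) (hadd : ∀ f g, P f → P g → P (f + g)) (hsmul : ∀ (c : ℝ) f, P f → P (c • f))
    {f : ℝ × Space d → ℝ} (hf : f ∈ tensorPoly d k ℓ) : P f := by
  refine Submodule.span_induction ?_ hzero (fun f g _ _ => hadd f g) (fun c f _ => hsmul c f) hf
  rintro _ ⟨p, q, hp, hq, rfl⟩
  exact hgen p q hp hq

theorem analyticOnNhd_of_mem_tensorPoly {d k ℓ : ℕ} {f : ℝ × Space d → ℝ}
    (hf : f ∈ tensorPoly d k ℓ) : AnalyticOnNhd ℝ f univ := by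
  refine tensorPoly_induction (P := fun f => AnalyticOnNhd ℝ f univ) ?_ analyticOnNhd_const
    (fun f g hf hg => hf.add hg) (fun c f hf => (analyticOnNhd_const (v := c)).smul hf) hf
  intro p q _ _
  refine AnalyticOnNhd.mul ?_ ?_
  · simpa [Polynomial.coe_aeval_eq_eval] using
      AnalyticOnNhd.aeval_polynomial (𝕜 := ℝ) (s := univ) (f := fun z : ℝ × Space d => z.1)
        analyticOnNhd_fst p
  · exact AnalyticOnNhd.eval_continuousLinearMap' (𝕜 := ℝ) (E := ℝ × Space d)
      (fun i => (EuclideanSpace.proj i).comp (ContinuousLinearMap.snd ℝ ℝ (Space d))) q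

theorem contDiff_of_mem_tensorPoly {d k ℓ : ℕ} {f : ℝ × Space d → ℝ}
    (hf : f ∈ tensorPoly d k ℓ) : ContDiff ℝ ∞ f :=
  (analyticOnNhd_of_mem_tensorPoly hf).contDiff

theorem continuous_of_mem_tensorPoly {d k ℓ : ℕ} {f : ℝ × Space d → ℝ}
    (hf : f ∈ tensorPoly d k ℓ) : Continuous f :=
  (contDiff_of_mem_tensorPoly hf).continuous

/-- Identity theorem for analytic functions. It makes the `L²` norm on a cell definite on
polynomials, and it forces the support of a basis function to contain each cell on which the
function is not identically zero. -/
theorem eq_zero_of_mem_tensorPoly {d k ℓ : ℕ} {f : ℝ × Space d → ℝ}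
    (hf : f ∈ tensorPoly d k ℓ) {U : Set (ℝ × Space d)} (hU : IsOpen U) (hne : U.Nonempty)
    (h : EqOn f 0 U) : f = 0 := by
  obtain ⟨z, hz⟩ := hne
  have := (analyticOnNhd_of_mem_tensorPoly hf).eqOn_zero_of_preconnected_of_eventuallyEq_zero
    isPreconnected_univ (mem_univ z) (h.eventuallyEq_of_mem (hU.mem_nhds hz))
  funext x
  exact this (mem_univ x)

/-- The product of polynomials in time and in space, as a bilinear map. -/
def tensorMap (d : ℕ) :
    Polynomial ℝ →ₗ[ℝ] MvPolynomial (Fin d) ℝ →ₗ[ℝ] (ℝ × Space d → ℝ) :=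
  LinearMap.mk₂ ℝ (fun p q z => p.eval z.1 * MvPolynomial.eval (fun i => z.2 i) q)
    (fun p p' q => by ext; simp [add_mul]) (fun c p q => by ext; simp [mul_assoc])
    (fun p q q' => by ext; simp [mul_add]) (fun c p q => by ext; simp; ring)

instance finiteDimensional_tensorPoly (d k ℓ : ℕ) :
    FiniteDimensional ℝ (tensorPoly d k ℓ) := by
  have h : tensorPoly d k ℓ = Submodule.map₂ (tensorMap d) (Polynomial.degreeLT ℝ (k + 1))
      (MvPolynomial.restrictTotalDegree (Fin d) ℝ ℓ) := by
    rw [Submodule.map₂_eq_span_image2, tensorPoly]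
    congr 1
    ext f
    simp only [mem_ofPred_eq, mem_image2, SetLike.mem_coe, MvPolynomial.mem_restrictTotalDegree]
    constructor
    · rintro ⟨p, q, hp, hq, rfl⟩
      refine ⟨p, ?_, q, hq, rfl⟩
      rw [Polynomial.mem_degreeLT]
      exact lt_of_le_of_lt Polynomial.degree_le_natDegree (by exact_mod_cast Nat.lt_succ_of_le hp)
    · rintro ⟨p, hp, q, hq, rfl⟩
      refine ⟨p, q, ?_, hq, rfl⟩
      rw [Polynomial.mem_degreeLT, Polynomial.degree_lt_iff_coeff_zero] at hp
      exact Polynomial.natDegree_le_iff_coeff_eq_zero.2 fun m hm => hp m hm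
  rw [h]
  refine Module.Finite.of_fg (Submodule.FG.map₂ _ ?_ ?_)
  · exact Module.Finite.iff_fg.1 inferInstance
  · exact Module.Finite.iff_fg.1 inferInstance

theorem const_mem_tensorPoly (d k ℓ : ℕ) (c : ℝ) : (fun _ => c) ∈ tensorPoly d k ℓ := by
  refine Submodule.subset_span ⟨Polynomial.C c, 1, by simp, by simp, ?_⟩
  ext z
  simp

theorem totalDegree_aeval_affine_le {d ℓ : ℕ} (c : Fin d → ℝ) (h : ℝ)
    {q : MvPolynomial (Fin d) ℝ} (hq : q.totalDegree ≤ ℓ) :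
    (MvPolynomial.aeval (fun i => MvPolynomial.C (c i) + MvPolynomial.C h * MvPolynomial.X i)
      q : MvPolynomial (Fin d) ℝ).totalDegree ≤ ℓ := by
  classical
  rw [MvPolynomial.aeval_def, MvPolynomial.eval₂_eq]
  refine (MvPolynomial.totalDegree_finsetSum _ _).trans (Finset.sup_le fun s hs => ?_)
  refine (MvPolynomial.totalDegree_mul _ _).trans ?_
  rw [MvPolynomial.algebraMap_eq, MvPolynomial.totalDegree_C, zero_add]
  refine (MvPolynomial.totalDegree_finsetProd _ _).trans ?_
  refine le_trans (Finset.sum_le_sum (g := fun i => s i) fun i _ => ?_)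
    ((MvPolynomial.le_totalDegree hs).trans hq)
  refine (MvPolynomial.totalDegree_pow _ _).trans ?_
  refine le_trans (Nat.mul_le_mul_left _ (?_ : _ ≤ 1)) (by simp)
  refine (MvPolynomial.totalDegree_add _ _).trans ?_
  rw [MvPolynomial.totalDegree_C, max_eq_right (Nat.zero_le _)]
  refine (MvPolynomial.totalDegree_mul _ _).trans ?_
  rw [MvPolynomial.totalDegree_C, MvPolynomial.totalDegree_X]

/-- The homothety `(s, y) ↦ (a + h s, c + h' y)`. -/
def homothety {d : ℕ} (a h : ℝ) (c : Space d) (h' : ℝ) (z : ℝ × Space d) : ℝ × Space d :=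
  (a + h * z.1, c + h' • z.2)

/-- Substituting affine polynomials for the variables does not raise degrees, so estimates for
polynomials can be proved at unit scale. -/
theorem comp_homothety_mem_tensorPoly {d k ℓ : ℕ} (a h : ℝ) (c : Space d) (h' : ℝ)
    {f : ℝ × Space d → ℝ} (hf : f ∈ tensorPoly d k ℓ) :
    f ∘ homothety a h c h' ∈ tensorPoly d k ℓ := by
  refine tensorPoly_induction (P := fun f => f ∘ homothety a h c h' ∈ tensorPoly d k ℓ) ?_
    (Submodule.zero_mem _) (fun f g hf hg => Submodule.add_mem _ hf hg)
    (fun r f hf => Submodule.smul_mem _ r hf) hf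
  intro p q hp hq
  refine Submodule.subset_span ⟨p.comp (Polynomial.C a + Polynomial.C h * Polynomial.X),
    MvPolynomial.aeval (fun i => MvPolynomial.C (c i) + MvPolynomial.C h' * MvPolynomial.X i) q,
    ?_, totalDegree_aeval_affine_le _ _ hq, ?_⟩
  · refine Polynomial.natDegree_comp_le.trans ?_
    refine le_trans (Nat.mul_le_mul_left _ (?_ : _ ≤ 1)) (by simpa using hp)
    compute_degree
  · funext z
    simp only [homothety, Function.comp, Polynomial.eval_comp, Polynomial.eval_add,
      Polynomial.eval_C, Polynomial.eval_mul, Polynomial.eval_X, PiLp.add_apply, PiLp.smul_apply,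
      smul_eq_mul]
    congr 1
    rw [MvPolynomial.aeval_def, MvPolynomial.eval_eval₂, MvPolynomial.eval, MvPolynomial.coe_eval₂Hom]
    congr 1
    · ext; simp
    · funext i; simp

/-! ### Inverse estimates and local projections -/

theorem memLp_two_of_continuous {E F : Type*} [MeasurableSpace E] [TopologicalSpace E]
    [OpensMeasurableSpace E] [SecondCountableTopology E] [NormedAddCommGroup F]
    {μ : Measure E} [IsFiniteMeasureOnCompacts μ] {f : E → F} (hf : Continuous f)
    {S : Set E} (hS : IsCompact S) (hSm : MeasurableSet S) :
    MemLp f 2 (μ.restrict S) := by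
  have : IsFiniteMeasure (μ.restrict S) := ⟨by simpa using hS.measure_lt_top⟩
  obtain ⟨C, hC⟩ := hS.exists_bound_of_continuousOn hf.continuousOn
  refine MemLp.of_bound ?_ C ?_
  · exact hf.continuousOn.aestronglyMeasurable_of_isCompact hS hSm
  · exact (ae_restrict_iff' hSm).2 (ae_of_all _ hC)

/-- The embedding of polynomials into `L²(S)`. -/
def tensorPolyToLp (d k ℓ : ℕ) {S : Set (ℝ × Space d)} (hS : IsCompact S) :
    tensorPoly d k ℓ →ₗ[ℝ] Lp ℝ 2 ((volume : Measure (ℝ × Space d)).restrict S) where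
  toFun f := (memLp_two_of_continuous (continuous_of_mem_tensorPoly f.2) hS
    hS.measurableSet).toLp f.1
  map_add' _ _ := rfl
  map_smul' _ _ := rfl

theorem inner_toLp {α : Type*} [MeasurableSpace α] {μ : Measure α} {f g : α → ℝ}
    (hf : MemLp f 2 μ) (hg : MemLp g 2 μ) :
    inner ℝ (hf.toLp f) (hg.toLp g) = ∫ z, f z * g z ∂μ := by
  rw [L2.inner_def]
  refine integral_congr_ae ?_
  filter_upwards [hf.coeFn_toLp, hg.coeFn_toLp] with z h1 h2
  rw [h1, h2]
  simp [mul_comm]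

theorem eq_zero_of_tensorPolyToLp_eq_zero {d k ℓ : ℕ} {S : Set (ℝ × Space d)} (hS : IsCompact S)
    (hne : (interior S).Nonempty) (f : tensorPoly d k ℓ) (h : tensorPolyToLp d k ℓ hS f = 0) :
    f = 0 := by
  have h1 : f.1 =ᵐ[volume.restrict S] 0 := by
    have := (memLp_two_of_continuous (continuous_of_mem_tensorPoly f.2) hS
      hS.measurableSet).coeFn_toLp (μ := (volume : Measure (ℝ × Space d)).restrict S)
    refine this.symm.trans ?_
    change (tensorPolyToLp d k ℓ hS f : ℝ × Space d → ℝ) =ᵐ[_] 0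
    rw [h]
    exact Lp.coeFn_zero _ _ _
  have h2 : f.1 =ᵐ[volume.restrict (interior S)] 0 :=
    ae_restrict_of_ae_restrict_of_subset interior_subset h1
  have h3 := Measure.eqOn_open_of_ae_eq h2 isOpen_interior
    (continuous_of_mem_tensorPoly f.2).continuousOn continuousOn_const
  exact Subtype.ext (eq_zero_of_mem_tensorPoly f.2 isOpen_interior hne h3)

/-- Norm equivalence on the polynomials: values and derivatives on a compact set are bounded by the
`L²` norm on a set with nonempty interior. -/
theorem exists_bound_tensorPoly (d k ℓ : ℕ) {R S : Set (ℝ × Space d)} (hR : IsCompact R)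
    (hS : IsCompact S) (hne : (interior S).Nonempty) :
    ∃ C : ℝ, 0 ≤ C ∧ ∀ f ∈ tensorPoly d k ℓ, ∀ z ∈ R,
      f z ^ 2 ≤ C * ∫ y in S, f y ^ 2 ∧ ‖fderiv ℝ f z‖ ^ 2 ≤ C * ∫ y in S, f y ^ 2 := by
  set b := Module.finBasis ℝ (tensorPoly d k ℓ) with hb
  set n := Module.finrank ℝ (tensorPoly d k ℓ) with hn
  let T : (Fin n → ℝ) →ₗ[ℝ] Lp ℝ 2 ((volume : Measure (ℝ × Space d)).restrict S) :=
    (tensorPolyToLp d k ℓ hS).comp b.equivFun.symm.toLinearMap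
  have hT : LinearMap.ker T = ⊥ := by
    rw [LinearMap.ker_eq_bot']
    intro c hc
    have := eq_zero_of_tensorPolyToLp_eq_zero hS hne _ hc
    exact b.equivFun.symm.map_eq_zero_iff.1 this
  -- An injective linear map on a finite-dimensional space is bounded below, so the coefficients are
  -- controlled by the `L²(S)` norm.
  obtain ⟨A, -, hA⟩ := LinearMap.exists_antilipschitzWith T hT
  have hA' : ∀ c, ‖c‖ ≤ A * ‖T c‖ := fun c => by
    have := hA.le_mul_dist c 0
    simpa [dist_eq_norm] using this
  have hB : ∀ i, ∃ B : ℝ, 0 ≤ B ∧ ∀ z ∈ R, |(b i).1 z| ≤ B ∧ ‖fderiv ℝ (b i).1 z‖ ≤ B := by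
    intro i
    obtain ⟨B1, h1⟩ := hR.exists_bound_of_continuousOn
      (continuous_of_mem_tensorPoly (b i).2).continuousOn
    obtain ⟨B2, h2⟩ := hR.exists_bound_of_continuousOn
      ((contDiff_of_mem_tensorPoly (b i).2).continuous_fderiv (by simp)).continuousOn
    refine ⟨max 0 (max B1 B2), le_max_left _ _, fun z hz => ⟨(h1 z hz).trans ?_, (h2 z hz).trans ?_⟩⟩
    · exact (le_max_left _ _).trans (le_max_right _ _)
    · exact (le_max_right _ _).trans (le_max_right _ _)
  choose B hB0 hB using hB
  refine ⟨(A * ∑ i, B i) ^ 2, sq_nonneg _, fun f hf z hz => ?_⟩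
  set c := b.equivFun ⟨f, hf⟩ with hc
  have hfc : f = ∑ i, c i • (b i).1 := by
    have h := b.sum_equivFun ⟨f, hf⟩
    have h' := congrArg Subtype.val h
    rw [Submodule.coe_sum] at h'
    exact h'.symm
  have hTc : ‖T c‖ ^ 2 = ∫ y in S, f y ^ 2 := by
    have hTc' : T c = (memLp_two_of_continuous (continuous_of_mem_tensorPoly hf) hS
      hS.measurableSet).toLp f := by
      simp only [T, LinearMap.comp_apply, hc, LinearEquiv.coe_coe, LinearEquiv.symm_apply_apply]
      rfl
    rw [hTc', ← real_inner_self_eq_norm_sq, inner_toLp]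
    simp_rw [sq]
  have hsum : ∑ i, |c i| * B i ≤ A * (∑ i, B i) * ‖T c‖ := by
    calc ∑ i, |c i| * B i ≤ ∑ i, ‖c‖ * B i :=
          Finset.sum_le_sum fun i _ => mul_le_mul_of_nonneg_right (norm_le_pi_norm c i) (hB0 i)
      _ = ‖c‖ * ∑ i, B i := by rw [Finset.mul_sum]
      _ ≤ (A * ‖T c‖) * ∑ i, B i :=
          mul_le_mul_of_nonneg_right (hA' c) (Finset.sum_nonneg fun i _ => hB0 i)
      _ = _ := by ring
  rw [← hTc, ← mul_pow]
  constructor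
  · rw [← sq_abs (f z)]
    refine pow_le_pow_left₀ (abs_nonneg _) (le_trans ?_ hsum) 2
    rw [hfc]
    simp only [Finset.sum_apply, Pi.smul_apply, smul_eq_mul]
    refine (Finset.abs_sum_le_sum_abs _ _).trans (Finset.sum_le_sum fun i _ => ?_)
    rw [abs_mul]
    exact mul_le_mul_of_nonneg_left (hB i z hz).1 (abs_nonneg _)
  · refine pow_le_pow_left₀ (norm_nonneg _) (le_trans ?_ hsum) 2
    have hd : ∀ i, DifferentiableAt ℝ (b i).1 z := fun i =>
      (contDiff_of_mem_tensorPoly (b i).2).differentiable (by simp) z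
    rw [hfc, fderiv_sum fun i _ => (hd i).const_smul (c i)]
    refine (norm_sum_le _ _).trans (Finset.sum_le_sum fun i _ => ?_)
    rw [fderiv_const_smul (hd i), norm_smul]
    exact mul_le_mul_of_nonneg_left (hB i z hz).2 (norm_nonneg _)

theorem hasFDerivAt_homothety {d : ℕ} (a h : ℝ) (c : Space d) (h' : ℝ) (z : ℝ × Space d) :
    HasFDerivAt (homothety a h c h') ((h • ContinuousLinearMap.fst ℝ ℝ (Space d)).prod
      (h' • ContinuousLinearMap.snd ℝ ℝ (Space d))) z := by
  refine HasFDerivAt.prodMk ?_ ?_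
  · exact ((ContinuousLinearMap.fst ℝ ℝ (Space d)).hasFDerivAt.const_mul h).const_add a
  · exact ((ContinuousLinearMap.snd ℝ ℝ (Space d)).hasFDerivAt.const_smul h').const_add c

theorem homothety_eq {d : ℕ} (a h : ℝ) (c : Space d) (h' : ℝ) :
    homothety a h c h' = Prod.map (fun t => a + h * t) (fun x => c + h' • x) := rfl

theorem homothety_preimage {d : ℕ} (a : ℝ) {h : ℝ} (c : Space d) {h' : ℝ} (hh : 0 < h)
    (hh' : 0 < h') (r : ℝ) :
    homothety a h c h' ⁻¹' (Icc a (a + h) ×ˢ Metric.closedBall c (h' * r)) =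
      Icc 0 1 ×ˢ Metric.closedBall (0 : Space d) r := by
  ext ⟨s, y⟩
  have h1 : h * s ≤ h ↔ s ≤ 1 := by
    constructor <;> intro h2 <;> nlinarith
  simp [homothety, dist_eq_norm, norm_smul, abs_of_pos hh', mul_le_mul_iff_right₀ hh',
    mul_nonneg_iff_of_pos_left hh, h1]

theorem map_homothety_volume {d : ℕ} (a : ℝ) {h : ℝ} (c : Space d) {h' : ℝ} (hh : 0 < h)
    (hh' : 0 < h') : Measure.map (homothety a h c h') (volume : Measure (ℝ × Space d)) =
      ENNReal.ofReal ((h * h' ^ d)⁻¹) • volume := by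
  have e1 : Measure.map (fun t : ℝ => a + h * t) volume = ENNReal.ofReal h⁻¹ • volume := by
    rw [show (fun t : ℝ => a + h * t) = (fun t => a + t) ∘ (fun t => h * t) from rfl,
      ← Measure.map_map (measurable_const_add a) (measurable_const_mul h),
      Real.map_volume_mul_left hh.ne', Measure.map_smul, map_add_left_eq_self,
      abs_of_pos (inv_pos.2 hh)]
  have e2 : Measure.map (fun x : Space d => c + h' • x) volume =
      ENNReal.ofReal (h' ^ d)⁻¹ • volume := by
    rw [show (fun x : Space d => c + h' • x) = (fun x => c + x) ∘ (fun x => h' • x) from rfl,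
      ← Measure.map_map (measurable_const_add c) (measurable_const_smul h'),
      Measure.map_addHaar_smul _ hh'.ne', Measure.map_smul, map_add_left_eq_self,
      finrank_euclideanSpace, Fintype.card_fin, abs_of_pos (by positivity)]
  rw [homothety_eq, Measure.volume_eq_prod, ← Measure.map_prod_map _ _ (by fun_prop) (by fun_prop),
    e1, e2, Measure.prod_smul_left, Measure.prod_smul_right, smul_smul,
    ← ENNReal.ofReal_mul (by positivity), mul_inv]

theorem measurableEmbedding_homothety {d : ℕ} (a : ℝ) {h : ℝ} (c : Space d) {h' : ℝ} (hh : 0 < h)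
    (hh' : 0 < h') : MeasurableEmbedding (homothety a h c h') := by
  have hc : Continuous (homothety a h c h') := by unfold homothety; fun_prop
  refine hc.measurableEmbedding ?_
  rintro ⟨s, y⟩ ⟨s', y'⟩ h1
  simp only [homothety, Prod.mk.injEq, add_right_inj] at h1
  exact Prod.ext (mul_left_cancel₀ hh.ne' h1.1) (smul_right_injective _ hh'.ne' h1.2)

theorem setIntegral_homothety {d : ℕ} (a : ℝ) {h : ℝ} (c : Space d) {h' : ℝ} (hh : 0 < h)
    (hh' : 0 < h') (f : ℝ × Space d → ℝ) (r : ℝ) :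
    ∫ z in Icc 0 1 ×ˢ Metric.closedBall (0 : Space d) r, f (homothety a h c h' z) =
      (h * h' ^ d)⁻¹ * ∫ z in Icc a (a + h) ×ˢ Metric.closedBall c (h' * r), f z := by
  rw [← homothety_preimage a c hh hh' r,
    ← (measurableEmbedding_homothety a c hh hh').setIntegral_map, map_homothety_volume a c hh hh',
    Measure.restrict_smul, integral_smul_measure, ENNReal.toReal_ofReal (by positivity),
    smul_eq_mul]

/-- The classical spatial gradient of a function on time-space. -/
def gradX {d : ℕ} (f : ℝ × Space d → ℝ) (z : ℝ × Space d) : Space d :=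
  (InnerProductSpace.toDual ℝ (Space d)).symm
    ((fderiv ℝ f z).comp (ContinuousLinearMap.inr ℝ ℝ (Space d)))

theorem gradX_apply {d : ℕ} (f : ℝ × Space d → ℝ) (z : ℝ × Space d) (i : Fin d) :
    gradX f z i = fderiv ℝ f z (0, EuclideanSpace.single i 1) := by
  have h : inner ℝ (gradX f z) (EuclideanSpace.single i (1 : ℝ)) =
      fderiv ℝ f z (0, EuclideanSpace.single i 1) := by
    simp [gradX]
  rw [← h, real_inner_comm, EuclideanSpace.inner_single_left]
  simp

theorem norm_gradX {d : ℕ} (f : ℝ × Space d → ℝ) (z : ℝ × Space d) :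
    ‖gradX f z‖ = ‖(fderiv ℝ f z).comp (ContinuousLinearMap.inr ℝ ℝ (Space d))‖ := by
  simp [gradX]

theorem continuous_gradX {d : ℕ} {f : ℝ × Space d → ℝ} (hf : ContDiff ℝ 1 f) :
    Continuous (gradX f) := by
  have h : Continuous fun z => (fderiv ℝ f z).comp (ContinuousLinearMap.inr ℝ ℝ (Space d)) :=
    (hf.continuous_fderiv (n := 1) one_ne_zero).clm_comp continuous_const
  exact (InnerProductSpace.toDual ℝ (Space d)).symm.isometry.continuous.comp h

/-! ### Geometry of a single cell. -/

namespace Cell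

variable {d : ℕ} (K : Cell d)

theorem isCompact_spaceSet : IsCompact K.spaceSet :=
  (finite_range _).isCompact_convexHull ℝ

theorem convex_spaceSet : Convex ℝ K.spaceSet := convex_convexHull _ _

theorem isCompact_toSet : IsCompact K.toSet := isCompact_Icc.prod K.isCompact_spaceSet

theorem convex_toSet : Convex ℝ K.toSet := (convex_Icc _ _).prod K.convex_spaceSet

theorem ht_pos : 0 < K.ht := sub_pos.2 K.lt

theorem simplex_mem_spaceSet (i : Fin (d + 1)) : K.simplex.points i ∈ K.spaceSet :=
  subset_convexHull _ _ (mem_range_self i)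

theorem dist_le_hx {x y : Space d} (hx : x ∈ K.spaceSet) (hy : y ∈ K.spaceSet) :
    dist x y ≤ K.hx := Metric.dist_le_diam_of_mem K.isCompact_spaceSet.isBounded hx hy

theorem hx_pos (hd : 1 ≤ d) : 0 < K.hx := by
  have hne : K.simplex.points 0 ≠ K.simplex.points (Fin.last d) :=
    K.simplex.independent.injective.ne (by
      rw [Ne, Fin.ext_iff]; simp; omega)
  exact (dist_pos.2 hne).trans_le (K.dist_le_hx (K.simplex_mem_spaceSet _)
    (K.simplex_mem_spaceSet _))

/-- `K_x` contains a ball of radius `h_x(K) / κ`. -/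
def ShapeRegular (κ : ℝ) : Prop := ∃ c, Metric.closedBall c (K.hx / κ) ⊆ K.spaceSet

theorem interior_toSet : interior K.toSet = Ioo K.a K.b ×ˢ interior K.spaceSet := by
  rw [toSet, timeSet, interior_prod_eq, interior_Icc]

variable {K}

theorem ShapeRegular.interior_nonempty (hd : 1 ≤ d) {κ : ℝ} (hκ : 1 ≤ κ)
    (hK : K.ShapeRegular κ) : (interior K.spaceSet).Nonempty := by
  obtain ⟨c, hc⟩ := hK
  exact ⟨c, interior_mono hc (Metric.ball_subset_interior_closedBall
    (Metric.mem_ball_self (div_pos (K.hx_pos hd) (by linarith))))⟩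

theorem ShapeRegular.interior_toSet_nonempty (hd : 1 ≤ d) {κ : ℝ} (hκ : 1 ≤ κ)
    (hK : K.ShapeRegular κ) : (interior K.toSet).Nonempty := by
  rw [K.interior_toSet]
  exact (nonempty_Ioo.2 K.lt).prod (hK.interior_nonempty hd hκ)

end Cell

/-- No reference simplex is used. Let `c` be the centre of the inscribed ball. The map with factor
`h_t` in time and `h_x` in space about `c` sends `[0,1] × B(0,1)` onto a set that contains `K`, and
`[0,1] × B(0,1/κ)` onto a subset of `K`. The norm equivalence between these two fixed sets gives a
constant independent of `K`. -/
theorem exists_inverse_estimate (d k ℓ : ℕ) (hd : 1 ≤ d) {κ : ℝ} (hκ : 1 ≤ κ) :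
    ∃ C : ℝ, 0 ≤ C ∧ ∀ K : Cell d, K.ShapeRegular κ → ∀ f ∈ tensorPoly d k ℓ, ∀ z ∈ K.toSet,
      f z ^ 2 ≤ C * ((K.ht * K.hx ^ d)⁻¹ * ∫ y in K.toSet, f y ^ 2) ∧
      K.hx ^ 2 * ‖gradX f z‖ ^ 2 ≤ C * ((K.ht * K.hx ^ d)⁻¹ * ∫ y in K.toSet, f y ^ 2) ∧
      K.ht ^ 2 * fderiv ℝ f z (1, 0) ^ 2 ≤
        C * ((K.ht * K.hx ^ d)⁻¹ * ∫ y in K.toSet, f y ^ 2) := by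
  have hR : IsCompact (Icc (0 : ℝ) 1 ×ˢ Metric.closedBall (0 : Space d) 1) :=
    isCompact_Icc.prod (isCompact_closedBall _ _)
  have hS : IsCompact (Icc (0 : ℝ) 1 ×ˢ Metric.closedBall (0 : Space d) κ⁻¹) :=
    isCompact_Icc.prod (isCompact_closedBall _ _)
  have hκ0 : 0 < κ⁻¹ := inv_pos.2 (by linarith)
  have hne : (interior (Icc (0 : ℝ) 1 ×ˢ Metric.closedBall (0 : Space d) κ⁻¹)).Nonempty := by
    rw [interior_prod_eq, interior_Icc]
    exact (nonempty_Ioo.2 one_pos).prod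
      ⟨0, Metric.ball_subset_interior_closedBall (Metric.mem_ball_self hκ0)⟩
  obtain ⟨C, hC0, hC⟩ := exists_bound_tensorPoly d k ℓ hR hS hne
  refine ⟨C, hC0, fun K hK f hf z hz => ?_⟩
  have hh := K.ht_pos
  have hh' := K.hx_pos hd
  obtain ⟨c, hc⟩ := hK
  have hcK : c ∈ K.spaceSet := hc (Metric.mem_closedBall_self (by positivity))
  set F := f ∘ homothety K.a K.ht c K.hx with hF
  have hFm : F ∈ tensorPoly d k ℓ := comp_homothety_mem_tensorPoly _ _ _ _ hf
  set w : ℝ × Space d := ((z.1 - K.a) / K.ht, K.hx⁻¹ • (z.2 - c)) with hw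
  have hwz : homothety K.a K.ht c K.hx w = z := by
    simp only [homothety, hw]
    refine Prod.ext ?_ ?_
    · field_simp
      ring
    · simp [smul_smul, hh'.ne']
  have hwR : w ∈ Icc (0 : ℝ) 1 ×ˢ Metric.closedBall (0 : Space d) 1 := by
    have hz1 : K.a ≤ z.1 ∧ z.1 ≤ K.b := hz.1
    refine ⟨⟨div_nonneg (by linarith) hh.le, (div_le_one hh).2 (by rw [Cell.ht]; linarith)⟩, ?_⟩
    have := K.dist_le_hx hz.2 hcK
    rw [mem_closedBall_zero_iff, norm_smul, norm_inv, Real.norm_of_nonneg hh'.le, ← dist_eq_norm]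
    exact inv_mul_le_one_of_le₀ this hh'.le
  have hint : ∫ y in Icc (0 : ℝ) 1 ×ˢ Metric.closedBall (0 : Space d) κ⁻¹, F y ^ 2 ≤
      (K.ht * K.hx ^ d)⁻¹ * ∫ y in K.toSet, f y ^ 2 := by
    have := setIntegral_homothety K.a c hh hh' (fun y => f y ^ 2) κ⁻¹
    simp only [hF, Function.comp]
    rw [this]
    refine mul_le_mul_of_nonneg_left ?_ (by positivity)
    refine setIntegral_mono_set ?_ (ae_of_all _ fun _ => sq_nonneg _) ?_
    · exact ((continuous_of_mem_tensorPoly hf).pow 2).continuousOn.integrableOn_compact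
        K.isCompact_toSet
    · refine (Set.prod_mono ?_ ?_).eventuallyLE
      · rw [Cell.ht, add_sub_cancel, Cell.timeSet]
      · rwa [← div_eq_mul_inv]
  obtain ⟨h1, h2⟩ := hC F hFm w hwR
  have hle := mul_le_mul_of_nonneg_left hint hC0
  -- The chain rule provides the weights `h_t` and `h_x` in front of the two derivatives.
  have hder : fderiv ℝ F w = (fderiv ℝ f z).comp ((K.ht • ContinuousLinearMap.fst ℝ ℝ (Space d)).prod
      (K.hx • ContinuousLinearMap.snd ℝ ℝ (Space d))) := by
    have hd1 : HasFDerivAt f (fderiv ℝ f z) (homothety K.a K.ht c K.hx w) := by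
      rw [hwz]
      exact ((contDiff_of_mem_tensorPoly hf).differentiable (by simp) z).hasFDerivAt
    exact (hd1.comp w (hasFDerivAt_homothety _ _ _ _ w)).fderiv
  refine ⟨?_, le_trans ?_ (h2.trans hle), le_trans ?_ (h2.trans hle)⟩
  · have : F w = f z := by rw [hF, Function.comp, hwz]
    rw [← this]
    exact h1.trans hle
  · rw [← mul_pow]
    refine pow_le_pow_left₀ (by positivity) ?_ 2
    rw [norm_gradX, ← Real.norm_of_nonneg hh'.le, ← norm_smul]
    refine ContinuousLinearMap.opNorm_le_bound _ (norm_nonneg _) fun ξ => ?_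
    have : (K.hx • (fderiv ℝ f z).comp (ContinuousLinearMap.inr ℝ ℝ (Space d))) ξ =
        fderiv ℝ F w (0, ξ) := by
      rw [hder]
      simp only [smul_apply, ContinuousLinearMap.comp_apply,
        ContinuousLinearMap.inr_apply, ContinuousLinearMap.prod_apply,
        ContinuousLinearMap.coe_fst', ContinuousLinearMap.coe_snd', smul_zero]
      rw [← map_smul]
      simp
    rw [this]
    refine (ContinuousLinearMap.le_opNorm _ _).trans (le_of_eq ?_)
    simp [Prod.norm_def]
  · rw [← mul_pow, ← sq_abs]
    refine pow_le_pow_left₀ (abs_nonneg _) ?_ 2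
    have : K.ht * fderiv ℝ f z (1, 0) = fderiv ℝ F w (1, 0) := by
      rw [hder]
      simp only [smul_apply, ContinuousLinearMap.comp_apply,
        ContinuousLinearMap.prod_apply,
        ContinuousLinearMap.coe_fst', ContinuousLinearMap.coe_snd', smul_zero]
      rw [← smul_eq_mul, ← map_smul]
      simp
    rw [this, ← Real.norm_eq_abs]
    refine (ContinuousLinearMap.le_opNorm _ _).trans (le_of_eq ?_)
    simp [Prod.norm_def]

/-- `p` is the `L²(S)`-orthogonal projection of `v` onto the polynomials. -/
def IsL2Proj {d : ℕ} (k ℓ : ℕ) (S : Set (ℝ × Space d)) (v p : ℝ × Space d → ℝ) : Prop :=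
  p ∈ tensorPoly d k ℓ ∧ ∀ q ∈ tensorPoly d k ℓ, ∫ z in S, (v z - p z) * q z = 0

/-! ### The local projection: existence, uniqueness, linearity and contraction. -/

section

variable {d k ℓ : ℕ} {S : Set (ℝ × Space d)}

theorem memLp_of_mem_tensorPoly (hS : IsCompact S) {p : ℝ × Space d → ℝ} (hp : p ∈ tensorPoly d k ℓ) :
    MemLp p 2 (volume.restrict S) :=
  memLp_two_of_continuous (continuous_of_mem_tensorPoly hp) hS hS.measurableSet

theorem exists_isL2Proj (hS : IsCompact S) (k ℓ : ℕ) {v : ℝ × Space d → ℝ} (hv : MemLp v 2 (volume.restrict S)) :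
    ∃ p, IsL2Proj k ℓ S v p := by
  obtain ⟨y, hy, z, hz, hyz⟩ := Submodule.exists_add_mem_mem_orthogonal
    (K := LinearMap.range (tensorPolyToLp d k ℓ hS)) (hv.toLp v)
  obtain ⟨p, rfl⟩ := hy
  refine ⟨p.1, p.2, fun q hq => ?_⟩
  have h1 := hz (tensorPolyToLp d k ℓ hS ⟨q, hq⟩) (LinearMap.mem_range_self _ _)
  have h2 : z = (hv.sub (memLp_of_mem_tensorPoly hS p.2)).toLp (v - p.1) := by
    rw [MemLp.toLp_sub hv (memLp_of_mem_tensorPoly hS p.2), hyz]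
    exact (add_sub_cancel_left _ _).symm
  have h3 : tensorPolyToLp d k ℓ hS ⟨q, hq⟩ = (memLp_of_mem_tensorPoly hS hq).toLp q := rfl
  rw [h2, h3, inner_toLp] at h1
  rw [← h1]
  refine integral_congr_ae (ae_of_all _ fun z => ?_)
  simp [mul_comm]

theorem IsL2Proj.unique (hS : IsCompact S) (hne : (interior S).Nonempty) {v p p' : ℝ × Space d → ℝ}
    (hv : MemLp v 2 (volume.restrict S))
    (hp : IsL2Proj k ℓ S v p) (hp' : IsL2Proj k ℓ S v p') : p = p' := by
  have hm : p' - p ∈ tensorPoly d k ℓ := Submodule.sub_mem _ hp'.1 hp.1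
  have h1 := hp.2 _ hm
  have h2 := hp'.2 _ hm
  have hpL := memLp_of_mem_tensorPoly hS hp.1
  have hpL' := memLp_of_mem_tensorPoly hS hp'.1
  have hmL := memLp_of_mem_tensorPoly hS hm
  have h3 : inner ℝ (hmL.toLp (p' - p)) (hmL.toLp (p' - p)) = 0 := by
    rw [inner_toLp, ← sub_zero (0 : ℝ)]
    nth_rewrite 1 [← h1]
    rw [← h2]
    refine Eq.trans ?_
      (integral_sub ((hv.sub hpL).integrable_mul hmL) ((hv.sub hpL').integrable_mul hmL))
    refine integral_congr_ae (ae_of_all _ fun z => ?_)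
    simp only [Pi.sub_apply]
    ring
  have h4 := eq_zero_of_tensorPolyToLp_eq_zero hS hne ⟨p' - p, hm⟩ (inner_self_eq_zero.1 h3)
  exact (sub_eq_zero.1 (congrArg Subtype.val h4)).symm

theorem isL2Proj_l2Proj (hS : IsCompact S) (k ℓ : ℕ) {v : ℝ × Space d → ℝ} (hv : MemLp v 2 (volume.restrict S)) :
    IsL2Proj k ℓ S v (l2Proj k ℓ S v) := by
  have h := exists_isL2Proj hS k ℓ hv
  have h' : ∃ p ∈ tensorPoly d k ℓ, ∀ q ∈ tensorPoly d k ℓ,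
      ∫ z in S, (v z - p z) * q z = 0 := h
  rw [l2Proj, dif_pos h']
  exact h'.choose_spec

theorem IsL2Proj.l2Proj_eq (hS : IsCompact S) (hne : (interior S).Nonempty) {v p : ℝ × Space d → ℝ}
    (hv : MemLp v 2 (volume.restrict S)) (hp : IsL2Proj k ℓ S v p) : l2Proj k ℓ S v = p :=
  (isL2Proj_l2Proj hS k ℓ hv).unique hS hne hv hp

theorem l2Proj_eq_of_eqOn (hS : IsCompact S) (hne : (interior S).Nonempty) {v p : ℝ × Space d → ℝ}
    (hp : p ∈ tensorPoly d k ℓ) (h : EqOn v p S) : l2Proj k ℓ S v = p := by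
  have hv : MemLp v 2 (volume.restrict S) :=
    (memLp_of_mem_tensorPoly hS hp).ae_eq
      ((ae_restrict_iff' hS.measurableSet).2 (ae_of_all _ fun z hz => (h hz).symm))
  refine IsL2Proj.l2Proj_eq hS hne hv ⟨hp, fun q _ => ?_⟩
  rw [setIntegral_congr_fun hS.measurableSet (g := fun _ => (0 : ℝ)) fun z hz => by
    simp [h hz]]
  simp

theorem l2Proj_congr_ae {u v : ℝ × Space d → ℝ} (h : u =ᵐ[volume.restrict S] v) :
    l2Proj k ℓ S u = l2Proj k ℓ S v := by
  have h1 : ∀ p q : ℝ × Space d → ℝ,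
      ∫ z in S, (u z - p z) * q z = ∫ z in S, (v z - p z) * q z := fun p q =>
    integral_congr_ae (by filter_upwards [h] with z hz; rw [hz])
  -- The projection is defined by a choice, and uniqueness is not available for a general `S`. The
  -- two defining predicates are shown to be equal, so that the same choice is made.
  let F (P : (ℝ × Space d → ℝ) → Prop) [Decidable (∃ p, P p)] : ℝ × Space d → ℝ :=
    if h : ∃ p, P p then h.choose else 0
  have h2 : (fun p => p ∈ tensorPoly d k ℓ ∧ ∀ q ∈ tensorPoly d k ℓ,
      ∫ z in S, (u z - p z) * q z = 0) = (fun p => p ∈ tensorPoly d k ℓ ∧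
        ∀ q ∈ tensorPoly d k ℓ, ∫ z in S, (v z - p z) * q z = 0) := by
    simp only [h1]
  classical
  exact congrArg (fun P => F P) h2

theorem l2Proj_lincomb (hS : IsCompact S) (hne : (interior S).Nonempty) {u v : ℝ × Space d → ℝ}
    (hu : MemLp u 2 (volume.restrict S)) (hv : MemLp v 2 (volume.restrict S)) (a b : ℝ) :
    l2Proj k ℓ S (a • u + b • v) = a • l2Proj k ℓ S u + b • l2Proj k ℓ S v := by
  have hpu := isL2Proj_l2Proj hS k ℓ hu
  have hpv := isL2Proj_l2Proj hS k ℓ hv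
  refine IsL2Proj.l2Proj_eq hS hne ((hu.const_smul a).add (hv.const_smul b))
    ⟨Submodule.add_mem _ (Submodule.smul_mem _ _ hpu.1) (Submodule.smul_mem _ _ hpv.1),
      fun q hq => ?_⟩
  have hqL := memLp_of_mem_tensorPoly hS hq
  have e1 := ((hu.sub (memLp_of_mem_tensorPoly hS hpu.1)).integrable_mul hqL).const_mul a
  have e2 := ((hv.sub (memLp_of_mem_tensorPoly hS hpv.1)).integrable_mul hqL).const_mul b
  have e3 := integral_add e1 e2
  rw [integral_const_mul, integral_const_mul] at e3
  simp only [Pi.mul_apply, Pi.sub_apply] at e3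
  rw [hpu.2 q hq, hpv.2 q hq, mul_zero, mul_zero, add_zero] at e3
  rw [← e3]
  refine integral_congr_ae (ae_of_all _ fun z => ?_)
  simp only [Pi.add_apply, Pi.smul_apply, smul_eq_mul]
  ring

/-- Pythagoras for `v - c = (v - p) + (p - c)`: constants are polynomials, so the second summand
lies in the space to which the first is orthogonal. -/
theorem integral_l2Proj_sub_const_sq_le (hS : IsCompact S) {v : ℝ × Space d → ℝ}
    (hv : MemLp v 2 (volume.restrict S)) (c : ℝ) :
    ∫ z in S, (l2Proj k ℓ S v z - c) ^ 2 ≤ ∫ z in S, (v z - c) ^ 2 := by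
  obtain ⟨hp, ho⟩ := isL2Proj_l2Proj hS k ℓ hv
  set p := l2Proj k ℓ S v
  set r : ℝ × Space d → ℝ := fun _ => c with hr
  have hq : p - r ∈ tensorPoly d k ℓ :=
    Submodule.sub_mem _ hp (const_mem_tensorPoly _ _ _ _)
  have hpL := memLp_of_mem_tensorPoly hS hp
  have hqL := memLp_of_mem_tensorPoly hS hq
  have h0 := ho _ hq
  have i1 := (hv.sub hpL).integrable_sq
  have i2 := hqL.integrable_sq
  have i3 := ((hv.sub hpL).integrable_mul hqL).const_mul 2
  have e : ∫ z in S, (v z - c) ^ 2 = ∫ z in S, (((v - p) z) ^ 2 + (((p - r) z) ^ 2 +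
      2 * ((v - p) * (p - r)) z)) := by
    refine integral_congr_ae (ae_of_all _ fun z => ?_)
    simp only [Pi.sub_apply, Pi.mul_apply, hr]
    ring
  have e' : ∫ z in S, ((v - p) * (p - r)) z = 0 := h0
  have e2 := integral_add i2 i3
  have e3 := integral_add i1 (i2.add i3)
  simp only [Pi.add_apply] at e3
  rw [e, e3, e2, integral_const_mul, e', mul_zero, add_zero]
  have : 0 ≤ ∫ z in S, ((v - p) z) ^ 2 := integral_nonneg fun _ => sq_nonneg _
  simp only [Pi.sub_apply, hr] at *
  linarith

end

/-! ### Translation estimates for functions with weak derivatives -/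

/-- Cauchy–Schwarz against the constant one. -/
theorem sq_lintegral_le {α : Type*} [MeasurableSpace α] {μ : Measure α} (hμ : μ univ ≤ 1)
    {f : α → ℝ≥0∞} (hf : AEMeasurable f μ) : (∫⁻ x, f x ∂μ) ^ 2 ≤ ∫⁻ x, f x ^ 2 ∂μ := by
  have h := ENNReal.lintegral_mul_le_Lp_mul_Lq μ Real.HolderConjugate.two_two hf
    (aemeasurable_const (b := (1 : ℝ≥0∞)))
  simp only [Pi.mul_apply, mul_one, ENNReal.one_rpow, lintegral_const, one_mul] at h
  have h1 : (μ univ) ^ (1 / (2 : ℝ)) ≤ 1 := ENNReal.rpow_le_one hμ (by norm_num)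
  calc (∫⁻ x, f x ∂μ) ^ 2 ≤ ((∫⁻ x, f x ^ (2 : ℝ) ∂μ) ^ (1 / (2 : ℝ))) ^ 2 :=
        pow_le_pow_left' (h.trans (mul_le_of_le_one_right' h1)) 2
    _ = ∫⁻ x, f x ^ 2 ∂μ := by
        rw [← ENNReal.rpow_natCast, ← ENNReal.rpow_mul]
        simp

section Translation

variable {E : Type*} [NormedAddCommGroup E] [NormedSpace ℝ E]

theorem IsTestFun.continuous {U : Set E} {φ : E → ℝ} (hφ : IsTestFun U φ) : Continuous φ :=
  hφ.contDiff.continuous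

theorem IsTestFun.exists_bound {U : Set E} {φ : E → ℝ} (hφ : IsTestFun U φ) :
    ∃ C, ∀ z, ‖φ z‖ ≤ C :=
  hφ.hasCompactSupport.exists_bound_of_continuous hφ.continuous

theorem IsTestFun.continuous_fderiv {U : Set E} {φ : E → ℝ} (hφ : IsTestFun U φ) :
    Continuous (fderiv ℝ φ) :=
  hφ.contDiff.continuous_fderiv (by simp)

theorem IsTestFun.exists_bound_fderiv {U : Set E} {φ : E → ℝ} (hφ : IsTestFun U φ) :
    ∃ C, ∀ z, ‖fderiv ℝ φ z‖ ≤ C :=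
  (hφ.hasCompactSupport.fderiv ℝ).exists_bound_of_continuous hφ.continuous_fderiv

theorem IsTestFun.comp_sub {U V : Set E} {φ : E → ℝ} (hφ : IsTestFun V φ) (a : E)
    (h : ∀ x ∈ V, x + a ∈ U) : IsTestFun U (fun z => φ (z - a)) := by
  have hts : tsupport (fun z => φ (z - a)) = (fun z => z - a) ⁻¹' tsupport φ :=
    tsupport_comp_eq_preimage φ (Homeomorph.subRight a)
  refine ⟨hφ.contDiff.comp (by fun_prop), ?_, ?_⟩
  · exact hφ.hasCompactSupport.comp_homeomorph (Homeomorph.subRight a)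
  · rw [hts]
    intro z hz
    simpa using h _ (hφ.tsupport_subset hz)

variable [FiniteDimensional ℝ E] [MeasurableSpace E] [BorelSpace E] {μ : Measure E}
  [μ.IsAddHaarMeasure]

/-- Fundamental theorem of calculus along a translation. Tested with `φ`, the shift moves from `w`
to `φ`, where the classical theorem applies. The weak derivative and Fubini then turn the result
back into an integral of `D`. -/
theorem ae_sub_eq_integral_of_weak_deriv {U : Set E} (hU : IsOpen U) (hc : Convex ℝ U)
    {w D : E → ℝ} (hDm : Measurable D) (hw : Integrable w μ) (hD : Integrable D μ) (h : E)
    (hweak : ∀ φ, IsTestFun U φ → ∫ z, w z * fderiv ℝ φ z h ∂μ = - ∫ z, D z * φ z ∂μ) :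
    ∀ᵐ z ∂μ, z ∈ U → z + h ∈ U → w (z + h) - w z = ∫ s in Ioc (0 : ℝ) 1, D (z + s • h) := by
  set V := U ∩ (fun z => z + h) ⁻¹' U with hV
  have hVo : IsOpen V := hU.inter (hU.preimage (by fun_prop))
  have hmeas : Measurable fun p : ℝ × E => D (p.2 + p.1 • h) := by
    have : Measurable fun p : ℝ × E => p.2 + p.1 • h := by fun_prop
    exact hDm.comp this
  have hint : ∀ ψ : E → ℝ, Continuous ψ → (∃ C, ∀ z, ‖ψ z‖ ≤ C) →
      Integrable (fun p : ℝ × E => D (p.2 + p.1 • h) * ψ p.2)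
        ((volume.restrict (Ioc (0 : ℝ) 1)).prod μ) := by
    rintro ψ hψ ⟨C, hC⟩
    have h1 : Integrable (fun p : ℝ × E => D (p.2 + p.1 • h))
        ((volume.restrict (Ioc (0 : ℝ) 1)).prod μ) := by
      rw [integrable_prod_iff hmeas.aestronglyMeasurable]
      refine ⟨ae_of_all _ fun s => hD.comp_add_right (s • h), ?_⟩
      have : ∀ s : ℝ, ∫ z, ‖D (z + s • h)‖ ∂μ = ∫ z, ‖D z‖ ∂μ := fun s =>
        integral_add_right_eq_self (fun z => ‖D z‖) (s • h)
      simp only [this]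
      exact integrable_const _
    exact h1.mul_bdd (c := C) (hψ.comp continuous_snd).aestronglyMeasurable (ae_of_all _ fun p => hC p.2)
  have hwh : Integrable (fun z => w (z + h)) μ := hw.comp_add_right h
  have hI : Integrable (fun z => ∫ s in Ioc (0 : ℝ) 1, D (z + s • h)) μ := by
    have := (hint (fun _ => 1) continuous_const ⟨1, by simp⟩).swap.integral_prod_left
    simpa using this
  have key : ∀ᵐ z ∂μ, z ∈ V → w (z + h) - w z - ∫ s in Ioc (0 : ℝ) 1, D (z + s • h) = 0 := by
    have hloc : LocallyIntegrableOn
        (fun z => w (z + h) - w z - ∫ s in Ioc (0 : ℝ) 1, D (z + s • h)) V μ :=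
      ((hwh.sub hw).sub hI).locallyIntegrable.locallyIntegrableOn V
    refine hVo.ae_eq_zero_of_integral_contDiff_smul_eq_zero hloc ?_
    intro φ hφ1 hφ2 hφ3
    have hφ : IsTestFun V φ := ⟨hφ1, hφ2, hφ3⟩
    obtain ⟨C, hC⟩ := hφ.exists_bound
    obtain ⟨C', hC'⟩ := hφ.exists_bound_fderiv
    have hcont := hφ.continuous
    have hcont' := hφ.continuous_fderiv
    have hbd : ∀ {f : E → ℝ} (a : E), Integrable f μ → Integrable (fun z => f z * φ (z - a)) μ :=
      fun a hf => hf.mul_bdd (c := C) (by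
        refine Continuous.aestronglyMeasurable ?_; fun_prop) (ae_of_all _ fun z => hC _)
    have e1 : ∫ z, w (z + h) * φ z ∂μ = ∫ z, w z * φ (z - h) ∂μ := by
      rw [← integral_add_right_eq_self (fun z => w z * φ (z - h)) h]
      simp
    have e2 : ∀ z, φ (z - h) - φ z = - ∫ s in Ioc (0 : ℝ) 1, fderiv ℝ φ (z - s • h) h := by
      intro z
      have hd : ∀ s ∈ uIcc (0 : ℝ) 1, HasDerivAt (fun s : ℝ => φ (z - s • h))
          (- fderiv ℝ φ (z - s • h) h) s := by
        intro s _
        have h1 : HasDerivAt (fun s : ℝ => z - s • h) (-h) s := by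
          simpa using ((hasDerivAt_id s).smul_const h).const_sub z
        have h2 := (hφ1.differentiable (by simp) (z - s • h)).hasFDerivAt.comp_hasDerivAt s h1
        rw [map_neg] at h2
        exact h2
      have h3 := intervalIntegral.integral_eq_sub_of_hasDerivAt hd
        (by apply Continuous.intervalIntegrable; fun_prop)
      rw [intervalIntegral.integral_of_le zero_le_one, integral_neg] at h3
      simpa using h3.symm
    have e3 : ∀ s ∈ Ioc (0 : ℝ) 1, ∫ z, w z * fderiv ℝ φ (z - s • h) h ∂μ =
        - ∫ z, D (z + s • h) * φ z ∂μ := by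
      intro s hs
      -- Convexity enters here: with `x` and `x + h` also `x + s h` lies in `U`.
      have ht : IsTestFun U (fun z => φ (z - s • h)) := by
        refine hφ.comp_sub _ fun x hx => ?_
        have := hc hx.1 hx.2 (sub_nonneg.2 hs.2) hs.1.le (by ring)
        convert this using 1
        module
      have h1 := hweak _ ht
      have h2 : ∀ z, fderiv ℝ (fun z => φ (z - s • h)) z = fderiv ℝ φ (z - s • h) := fun z => by
        rw [fderiv_comp_sub]
      simp only [h2] at h1
      rw [h1, ← integral_add_right_eq_self (fun z => D z * φ (z - s • h)) (s • h)]
      simp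
    have e4 : ∫ z, w z * (φ (z - h) - φ z) ∂μ =
        ∫ z, (∫ s in Ioc (0 : ℝ) 1, D (z + s • h)) * φ z ∂μ := by
      have i1 : Integrable (fun p : E × ℝ => w p.1 * fderiv ℝ φ (p.1 - p.2 • h) h)
          (μ.prod (volume.restrict (Ioc (0 : ℝ) 1))) := by
        refine (hw.comp_fst _).mul_bdd (c := C' * ‖h‖) ?_ (ae_of_all _ fun p => ?_)
        · refine Continuous.aestronglyMeasurable ?_
          fun_prop
        · exact (ContinuousLinearMap.le_opNorm _ _).trans
            (mul_le_mul_of_nonneg_right (hC' _) (norm_nonneg _))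
      calc ∫ z, w z * (φ (z - h) - φ z) ∂μ
          = ∫ z, (- ∫ s in Ioc (0 : ℝ) 1, w z * fderiv ℝ φ (z - s • h) h) ∂μ := by
            refine integral_congr_ae (ae_of_all _ fun z => ?_)
            simp only [e2, integral_const_mul, mul_neg]
        _ = - ∫ s in Ioc (0 : ℝ) 1, (∫ z, w z * fderiv ℝ φ (z - s • h) h ∂μ) := by
            rw [integral_neg, integral_integral_swap i1]
        _ = ∫ s in Ioc (0 : ℝ) 1, (∫ z, D (z + s • h) * φ z ∂μ) := by
            rw [setIntegral_congr_fun measurableSet_Ioc e3, integral_neg, neg_neg]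
        _ = ∫ z, (∫ s in Ioc (0 : ℝ) 1, D (z + s • h) * φ z) ∂μ :=
            integral_integral_swap (hint φ hcont ⟨C, hC⟩)
        _ = _ := by simp only [integral_mul_const]
    have i2 := hbd 0 hwh
    have i3 := hbd 0 hw
    have i4 := hbd h hw
    have i5 := hbd 0 hI
    simp only [sub_zero] at i2 i3 i5
    calc ∫ z, φ z • (w (z + h) - w z - ∫ s in Ioc (0 : ℝ) 1, D (z + s • h)) ∂μ
        = ∫ z, (w (z + h) * φ z - w z * φ z -
            (∫ s in Ioc (0 : ℝ) 1, D (z + s • h)) * φ z) ∂μ := by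
          refine integral_congr_ae (ae_of_all _ fun z => ?_)
          simp only [smul_eq_mul]
          ring
      _ = 0 := by
          have e5 := integral_sub (i2.sub i3) i5
          simp only [Pi.sub_apply] at e5
          rw [e5, integral_sub i2 i3, e1, ← integral_sub i4 i3, ← e4]
          simp only [mul_sub, sub_self]
  filter_upwards [key] with z hz h1 h2
  exact sub_eq_zero.1 (hz ⟨h1, h2⟩)

/-- Square the formula for the difference by Cauchy–Schwarz in `s`. By translation invariance every
`s` contributes the same integral of `|D|²`. -/
theorem lintegral_translate_sub_le {U : Set E} (hU : IsOpen U) (hc : Convex ℝ U)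
    {w D : E → ℝ} (hDm : Measurable D) (hw : Integrable w μ) (hD : Integrable D μ) (h : E)
    (hweak : ∀ φ, IsTestFun U φ → ∫ z, w z * fderiv ℝ φ z h ∂μ = - ∫ z, D z * φ z ∂μ) :
    ∫⁻ z in U ∩ (fun z => z + h) ⁻¹' U, ‖w (z + h) - w z‖ₑ ^ 2 ∂μ ≤ ∫⁻ z, ‖D z‖ₑ ^ 2 ∂μ := by
  have hVm : MeasurableSet (U ∩ (fun z => z + h) ⁻¹' U) :=
    (hU.inter (hU.preimage (by fun_prop))).measurableSet
  have hmeas : Measurable fun p : E × ℝ => ‖D (p.1 + p.2 • h)‖ₑ ^ 2 := by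
    have : Measurable fun p : E × ℝ => p.1 + p.2 • h := by fun_prop
    exact (hDm.comp this).enorm.pow_const 2
  have h1 : ∫⁻ z in U ∩ (fun z => z + h) ⁻¹' U, ‖w (z + h) - w z‖ₑ ^ 2 ∂μ ≤
      ∫⁻ z in U ∩ (fun z => z + h) ⁻¹' U,
        (∫⁻ s in Ioc (0 : ℝ) 1, ‖D (z + s • h)‖ₑ ^ 2) ∂μ := by
    refine lintegral_mono_ae ?_
    rw [ae_restrict_iff' hVm]
    filter_upwards [ae_sub_eq_integral_of_weak_deriv hU hc hDm hw hD h hweak] with z hz hzV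
    rw [hz hzV.1 hzV.2]
    refine (pow_le_pow_left' (enorm_integral_le_lintegral_enorm _) 2).trans
      (sq_lintegral_le (by simp) ?_)
    have : Measurable fun s : ℝ => z + s • h := by fun_prop
    exact (hDm.comp this).enorm.aemeasurable
  refine h1.trans ((setLIntegral_le_lintegral _ _).trans ?_)
  rw [lintegral_lintegral_swap hmeas.aemeasurable]
  calc ∫⁻ s in Ioc (0 : ℝ) 1, (∫⁻ z, ‖D (z + s • h)‖ₑ ^ 2 ∂μ)
      = ∫⁻ _s in Ioc (0 : ℝ) 1, (∫⁻ z, ‖D z‖ₑ ^ 2 ∂μ) := by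
        congr 1
        funext s
        exact lintegral_add_right_eq_self (fun z => ‖D z‖ₑ ^ 2) (s • h)
    _ ≤ _ := by simp

/-- The integral of `|w x - w y|²` over a product of sets is controlled by translations. -/
theorem lintegral_lintegral_sub_le {U A B H : Set E} (hA : A ⊆ U) (hB : B ⊆ U)
    (hU : MeasurableSet U) {w : E → ℝ} (hw : Measurable w) {M : ℝ≥0∞}
    (hAm : MeasurableSet A) (hBm : MeasurableSet B) (hH : MeasurableSet H)
    (hsub : ∀ x ∈ A, ∀ y ∈ B, y - x ∈ H)
    (hM : ∀ h ∈ H, ∫⁻ z in U ∩ (fun z => z + h) ⁻¹' U, ‖w (z + h) - w z‖ₑ ^ 2 ∂μ ≤ M) :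
    ∫⁻ x in A, ∫⁻ y in B, ‖w x - w y‖ₑ ^ 2 ∂μ ∂μ ≤ μ H * M := by
  have hF : Measurable fun p : E × E => (U ∩ (fun z => z + p.2) ⁻¹' U).indicator
      (fun z => ‖w (z + p.2) - w z‖ₑ ^ 2) p.1 := by
    have h1 : Measurable fun p : E × E => ‖w (p.1 + p.2) - w p.1‖ₑ ^ 2 := by fun_prop
    have h2 : MeasurableSet {p : E × E | p.1 ∈ U ∧ p.1 + p.2 ∈ U} :=
      (measurable_fst hU).inter ((measurable_fst.add measurable_snd) hU)
    exact h1.indicator h2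
  calc ∫⁻ x in A, ∫⁻ y in B, ‖w x - w y‖ₑ ^ 2 ∂μ ∂μ
      ≤ ∫⁻ x, ∫⁻ h in H, (U ∩ (fun z => z + h) ⁻¹' U).indicator
          (fun z => ‖w (z + h) - w z‖ₑ ^ 2) x ∂μ ∂μ := by
        rw [← lintegral_indicator hAm]
        refine lintegral_mono fun x => ?_
        by_cases hx : x ∈ A
        -- The substitution `y = x + h` turns the inner integral into one over translations.
        · rw [indicator_of_mem hx, ← lintegral_indicator hBm, ← lintegral_indicator hH,
            ← lintegral_add_left_eq_self _ x]
          refine lintegral_mono fun h => ?_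
          by_cases hy : x + h ∈ B
          · have hh : h ∈ H := by simpa using hsub x hx _ hy
            have hxU : x ∈ U ∩ (fun z => z + h) ⁻¹' U := ⟨hA hx, hB hy⟩
            rw [indicator_of_mem hy, indicator_of_mem hh, indicator_of_mem hxU, ← enorm_neg,
              neg_sub]
          · rw [indicator_of_notMem hy]
            exact zero_le
        · rw [indicator_of_notMem hx]
          exact zero_le
    _ = ∫⁻ h in H, ∫⁻ x, (U ∩ (fun z => z + h) ⁻¹' U).indicator
          (fun z => ‖w (z + h) - w z‖ₑ ^ 2) x ∂μ ∂μ := lintegral_lintegral_swap hF.aemeasurable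
    _ ≤ ∫⁻ _h in H, M ∂μ := by
        refine setLIntegral_mono' hH fun h hh => ?_
        rw [lintegral_indicator (hU.inter ((measurable_add_const h) hU))]
        exact hM h hh
    _ = μ H * M := by rw [setLIntegral_const, mul_comm]

end Translation

instance isAddHaarMeasure_volume {d : ℕ} :
    (volume : Measure (ℝ × Space d)).IsAddHaarMeasure := by
  rw [Measure.volume_eq_prod]
  infer_instance

theorem IsTestFun.mono {F : Type*} [NormedAddCommGroup F] [NormedSpace ℝ F] {U V : Set F}
    {φ : F → ℝ} (hφ : IsTestFun U φ) (h : U ⊆ V) : IsTestFun V φ :=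
  ⟨hφ.contDiff, hφ.hasCompactSupport, hφ.tsupport_subset.trans h⟩

theorem IsTestFun.eq_zero {F : Type*} [NormedAddCommGroup F] [NormedSpace ℝ F] {U : Set F}
    {φ : F → ℝ} (hφ : IsTestFun U φ) {z : F} (hz : z ∉ U) : φ z = 0 :=
  image_eq_zero_of_notMem_tsupport fun h => hz (hφ.tsupport_subset h)

theorem IsTestFun.fderiv_eq_zero {F : Type*} [NormedAddCommGroup F] [NormedSpace ℝ F] {U : Set F}
    {φ : F → ℝ} (hφ : IsTestFun U φ) {z : F} (hz : z ∉ U) : fderiv ℝ φ z = 0 :=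
  image_eq_zero_of_notMem_tsupport fun h => hz (hφ.tsupport_subset (tsupport_fderiv_subset ℝ h))

theorem setIntegral_mul_eq_integral_indicator_mul {α : Type*} [MeasurableSpace α] {μ : Measure α}
    {U O : Set α} (hUO : U ⊆ O) {w ψ : α → ℝ} (hψ : ∀ z ∉ U, ψ z = 0) :
    ∫ z in O, w z * ψ z ∂μ = ∫ z, U.indicator w z * ψ z ∂μ := by
  rw [setIntegral_eq_integral_of_forall_compl_eq_zero fun z hz => by
    rw [hψ z fun h => hz (hUO h), mul_zero]]
  refine integral_congr_ae (ae_of_all _ fun z => ?_)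
  by_cases hz : z ∈ U
  · simp [hz]
  · simp [hψ z hz]

theorem apply_eq_sum_single {d : ℕ} (A : ℝ × Space d →L[ℝ] ℝ) (τ : ℝ) (ξ : Space d) :
    A (τ, ξ) = τ * A (1, 0) + ∑ i, ξ i * A (0, EuclideanSpace.single i 1) := by
  have h1 : ((τ, ξ) : ℝ × Space d) =
      τ • (1, 0) + ∑ i, ξ i • ((0, EuclideanSpace.single i 1) : ℝ × Space d) := by
    refine Prod.ext ?_ ?_
    · simp [Prod.fst_sum]
    · ext j
      simp [Prod.snd_sum, Pi.single_apply]
  rw [h1, map_add, map_smul, map_sum]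
  simp only [map_smul, smul_eq_mul]

/-- Weak derivatives in all directions. -/
theorem integral_mul_fderiv_of_weak {d : ℕ} {O U : Set (ℝ × Space d)} (hU : MeasurableSet U)
    (hUO : U ⊆ O) (hfin : volume U ≠ ⊤) {w f : ℝ × Space d → ℝ} {g : ℝ × Space d → Space d}
    (hw : MemLp w 2 (volume.restrict O)) (hf : MemLp f 2 (volume.restrict O))
    (hg : MemLp g 2 (volume.restrict O)) (hwf : HasWeakDt O w f) (hwg : HasWeakGradX O w g)
    (τ : ℝ) (ξ : Space d) {φ : ℝ × Space d → ℝ} (hφ : IsTestFun U φ) :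
    ∫ z, U.indicator w z * fderiv ℝ φ z (τ, ξ) =
      - ∫ z, U.indicator (fun z => τ * f z + inner ℝ ξ (g z)) z * φ z := by
  have : IsFiniteMeasure (volume.restrict U) := ⟨by simpa using hfin.lt_top⟩
  have int : ∀ {v : ℝ × Space d → ℝ}, MemLp v 2 (volume.restrict O) →
      Integrable (U.indicator v) := fun hv =>
    (integrable_indicator_iff hU).2 ((hv.mono_measure (Measure.restrict_mono hUO le_rfl)).integrable
      (by norm_num))
  obtain ⟨C, hC⟩ := hφ.exists_bound
  obtain ⟨C', hC'⟩ := hφ.exists_bound_fderiv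
  have hcont := hφ.continuous
  have hcont' := hφ.continuous_fderiv
  have hgi : ∀ i, MemLp (fun z => g z i) 2 (volume.restrict O) := fun i =>
    (EuclideanSpace.proj (𝕜 := ℝ) i : Space d →L[ℝ] ℝ).comp_memLp' hg
  have i1 : ∀ (e : ℝ × Space d),
      Integrable (fun z => U.indicator w z * fderiv ℝ φ z e) := fun e =>
    (int hw).mul_bdd (c := C' * ‖e‖) (by apply Continuous.aestronglyMeasurable; fun_prop)
      (ae_of_all _ fun z => (ContinuousLinearMap.le_opNorm _ _).trans
        (mul_le_mul_of_nonneg_right (hC' _) (norm_nonneg _)))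
  have i2 : ∀ {v : ℝ × Space d → ℝ}, MemLp v 2 (volume.restrict O) →
      Integrable (fun z => U.indicator v z * φ z) := fun hv =>
    (int hv).mul_bdd (c := C) hcont.aestronglyMeasurable (ae_of_all _ hC)
  have hφO := hφ.mono hUO
  have e1 : ∫ z, U.indicator w z * fderiv ℝ φ z (1, 0) = - ∫ z, U.indicator f z * φ z := by
    have := hwf.2.2 φ hφO
    rwa [setIntegral_mul_eq_integral_indicator_mul hUO fun z hz => by simp [hφ.fderiv_eq_zero hz],
      setIntegral_mul_eq_integral_indicator_mul hUO fun z hz => hφ.eq_zero hz] at this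
  have e2 : ∀ i, ∫ z, U.indicator w z * fderiv ℝ φ z (0, EuclideanSpace.single i 1) =
      - ∫ z, U.indicator (fun z => g z i) z * φ z := fun i => by
    have := hwg.2.2 φ hφO i
    rwa [setIntegral_mul_eq_integral_indicator_mul hUO fun z hz => by simp [hφ.fderiv_eq_zero hz],
      setIntegral_mul_eq_integral_indicator_mul hUO fun z hz => hφ.eq_zero hz] at this
  have l1 : ∀ z, U.indicator w z * fderiv ℝ φ z (τ, ξ) =
      τ * (U.indicator w z * fderiv ℝ φ z (1, 0)) +
        ∑ i, ξ i * (U.indicator w z * fderiv ℝ φ z (0, EuclideanSpace.single i 1)) := fun z => by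
    rw [apply_eq_sum_single, mul_add, Finset.mul_sum]
    congr 1
    · ring
    · exact Finset.sum_congr rfl fun i _ => by ring
  have l2 : ∀ z, U.indicator (fun z => τ * f z + inner ℝ ξ (g z)) z * φ z =
      τ * (U.indicator f z * φ z) + ∑ i, ξ i * (U.indicator (fun z => g z i) z * φ z) := fun z => by
    by_cases hz : z ∈ U
    · simp only [indicator_of_mem hz, PiLp.inner_apply, RCLike.inner_apply, conj_trivial, add_mul,
        Finset.sum_mul]
      congr 1
      · ring
      · exact Finset.sum_congr rfl fun i _ => by ring
    · simp [indicator_of_notMem hz]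
  simp only [l1, l2]
  rw [integral_add ((i1 _).const_mul _) (integrable_finsetSum _ fun i _ => (i1 _).const_mul _),
    integral_add ((i2 hf).const_mul _) (integrable_finsetSum _ fun i _ => (i2 (hgi i)).const_mul _),
    integral_finsetSum _ fun i _ => (i1 _).const_mul _,
    integral_finsetSum _ fun i _ => (i2 (hgi i)).const_mul _]
  simp only [integral_const_mul, e1, e2, mul_neg, Finset.sum_neg_distrib]
  ring

/-- The Poincaré inequality in the form of a bound for mean square differences. -/
theorem lintegral_lintegral_sub_le_of_weak {d : ℕ} {O U A B : Set (ℝ × Space d)} (hU : IsOpen U)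
    (hc : Convex ℝ U) (hUO : U ⊆ O) (hfin : volume U ≠ ⊤) {w f : ℝ × Space d → ℝ}
    {g : ℝ × Space d → Space d} (hwm : Measurable w) (hfm : Measurable f) (hgm : Measurable g)
    (hw : MemLp w 2 (volume.restrict O)) (hf : MemLp f 2 (volume.restrict O))
    (hg : MemLp g 2 (volume.restrict O)) (hwf : HasWeakDt O w f) (hwg : HasWeakGradX O w g)
    (hA : A ⊆ U) (hB : B ⊆ U) (hAm : MeasurableSet A) (hBm : MeasurableSet B) {τ ρ : ℝ}
    (hτ : ∀ x ∈ A, ∀ y ∈ B, |y.1 - x.1| ≤ τ) (hρ : ∀ x ∈ A, ∀ y ∈ B, ‖y.2 - x.2‖ ≤ ρ) :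
    ∫⁻ x in A, ∫⁻ y in B, ‖w x - w y‖ₑ ^ 2 ≤
      volume (Icc (-τ) τ ×ˢ Metric.closedBall (0 : Space d) ρ) *
        (2 * (ENNReal.ofReal τ ^ 2 * (∫⁻ z in O, ‖f z‖ₑ ^ 2) +
          ENNReal.ofReal ρ ^ 2 * ∫⁻ z in O, ‖g z‖ₑ ^ 2)) := by
  have : IsFiniteMeasure (volume.restrict U) := ⟨by simpa using hfin.lt_top⟩
  have hUm := hU.measurableSet
  have hmono := Measure.restrict_mono hUO (le_refl (volume : Measure (ℝ × Space d)))
  -- Extension by zero outside `U` makes `w` integrable on the whole space. This is harmless because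
  -- the weak derivative is only tested with functions supported in `U`.
  have e : ∫⁻ x in A, ∫⁻ y in B, ‖w x - w y‖ₑ ^ 2 =
      ∫⁻ x in A, ∫⁻ y in B, ‖U.indicator w x - U.indicator w y‖ₑ ^ 2 := by
    refine setLIntegral_congr_fun hAm fun x hx => setLIntegral_congr_fun hBm fun y hy => ?_
    rw [indicator_of_mem (hA hx), indicator_of_mem (hB hy)]
  rw [e]
  refine lintegral_lintegral_sub_le hA hB hUm (hwm.indicator hUm) hAm hBm
    (measurableSet_Icc.prod measurableSet_closedBall) ?_ ?_
  · intro x hx y hy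
    exact ⟨abs_le.1 (hτ x hx y hy), mem_closedBall_zero_iff.2 (hρ x hx y hy)⟩
  · rintro ⟨τ', ξ⟩ ⟨h1, h2⟩
    set D : ℝ × Space d → ℝ := fun z => τ' * f z + inner ℝ ξ (g z) with hD
    have hDm : Measurable D := (hfm.const_mul τ').add (by fun_prop)
    have hDL : MemLp D 2 (volume.restrict O) := by
      refine (hf.const_mul τ').add ?_
      exact (innerSL ℝ ξ).comp_memLp' hg
    refine (lintegral_translate_sub_le hU hc (hDm.indicator hUm)
      ((integrable_indicator_iff hUm).2 ((hw.mono_measure hmono).integrable (by norm_num)))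
      ((integrable_indicator_iff hUm).2 ((hDL.mono_measure hmono).integrable (by norm_num)))
      (τ', ξ) fun φ hφ => integral_mul_fderiv_of_weak hUm hUO hfin hw hf hg hwf hwg τ' ξ hφ).trans ?_
    have h3 : ∀ z, ‖U.indicator D z‖ₑ ^ 2 ≤ O.indicator (fun z =>
        2 * (ENNReal.ofReal τ ^ 2 * ‖f z‖ₑ ^ 2 + ENNReal.ofReal ρ ^ 2 * ‖g z‖ₑ ^ 2)) z := by
      intro z
      by_cases hz : z ∈ U
      · rw [indicator_of_mem hz, indicator_of_mem (hUO hz)]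
        have a1 : ‖τ' * f z‖ₑ ≤ ENNReal.ofReal τ * ‖f z‖ₑ := by
          rw [enorm_mul]
          gcongr
          rw [Real.enorm_eq_ofReal_abs]
          exact ENNReal.ofReal_le_ofReal (abs_le.2 h1)
        have a2 : ‖(inner ℝ ξ (g z) : ℝ)‖ₑ ≤ ENNReal.ofReal ρ * ‖g z‖ₑ := by
          rw [← ofReal_norm (g z), ← ENNReal.ofReal_mul' (norm_nonneg _),
            Real.enorm_eq_ofReal_abs]
          refine ENNReal.ofReal_le_ofReal ((abs_real_inner_le_norm _ _).trans ?_)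
          gcongr
          exact mem_closedBall_zero_iff.1 h2
        calc ‖D z‖ₑ ^ 2 ≤ (ENNReal.ofReal τ * ‖f z‖ₑ + ENNReal.ofReal ρ * ‖g z‖ₑ) ^ 2 := by
              gcongr
              exact (enorm_add_le _ _).trans (add_le_add a1 a2)
          _ ≤ 2 * ((ENNReal.ofReal τ * ‖f z‖ₑ) ^ 2 + (ENNReal.ofReal ρ * ‖g z‖ₑ) ^ 2) := by
              have := ENNReal.rpow_add_le_mul_rpow_add_rpow (ENNReal.ofReal τ * ‖f z‖ₑ)
                (ENNReal.ofReal ρ * ‖g z‖ₑ) (one_le_two)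
              norm_num at this
              exact this
          _ = _ := by rw [mul_pow, mul_pow]
      · simp [indicator_of_notMem hz]
    refine (lintegral_mono h3).trans ((lintegral_indicator_le _ _).trans ?_)
    rw [lintegral_const_mul _ (by fun_prop), lintegral_add_left (by fun_prop),
      lintegral_const_mul _ (by fun_prop), lintegral_const_mul _ (by fun_prop)]

/-! ### Mean square differences -/

/-- The mean square difference of the values of `w` with respect to two measures. -/
def msd {α : Type*} [MeasurableSpace α] (w : α → ℝ) (μ ν : Measure α) : ℝ≥0∞ :=
  ∫⁻ x, ∫⁻ y, ‖w x - w y‖ₑ ^ 2 ∂ν ∂μ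

theorem enorm_add_sq_le (a b : ℝ) : ‖a + b‖ₑ ^ 2 ≤ 2 * ‖a‖ₑ ^ 2 + 2 * ‖b‖ₑ ^ 2 := by
  have := ENNReal.rpow_add_le_mul_rpow_add_rpow ‖a‖ₑ ‖b‖ₑ one_le_two
  norm_num at this
  rw [← mul_add]
  exact (pow_le_pow_left' (enorm_add_le a b) 2).trans this

section msd

variable {α : Type*} [MeasurableSpace α] {w : α → ℝ} {μ ν ρ : Measure α}

theorem msd_comm [SFinite μ] [SFinite ν] (hw : Measurable w) : msd w μ ν = msd w ν μ := by
  unfold msd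
  rw [lintegral_lintegral_swap (by fun_prop)]
  simp only [enorm_sub_rev]

/-- Integrate `(a + b)² ≤ 2a² + 2b²` over all three variables. Each measure has mass one, so the
variable missing in a term drops out. -/
theorem msd_triangle (hw : Measurable w) [IsProbabilityMeasure μ] [IsProbabilityMeasure ν]
    [IsProbabilityMeasure ρ] : msd w μ ρ ≤ 2 * msd w μ ν + 2 * msd w ν ρ := by
  have h : ∀ x y z, ‖w x - w z‖ₑ ^ 2 ≤ 2 * ‖w x - w y‖ₑ ^ 2 + 2 * ‖w y - w z‖ₑ ^ 2 := by
    intro x y z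
    have := enorm_add_sq_le (w x - w y) (w y - w z)
    rwa [sub_add_sub_cancel] at this
  calc msd w μ ρ = ∫⁻ x, ∫⁻ _y, ∫⁻ z, ‖w x - w z‖ₑ ^ 2 ∂ρ ∂ν ∂μ := by simp [msd]
    _ ≤ ∫⁻ x, ∫⁻ y, ∫⁻ z, (2 * ‖w x - w y‖ₑ ^ 2 + 2 * ‖w y - w z‖ₑ ^ 2) ∂ρ ∂ν ∂μ :=
        lintegral_mono fun x => lintegral_mono fun y => lintegral_mono fun z => h x y z
    _ = ∫⁻ x, ∫⁻ y, (2 * ‖w x - w y‖ₑ ^ 2 + 2 * ∫⁻ z, ‖w y - w z‖ₑ ^ 2 ∂ρ) ∂ν ∂μ := by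
        refine lintegral_congr fun x => lintegral_congr fun y => ?_
        rw [lintegral_add_left (by fun_prop), lintegral_const, measure_univ, mul_one,
          lintegral_const_mul _ (by fun_prop)]
    _ = ∫⁻ x, (2 * (∫⁻ y, ‖w x - w y‖ₑ ^ 2 ∂ν) + 2 * msd w ν ρ) ∂μ := by
        refine lintegral_congr fun x => ?_
        have h1 : Measurable fun y => ∫⁻ z, ‖w y - w z‖ₑ ^ 2 ∂ρ :=
          Measurable.lintegral_prod_right (by fun_prop)
        rw [lintegral_add_left (by fun_prop), lintegral_const_mul _ (by fun_prop),
          lintegral_const_mul _ h1]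
        rfl
    _ = 2 * msd w μ ν + 2 * msd w ν ρ := by
        have h1 : Measurable fun x => ∫⁻ y, ‖w x - w y‖ₑ ^ 2 ∂ν :=
          Measurable.lintegral_prod_right (by fun_prop)
        rw [lintegral_add_right _ measurable_const, lintegral_const_mul _ h1]
        simp [msd]

theorem msd_cond {A B : Set α} {μ : Measure α} :
    msd w (ProbabilityTheory.cond μ A) (ProbabilityTheory.cond μ B) =
      (μ A)⁻¹ * ((μ B)⁻¹ * ∫⁻ x in A, ∫⁻ y in B, ‖w x - w y‖ₑ ^ 2 ∂μ ∂μ) := by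
  unfold msd ProbabilityTheory.cond
  simp only [lintegral_smul_measure, smul_eq_mul]
  -- For `μ B = 0` the factor is infinite and cannot be pulled out, but then both sides vanish.
  by_cases h : (μ B)⁻¹ = ⊤
  · have hB : μ.restrict B = 0 := by simpa using h
    simp [hB]
  · rw [lintegral_const_mul' _ _ h]

theorem lintegral_sq_cond_le {A B : Set α} {μ : Measure α} (hw : Measurable w)
    [IsProbabilityMeasure (ProbabilityTheory.cond μ A)]
    [IsProbabilityMeasure (ProbabilityTheory.cond μ B)] :
    ∫⁻ x, ‖w x‖ₑ ^ 2 ∂(ProbabilityTheory.cond μ A) ≤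
      2 * msd w (ProbabilityTheory.cond μ A) (ProbabilityTheory.cond μ B) +
        2 * ∫⁻ x, ‖w x‖ₑ ^ 2 ∂(ProbabilityTheory.cond μ B) := by
  set μ' := ProbabilityTheory.cond μ A
  set ν := ProbabilityTheory.cond μ B
  calc ∫⁻ x, ‖w x‖ₑ ^ 2 ∂μ' = ∫⁻ x, ∫⁻ _y, ‖w x‖ₑ ^ 2 ∂ν ∂μ' := by simp
    _ ≤ ∫⁻ x, ∫⁻ y, (2 * ‖w x - w y‖ₑ ^ 2 + 2 * ‖w y‖ₑ ^ 2) ∂ν ∂μ' := by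
        refine lintegral_mono fun x => lintegral_mono fun y => ?_
        have := enorm_add_sq_le (w x - w y) (w y)
        rwa [sub_add_cancel] at this
    _ = _ := by
        have h1 : Measurable fun x => ∫⁻ y, ‖w x - w y‖ₑ ^ 2 ∂ν :=
          Measurable.lintegral_prod_right (by fun_prop)
        have h2 : ∀ x, ∫⁻ y, (2 * ‖w x - w y‖ₑ ^ 2 + 2 * ‖w y‖ₑ ^ 2) ∂ν =
            2 * (∫⁻ y, ‖w x - w y‖ₑ ^ 2 ∂ν) + 2 * ∫⁻ y, ‖w y‖ₑ ^ 2 ∂ν := fun x => by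
          rw [lintegral_add_left (by fun_prop), lintegral_const_mul _ (by fun_prop),
            lintegral_const_mul _ (by fun_prop)]
        simp only [h2]
        rw [lintegral_add_right _ measurable_const, lintegral_const_mul _ h1]
        simp [msd]

end msd

/-- A measurable function `w` with weak derivatives `f` in time and `g` in space that are square
integrable on `O`. -/
structure IsWeakTriple {d : ℕ} (O : Set (ℝ × Space d)) (w f : ℝ × Space d → ℝ)
    (g : ℝ × Space d → Space d) : Prop where
  measurable : Measurable w
  measurable_dt : Measurable f
  measurable_grad : Measurable g
  memLp : MemLp w 2 (volume.restrict O)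
  memLp_dt : MemLp f 2 (volume.restrict O)
  memLp_grad : MemLp g 2 (volume.restrict O)
  hasWeakDt : HasWeakDt O w f
  hasWeakGradX : HasWeakGradX O w g

/-- The square of the anisotropic seminorm `h_t ‖f‖ + h_x ‖g‖`. -/
def energy {d : ℕ} (O : Set (ℝ × Space d)) (ht hx : ℝ) (f : ℝ × Space d → ℝ)
    (g : ℝ × Space d → Space d) : ℝ≥0∞ :=
  ENNReal.ofReal ht ^ 2 * (∫⁻ z in O, ‖f z‖ₑ ^ 2) + ENNReal.ofReal hx ^ 2 * ∫⁻ z in O, ‖g z‖ₑ ^ 2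

/-- Scaling: the differences `y - x` fill a box of volume of order `h_t h_x^d`, while the two
normalisations contribute the inverse square of this volume. One inverse power remains. -/
theorem exists_msd_cond_le (d : ℕ) {Λ α : ℝ} (hΛ : 0 < Λ) (hα : 0 < α) :
    ∃ C : ℝ≥0, ∀ {O U A B : Set (ℝ × Space d)} {w f : ℝ × Space d → ℝ}
      {g : ℝ × Space d → Space d} {ht hx : ℝ}, IsWeakTriple O w f g → IsOpen U → Convex ℝ U →
      U ⊆ O → volume U ≠ ⊤ → 0 < ht → 0 < hx → A ⊆ U → B ⊆ U → MeasurableSet A → MeasurableSet B →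
      (∀ x ∈ A, ∀ y ∈ B, |y.1 - x.1| ≤ Λ * ht) → (∀ x ∈ A, ∀ y ∈ B, ‖y.2 - x.2‖ ≤ Λ * hx) →
      ENNReal.ofReal (α * (ht * hx ^ d)) ≤ volume A →
      ENNReal.ofReal (α * (ht * hx ^ d)) ≤ volume B →
      msd w (ProbabilityTheory.cond volume A) (ProbabilityTheory.cond volume B) ≤
        C * (energy O ht hx f g / ENNReal.ofReal (ht * hx ^ d)) := by
  have hb : volume (Metric.ball (0 : Space d) 1) ≠ ⊤ := measure_ball_lt_top.ne
  set b : ℝ≥0 := (volume (Metric.ball (0 : Space d) 1)).toNNReal with hbdef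
  have hbe : volume (Metric.ball (0 : Space d) 1) = b := (ENNReal.coe_toNNReal hb).symm
  set L : ℝ≥0 := Λ.toNNReal with hL
  set a : ℝ≥0 := α.toNNReal with ha
  have ha0 : a ≠ 0 := by simpa [ha] using hα
  -- The factors come from the volumes of `A` and `B`, from the volume of the box of differences,
  -- and from `(τ f + ξ·g)²` with `|τ| ≤ Λ h_t` and `|ξ| ≤ Λ h_x`.
  refine ⟨a⁻¹ * a⁻¹ * (2 * L * L ^ d * b * (2 * L ^ 2)), ?_⟩
  intro O U A B w f g ht hx hw hU hc hUO hfin hht hhx hA hB hAm hBm hτ hρ hvA hvB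
  have h1 := lintegral_lintegral_sub_le_of_weak hU hc hUO hfin hw.measurable hw.measurable_dt
    hw.measurable_grad hw.memLp hw.memLp_dt hw.memLp_grad hw.hasWeakDt hw.hasWeakGradX hA hB hAm
    hBm hτ hρ
  set T : ℝ≥0 := ht.toNNReal with hT
  set X : ℝ≥0 := hx.toNNReal with hX
  have hT0 : T ≠ 0 := by simpa [hT] using hht
  have hX0 : X ≠ 0 := by simpa [hX] using hhx
  have eT : ENNReal.ofReal ht = T := rfl
  have eX : ENNReal.ofReal hx = X := rfl
  have eL : ENNReal.ofReal Λ = L := rfl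
  have ea : ENNReal.ofReal α = a := rfl
  have ev : ENNReal.ofReal (ht * hx ^ d) = T * X ^ d := by
    rw [ENNReal.ofReal_mul hht.le, ENNReal.ofReal_pow hhx.le, eT, eX]
  have eH : volume (Icc (-(Λ * ht)) (Λ * ht) ×ˢ Metric.closedBall (0 : Space d) (Λ * hx)) =
      (2 * L * T) * ((L * X) ^ d * b) := by
    rw [Measure.volume_eq_prod, Measure.prod_prod, Real.volume_Icc,
      Measure.addHaar_closedBall _ _ (by positivity), finrank_euclideanSpace, Fintype.card_fin,
      hbe, ENNReal.ofReal_pow (by positivity), ENNReal.ofReal_mul hΛ.le]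
    rw [show Λ * ht - -(Λ * ht) = 2 * Λ * ht by ring, ENNReal.ofReal_mul (by positivity),
      ENNReal.ofReal_mul (by norm_num)]
    simp [eT, eX, eL]
  rw [ENNReal.ofReal_mul hα.le, ev, ea] at hvA hvB
  rw [msd_cond, ev]
  have hE : (ENNReal.ofReal (Λ * ht) ^ 2 * (∫⁻ z in O, ‖f z‖ₑ ^ 2) +
      ENNReal.ofReal (Λ * hx) ^ 2 * ∫⁻ z in O, ‖g z‖ₑ ^ 2) = (L : ℝ≥0∞) ^ 2 * energy O ht hx f g := by
    rw [energy, ENNReal.ofReal_mul hΛ.le, ENNReal.ofReal_mul hΛ.le, mul_pow, mul_pow, mul_add, eL]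
    ring
  rw [hE, eH] at h1
  have hv0 : T * X ^ d ≠ 0 := by positivity
  calc (volume A)⁻¹ * ((volume B)⁻¹ * ∫⁻ x in A, ∫⁻ y in B, ‖w x - w y‖ₑ ^ 2)
      ≤ ((a * (T * X ^ d) : ℝ≥0) : ℝ≥0∞)⁻¹ * (((a * (T * X ^ d) : ℝ≥0) : ℝ≥0∞)⁻¹ *
        ((2 * L * T) * ((L * X) ^ d * b) * (2 * (L ^ 2 * energy O ht hx f g)))) := by
        gcongr
        · push_cast
          exact hvA
        · push_cast
          exact hvB
    _ = ((a * (T * X ^ d))⁻¹ * (a * (T * X ^ d))⁻¹ *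
          ((2 * L * T) * ((L * X) ^ d * b) * (2 * L ^ 2)) : ℝ≥0) * energy O ht hx f g := by
        rw [← ENNReal.coe_inv (by positivity)]
        push_cast
        ring
    _ = ((a⁻¹ * a⁻¹ * (2 * L * L ^ d * b * (2 * L ^ 2)) * (T * X ^ d)⁻¹ : ℝ≥0) : ℝ≥0∞) *
          energy O ht hx f g := by
        congr 2
        rw [mul_pow]
        field_simp
    _ = _ := by
        rw [ENNReal.coe_mul, ENNReal.coe_inv hv0, div_eq_mul_inv]
        push_cast
        ring

/-- Chaining along a connected set. -/
theorem chain_le {X : Type*} [PseudoMetricSpace X] {Γ : Set X} (hΓ : IsPreconnected Γ) {ε : ℝ}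
    (hε : 0 < ε) {N : ℕ} (hN : ∀ s : Finset X, (s : Set X) ⊆ Γ →
      (∀ x ∈ s, ∀ y ∈ s, x ≠ y → ε ≤ dist x y) → s.card ≤ N)
    {e : X → X → ℝ≥0∞} {q : ℝ≥0∞} (hstep : ∀ x ∈ Γ, ∀ y ∈ Γ, dist x y < ε → e x y ≤ q)
    (htri : ∀ x ∈ Γ, ∀ y ∈ Γ, ∀ z ∈ Γ, e x z ≤ 2 * e x y + 2 * e y z) {x₀ : X} (hx₀ : x₀ ∈ Γ) :
    ∀ y ∈ Γ, e x₀ y ≤ 4 ^ (2 * N + 2) * q := by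
  classical
  -- `S n` consists of the points of `Γ` that are reached from `x₀` in `n` steps shorter than `ε`.
  -- Steps of length zero are allowed, so these sets increase.
  obtain ⟨S, hS0, hS1⟩ : ∃ S : ℕ → Set X, S 0 = {x₀} ∧
      ∀ n, S (n + 1) = {y | y ∈ Γ ∧ ∃ x ∈ S n, dist x y < ε} :=
    ⟨fun n => Nat.rec {x₀} (fun _ s => {y | y ∈ Γ ∧ ∃ x ∈ s, dist x y < ε}) n, rfl,
      fun n => rfl⟩
  have hSΓ : ∀ n, S n ⊆ Γ := by
    rintro (_ | n)
    · simpa [hS0] using hx₀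
    · rw [hS1]; exact fun y hy => hy.1
  have hSsucc : ∀ n, S n ⊆ S (n + 1) := fun n y hy => by
    rw [hS1]
    exact ⟨hSΓ n hy, y, hy, by simpa using hε⟩
  have hmono : Monotone S := monotone_nat_of_le_succ hSsucc
  have hbound : ∀ n, ∀ y ∈ S n, e x₀ y ≤ 4 ^ n * q := by
    intro n
    induction n with
    | zero =>
      intro y hy
      rw [hS0, mem_singleton_iff] at hy
      rw [hy]
      simpa using hstep x₀ hx₀ x₀ hx₀ (by simpa using hε)
    | succ n ih =>
      intro y hy
      rw [hS1] at hy
      obtain ⟨hyΓ, x, hx, hxy⟩ := hy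
      calc e x₀ y ≤ 2 * e x₀ x + 2 * e x y := htri _ hx₀ _ (hSΓ n hx) _ hyΓ
        _ ≤ 2 * (4 ^ n * q) + 2 * (4 ^ n * q) := by
            gcongr
            · exact ih x hx
            · exact (hstep x (hSΓ n hx) y hyΓ hxy).trans
                (le_mul_of_one_le_left' (one_le_pow₀ (by norm_num)))
        _ = 4 ^ (n + 1) * q := by ring
  -- Otherwise each step up to `2N + 1` adds a new point `y n`. The points with even index are
  -- `ε`-separated: everything within `ε` of `y (2m)` is in `S (2m + 2)`, hence in `S (2n)` for `m <
  -- n`, which `y (2n)` avoids. The indices `0, 2, ..., 2N` give `N + 1` such points, one too many.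
  have hstab : ∃ n ≤ 2 * N + 1, S (n + 1) ⊆ S n := by
    by_contra! hcon
    have hex : ∀ n : ℕ, n ≤ 2 * N + 1 → ∃ y, y ∈ S (n + 1) ∧ y ∉ S n := fun n hn =>
      not_subset.1 (hcon n hn)
    have : Nonempty X := ⟨x₀⟩
    choose! y hy1 hy2 using hex
    have hsep : ∀ m n, m < n → n ≤ N → ε ≤ dist (y (2 * m)) (y (2 * n)) := by
      intro m n hmn hn
      by_contra! hlt
      refine hy2 (2 * n) (by omega) (hmono (show 2 * m + 2 ≤ 2 * n by omega) ?_)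
      rw [show 2 * m + 2 = (2 * m + 1) + 1 from rfl, hS1]
      exact ⟨hSΓ _ (hy1 (2 * n) (by omega)), _, hy1 (2 * m) (by omega), hlt⟩
    have hsep' : ∀ m ≤ N, ∀ n ≤ N, m ≠ n → ε ≤ dist (y (2 * m)) (y (2 * n)) := by
      intro m hm n hn hne
      rcases lt_or_gt_of_ne hne with h | h
      · exact hsep m n h hn
      · rw [dist_comm]; exact hsep n m h hm
    have hinj : InjOn (fun m => y (2 * m)) (Finset.range (N + 1) : Set ℕ) := by
      intro m hm n hn hmn
      by_contra hne
      have := hsep' m (by simpa [Nat.lt_succ_iff] using hm) n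
        (by simpa [Nat.lt_succ_iff] using hn) hne
      simp only at hmn
      rw [hmn, dist_self] at this
      linarith
    have hcard := hN ((Finset.range (N + 1)).image fun m => y (2 * m)) ?_ ?_
    · rw [Finset.card_image_of_injOn hinj, Finset.card_range] at hcard
      omega
    · intro x hx
      simp only [Finset.coe_image, mem_image, Finset.coe_range, mem_Iio] at hx
      obtain ⟨m, hm, rfl⟩ := hx
      exact hSΓ _ (hy1 _ (by omega))
    · intro x hx x' hx' hne
      simp only [Finset.mem_image, Finset.mem_range] at hx hx'
      obtain ⟨m, hm, rfl⟩ := hx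
      obtain ⟨n, hn, rfl⟩ := hx'
      exact hsep' m (by omega) n (by omega) fun h => hne (by rw [h])
  obtain ⟨n, hn, hst⟩ := hstab
  -- Once the sets stop growing, the `ε`-neighbourhoods of `S n` and of its complement in `Γ` have
  -- no common point in `Γ`, so connectedness leaves nothing outside `S n`.
  have hall : Γ ⊆ S n := by
    have hcov : Γ ⊆ (⋃ x ∈ S n, Metric.ball x ε) ∪ (⋃ x ∈ Γ \ S n, Metric.ball x ε) := by
      intro y hy
      by_cases h : y ∈ S n
      · exact Or.inl (mem_biUnion h (Metric.mem_ball_self hε))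
      · exact Or.inr (mem_biUnion (⟨hy, h⟩ : y ∈ Γ \ S n) (Metric.mem_ball_self hε))
    by_contra hcon
    obtain ⟨y, hyΓ, hyS⟩ := not_subset.1 hcon
    have hx₀n : x₀ ∈ S n := hmono (Nat.zero_le n) (by simp [hS0])
    obtain ⟨z, hzΓ, hz1, hz2⟩ := hΓ _ _ (isOpen_biUnion fun x _ => Metric.isOpen_ball)
      (isOpen_biUnion fun x _ => Metric.isOpen_ball) hcov
      ⟨x₀, hx₀, mem_biUnion hx₀n (Metric.mem_ball_self hε)⟩
      ⟨y, hyΓ, mem_biUnion (⟨hyΓ, hyS⟩ : y ∈ Γ \ S n) (Metric.mem_ball_self hε)⟩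
    simp only [mem_iUnion, exists_prop, Metric.mem_ball] at hz1 hz2
    obtain ⟨x1, hx1, hd1⟩ := hz1
    obtain ⟨x2, ⟨hx2Γ, hx2⟩, hd2⟩ := hz2
    have hzS : z ∈ S n := hst (by rw [hS1]; exact ⟨hzΓ, x1, hx1, by rwa [dist_comm]⟩)
    exact hx2 (hst (by rw [hS1]; exact ⟨hx2Γ, z, hzS, hd2⟩))
  intro y hy
  refine (hbound n y (hall hy)).trans ?_
  gcongr
  · norm_num
  · omega

/-! ### Functions that vanish on the boundary -/

theorem eLpNorm_two_sq {α F : Type*} [MeasurableSpace α] [NormedAddCommGroup F] (f : α → F)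
    (μ : Measure α) : eLpNorm f 2 μ ^ 2 = ∫⁻ x, ‖f x‖ₑ ^ 2 ∂μ := by
  rw [eLpNorm_eq_lintegral_rpow_enorm_toReal (by norm_num) (by norm_num), ← ENNReal.rpow_natCast,
    ← ENNReal.rpow_mul]
  simp

theorem norm_gradient {d : ℕ} (ψ : Space d → ℝ) (x : Space d) :
    ‖gradient ψ x‖ = ‖fderiv ℝ ψ x‖ := by
  simp [gradient]

theorem gradient_apply {d : ℕ} (ψ : Space d → ℝ) (x : Space d) (i : Fin d) :
    gradient ψ x i = fderiv ℝ ψ x (EuclideanSpace.single i 1) := by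
  have h : inner ℝ (gradient ψ x) (EuclideanSpace.single i (1 : ℝ)) =
      fderiv ℝ ψ x (EuclideanSpace.single i 1) := by
    simp [gradient]
  rw [← h, real_inner_comm, EuclideanSpace.inner_single_left]
  simp

theorem continuous_gradient {d : ℕ} {ψ : Space d → ℝ} (h : ContDiff ℝ 1 ψ) :
    Continuous (gradient ψ) :=
  (InnerProductSpace.toDual ℝ (Space d)).symm.isometry.continuous.comp
    (h.continuous_fderiv (n := 1) one_ne_zero)

theorem IsTestFun.contDiff_one {F : Type*} [NormedAddCommGroup F] [NormedSpace ℝ F] {U : Set F}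
    {φ : F → ℝ} (hφ : IsTestFun U φ) : ContDiff ℝ 1 φ := hφ.contDiff.of_le (by simp)

theorem enorm_sq_le_lintegral_segment {d : ℕ} {ψ : Space d → ℝ} (hψ : ContDiff ℝ 1 ψ)
    (x b : Space d) {s₀ : ℝ} (hs₀ : s₀ ∈ Icc (0 : ℝ) 1) (h0 : ψ (x + s₀ • b) = 0) :
    ‖ψ x‖ₑ ^ 2 ≤ ∫⁻ s in Ioo (0 : ℝ) s₀, (‖b‖ₑ * ‖gradient ψ (x + s • b)‖ₑ) ^ 2 := by
  have hd : ∀ s ∈ uIcc (0 : ℝ) s₀, HasDerivAt (fun s : ℝ => ψ (x + s • b))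
      (fderiv ℝ ψ (x + s • b) b) s := by
    intro s _
    have h1 : HasDerivAt (fun s : ℝ => x + s • b) b s := by
      simpa using ((hasDerivAt_id s).smul_const b).const_add x
    exact (hψ.differentiable one_ne_zero (x + s • b)).hasFDerivAt.comp_hasDerivAt s h1
  have hcont := hψ.continuous_fderiv (n := 1) one_ne_zero
  have h3 := intervalIntegral.integral_eq_sub_of_hasDerivAt hd
    (by apply Continuous.intervalIntegrable; fun_prop)
  rw [intervalIntegral.integral_of_le hs₀.1, h0, integral_Ioc_eq_integral_Ioo] at h3
  simp only [zero_smul, add_zero, zero_sub] at h3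
  have hc : Continuous fun s : ℝ => gradient ψ (x + s • b) :=
    (continuous_gradient hψ).comp (by fun_prop)
  calc ‖ψ x‖ₑ ^ 2 = ‖∫ s in Ioo (0 : ℝ) s₀, fderiv ℝ ψ (x + s • b) b‖ₑ ^ 2 := by
        rw [h3, enorm_neg]
    _ ≤ (∫⁻ s in Ioo (0 : ℝ) s₀, ‖b‖ₑ * ‖gradient ψ (x + s • b)‖ₑ) ^ 2 := by
        gcongr
        refine (enorm_integral_le_lintegral_enorm _).trans (lintegral_mono fun s => ?_)
        rw [mul_comm, ← enorm_norm (gradient ψ _), norm_gradient, enorm_norm]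
        exact ContinuousLinearMap.le_opENorm _ _
    _ ≤ _ := sq_lintegral_le (by simpa using hs₀.2)
        (hc.enorm.measurable.const_mul _).aemeasurable

/-- Fundamental theorem of calculus on the segment from `x` to the zero of `ψ`, then integration
over `x`. The vector `b` is the same for all `x`, so Fubini and translation invariance apply. -/
theorem lintegral_sq_le_of_segment {d : ℕ} {ψ : Space d → ℝ} (hψ : ContDiff ℝ 1 ψ)
    {S S' : Set (Space d)} (hS' : MeasurableSet S') (hS : MeasurableSet S) (b : Space d)
    (h : ∀ x ∈ S, ∃ s₀ ∈ Icc (0 : ℝ) 1, ψ (x + s₀ • b) = 0 ∧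
      ∀ s ∈ Ioo 0 s₀, x + s • b ∈ S') :
    ∫⁻ x in S, ‖ψ x‖ₑ ^ 2 ≤ ‖b‖ₑ ^ 2 * ∫⁻ x in S', ‖gradient ψ x‖ₑ ^ 2 := by
  have hgm : Measurable (gradient ψ) := (continuous_gradient hψ).measurable
  set F : Space d → ℝ≥0∞ := S'.indicator fun x => (‖b‖ₑ * ‖gradient ψ x‖ₑ) ^ 2 with hF
  have hFm : Measurable F := Measurable.indicator (by fun_prop) hS'
  calc ∫⁻ x in S, ‖ψ x‖ₑ ^ 2 ≤ ∫⁻ x in S, ∫⁻ s in Ioc (0 : ℝ) 1, F (x + s • b) := by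
        refine setLIntegral_mono' hS fun x hx => ?_
        obtain ⟨s₀, hs₀, h0, hs⟩ := h x hx
        refine (enorm_sq_le_lintegral_segment hψ x b hs₀ h0).trans ?_
        refine le_trans (setLIntegral_mono' measurableSet_Ioo fun s hs1 => ?_)
          (lintegral_mono_set (t := Ioc (0 : ℝ) 1) fun s hs1 => ⟨hs1.1, hs1.2.le.trans hs₀.2⟩)
        rw [hF, indicator_of_mem (hs s hs1)]
    _ ≤ ∫⁻ x, ∫⁻ s in Ioc (0 : ℝ) 1, F (x + s • b) := setLIntegral_le_lintegral _ _
    _ = ∫⁻ s in Ioc (0 : ℝ) 1, ∫⁻ x, F (x + s • b) := by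
        refine lintegral_lintegral_swap ?_
        have : Measurable fun p : Space d × ℝ => p.1 + p.2 • b := by fun_prop
        exact (hFm.comp this).aemeasurable
    _ = ∫⁻ _s in Ioc (0 : ℝ) 1, ∫⁻ x, F x := by
        congr 1
        funext s
        exact lintegral_add_right_eq_self F (s • b)
    _ = ∫⁻ x, F x := by simp
    _ = _ := by
        rw [hF, lintegral_indicator hS', ← lintegral_const_mul _ (by fun_prop)]
        simp only [mul_pow]

theorem IsTestFun.gradient_eq_zero {d : ℕ} {U : Set (Space d)} {ψ : Space d → ℝ}
    (hψ : IsTestFun U ψ) {x : Space d} (hx : x ∉ U) : gradient ψ x = 0 := by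
  rw [gradient, hψ.fderiv_eq_zero hx, map_zero]

theorem IsTestFun.memLp_gradient {d : ℕ} {U : Set (Space d)} {ψ : Space d → ℝ}
    (hψ : IsTestFun U ψ) : MemLp (gradient ψ) 2 volume := by
  refine (continuous_gradient hψ.contDiff_one).memLp_of_hasCompactSupport ?_
  refine HasCompactSupport.intro hψ.hasCompactSupport fun x hx => ?_
  have := image_eq_zero_of_notMem_tsupport fun h => hx (tsupport_fderiv_subset ℝ h)
  rw [gradient, this, map_zero]

theorem IsTestFun.memLp {F : Type*} [NormedAddCommGroup F] [NormedSpace ℝ F] [MeasurableSpace F]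
    [BorelSpace F] {μ : Measure F} [IsFiniteMeasureOnCompacts μ] {U : Set F} {ψ : F → ℝ}
    (hψ : IsTestFun U ψ) {p : ℝ≥0∞} : MemLp ψ p μ :=
  hψ.continuous.memLp_of_hasCompactSupport hψ.hasCompactSupport

theorem IsTestFun.memLp_fderiv_apply {F : Type*} [NormedAddCommGroup F] [NormedSpace ℝ F]
    [MeasurableSpace F] [BorelSpace F] {μ : Measure F} [IsFiniteMeasureOnCompacts μ]
    {U : Set F} {ψ : F → ℝ} (hψ : IsTestFun U ψ) (e : F) {p : ℝ≥0∞} :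
    MemLp (fun x => fderiv ℝ ψ x e) p μ :=
  (hψ.continuous_fderiv.clm_apply continuous_const).memLp_of_hasCompactSupport
    (hψ.hasCompactSupport.fderiv_apply ℝ e)

/-- Poincaré–Friedrichs inequality in a direction `b` that leads out of `Ω`. -/
theorem HasH10Grad.eLpNorm_le {d : ℕ} {Ω : Set (Space d)} {u : Space d → ℝ}
    {g : Space d → Space d} (h : HasH10Grad Ω u g) (hΩ : MeasurableSet Ω) {S S' : Set (Space d)}
    (hS : MeasurableSet S) (hS' : MeasurableSet S') (hSΩ : S ⊆ Ω) (b : Space d)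
    (hb : ∀ x ∈ S, ∃ s₀ ∈ Icc (0 : ℝ) 1, x + s₀ • b ∉ Ω ∧ ∀ s ∈ Ioo 0 s₀, x + s • b ∈ S') :
    eLpNorm u 2 (volume.restrict S) ≤ ‖b‖ₑ * eLpNorm g 2 (volume.restrict (S' ∩ Ω)) := by
  obtain ⟨hu, hg, ψ, hψ, h1, h2⟩ := h
  have hSΩ' := Measure.restrict_mono hSΩ (le_refl (volume : Measure (Space d)))
  have hSΩ'' := Measure.restrict_mono (inter_subset_right (s := S') (t := Ω))
    (le_refl (volume : Measure (Space d)))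
  -- The smooth approximants vanish outside `Ω`, in particular where the segment has left `Ω`. The
  -- inequality for `u` follows in the limit.
  have hψle : ∀ n, eLpNorm (ψ n) 2 (volume.restrict S) ≤
      ‖b‖ₑ * eLpNorm (gradient (ψ n)) 2 (volume.restrict (S' ∩ Ω)) := by
    intro n
    rw [← ENNReal.pow_le_pow_left_iff (two_ne_zero), mul_pow, eLpNorm_two_sq, eLpNorm_two_sq]
    refine (lintegral_sq_le_of_segment (hψ n).contDiff_one hS' hS b fun x hx => ?_).trans
      (le_of_eq ?_)
    · obtain ⟨s₀, hs₀, hs1, hs2⟩ := hb x hx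
      exact ⟨s₀, hs₀, (hψ n).eq_zero hs1, hs2⟩
    · congr 1
      rw [← lintegral_indicator hS', ← lintegral_indicator (hS'.inter hΩ)]
      refine lintegral_congr fun x => ?_
      by_cases hx : x ∈ Ω
      · by_cases hx' : x ∈ S' <;> simp [hx, hx', indicator]
      · simp [indicator, hx, (hψ n).gradient_eq_zero hx]
  have key : ∀ n, eLpNorm u 2 (volume.restrict S) ≤
      eLpNorm (fun x => u x - ψ n x) 2 (volume.restrict Ω) +
        ‖b‖ₑ * (eLpNorm (fun x => g x - gradient (ψ n) x) 2 (volume.restrict Ω) +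
          eLpNorm g 2 (volume.restrict (S' ∩ Ω))) := by
    intro n
    have a1 : eLpNorm u 2 (volume.restrict S) ≤ eLpNorm (fun x => u x - ψ n x) 2 (volume.restrict S)
        + eLpNorm (ψ n) 2 (volume.restrict S) := by
      have hum := (hu.mono_measure hSΩ').aestronglyMeasurable
      have hpm := (hψ n).continuous.aestronglyMeasurable (μ := volume.restrict S)
      have := eLpNorm_add_le (hum.sub hpm) hpm (p := 2) (by norm_num)
      rw [sub_add_cancel] at this
      exact this
    have a2 : eLpNorm (gradient (ψ n)) 2 (volume.restrict (S' ∩ Ω)) ≤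
        eLpNorm (fun x => g x - gradient (ψ n) x) 2 (volume.restrict (S' ∩ Ω)) +
          eLpNorm g 2 (volume.restrict (S' ∩ Ω)) := by
      have hum := (hg.mono_measure hSΩ'').aestronglyMeasurable
      have hpm := (continuous_gradient (hψ n).contDiff_one).aestronglyMeasurable
        (μ := volume.restrict (S' ∩ Ω))
      have := eLpNorm_sub_le hum (hum.sub hpm) (p := 2) (by norm_num)
      rw [sub_sub_cancel] at this
      rw [add_comm]
      exact this
    refine a1.trans (add_le_add (eLpNorm_mono_measure _ hSΩ') ((hψle n).trans ?_))
    gcongr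
    exact a2.trans (add_le_add (eLpNorm_mono_measure _ hSΩ'') le_rfl)
  refine ge_of_tendsto' (b := eLpNorm u 2 (volume.restrict S)) (x := atTop) ?_ key
  have := h1.add (ENNReal.Tendsto.const_mul (a := ‖b‖ₑ) (h2.add (tendsto_const_nhds
    (x := eLpNorm g 2 (volume.restrict (S' ∩ Ω))))) (Or.inr enorm_ne_top))
  simpa using this

theorem tendsto_integral_mul_of_eLpNorm {α : Type*} [MeasurableSpace α] {μ : Measure α}
    {u k : α → ℝ} {v : ℕ → α → ℝ} (hu : MemLp u 2 μ) (hk : MemLp k 2 μ) (hv : ∀ n, MemLp (v n) 2 μ)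
    (h : Tendsto (fun n => eLpNorm (fun x => u x - v n x) 2 μ) atTop (𝓝 0)) :
    Tendsto (fun n => ∫ x, v n x * k x ∂μ) atTop (𝓝 (∫ x, u x * k x ∂μ)) := by
  refine tendsto_integral_of_L1' (fun x => u x * k x) (hu.integrable_mul hk).aestronglyMeasurable
    (Eventually.of_forall fun n => (hv n).integrable_mul hk) ?_
  have hle : ∀ n, eLpNorm ((fun x => v n x * k x) - fun x => u x * k x) 1 μ ≤
      eLpNorm (fun x => u x - v n x) 2 μ * eLpNorm k 2 μ := by
    intro n
    have e : ((fun x => v n x * k x) - fun x => u x * k x) = -((fun x => u x - v n x) • k) := by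
      funext x
      simp only [Pi.sub_apply, Pi.neg_apply, smul_eq_mul, Pi.mul_apply]
      ring
    rw [e, eLpNorm_neg]
    exact eLpNorm_smul_le_mul_eLpNorm hk.aestronglyMeasurable
      (hu.sub (hv n)).aestronglyMeasurable
  refine tendsto_of_tendsto_of_tendsto_of_le_of_le tendsto_const_nhds ?_ (fun _ => zero_le) hle
  have := ENNReal.Tendsto.mul_const (b := eLpNorm k 2 μ) h (Or.inr hk.eLpNorm_ne_top)
  simpa using this

/-- There is no boundary term although `η` need not vanish on `∂Ω`: the approximants of `u` vanish
outside `Ω`, so they can be integrated by parts on the whole space. -/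
theorem HasH10Grad.integral_mul_fderiv {d : ℕ} {Ω : Set (Space d)} {u : Space d → ℝ}
    {g : Space d → Space d} (h : HasH10Grad Ω u g) {η : Space d → ℝ} {V : Set (Space d)}
    (hη : IsTestFun V η) (i : Fin d) :
    ∫ x in Ω, u x * fderiv ℝ η x (EuclideanSpace.single i 1) = - ∫ x in Ω, g x i * η x := by
  obtain ⟨hu, hg, ψ, hψ, h1, h2⟩ := h
  have hgi : MemLp (fun x => g x i) 2 (volume.restrict Ω) :=
    (EuclideanSpace.proj (𝕜 := ℝ) i : Space d →L[ℝ] ℝ).comp_memLp' hg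
  have hpi : ∀ n, MemLp (fun x => gradient (ψ n) x i) 2 (volume.restrict Ω) := fun n =>
    ((EuclideanSpace.proj (𝕜 := ℝ) i : Space d →L[ℝ] ℝ).comp_memLp' (hψ n).memLp_gradient).restrict _
  have t1 := tendsto_integral_mul_of_eLpNorm hu
    (hη.memLp_fderiv_apply (μ := volume.restrict Ω) (EuclideanSpace.single i 1) (p := 2))
    (fun n => (hψ n).memLp) h1
  have h2i : Tendsto (fun n => eLpNorm (fun x => g x i - gradient (ψ n) x i) 2
      (volume.restrict Ω)) atTop (𝓝 0) := by
    refine tendsto_of_tendsto_of_tendsto_of_le_of_le tendsto_const_nhds h2 (fun _ => zero_le)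
      fun n => eLpNorm_mono fun x => ?_
    exact PiLp.norm_apply_le (g x - gradient (ψ n) x) i
  have t2 := (tendsto_integral_mul_of_eLpNorm hgi (hη.memLp (μ := volume.restrict Ω) (p := 2))
    hpi h2i).neg
  refine tendsto_nhds_unique t1 (t2.congr fun n => ?_)
  have hψz : ∀ x ∉ Ω, gradient (ψ n) x i * η x = 0 := fun x hx => by
    rw [(hψ n).gradient_eq_zero hx]; simp
  have hψz' : ∀ x ∉ Ω, ψ n x * fderiv ℝ η x (EuclideanSpace.single i 1) = 0 := fun x hx => by
    rw [(hψ n).eq_zero hx, zero_mul]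
  rw [setIntegral_eq_integral_of_forall_compl_eq_zero hψz,
    setIntegral_eq_integral_of_forall_compl_eq_zero hψz']
  simp only [gradient_apply]
  refine (integral_mul_fderiv_eq_neg_fderiv_mul_of_integrable ?_ ?_ ?_ ?_ ?_).symm
  · exact ((hψ n).memLp_fderiv_apply _ (p := 2)).integrable_mul (hη.memLp (p := 2))
  · exact ((hψ n).memLp (p := 2)).integrable_mul (hη.memLp_fderiv_apply _ (p := 2))
  · exact ((hψ n).memLp (p := 2)).integrable_mul (hη.memLp (p := 2))
  · exact fun x _ => (hψ n).contDiff_one.differentiable one_ne_zero x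
  · exact fun x _ => hη.contDiff_one.differentiable one_ne_zero x

/-! ### Lipschitz domains, cells and meshes -/

theorem IsLipschitzDomain.mem_frontier_iff {d : ℕ} {Ω : Set (Space d)} (hΩ : IsLipschitzDomain Ω)
    {x : Space d} : x ∈ frontier Ω ↔ x ∈ closure Ω ∧ x ∉ Ω := by
  rw [frontier, hΩ.isOpen.interior_eq, Set.mem_sdiff]

theorem inner_le_of_mem_closure {d : ℕ} {Ω : Set (Space d)} {p e : Space d} {g : Space d → ℝ}
    {r : ℝ} (hg : Continuous g)
    (h : ∀ x ∈ Metric.ball p r, x ∈ Ω ↔ inner ℝ x e < g x) {x : Space d}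
    (hx : x ∈ Metric.ball p r) (hxc : x ∈ closure Ω) : inner ℝ x e ≤ g x := by
  have h1 : x ∈ closure (Metric.ball p r ∩ Ω) := Metric.isOpen_ball.inter_closure ⟨hx, hxc⟩
  have h2 : IsClosed {y : Space d | inner ℝ y e ≤ g y} := isClosed_le (by fun_prop) hg
  exact closure_minimal (fun y hy => ((h y hy.1).1 hy.2).le) h2 h1

/-- A Lipschitz domain lies on one side of its boundary. If a boundary point `x` were interior to
the closure, then so would be `x + c e` for small `c > 0`, but these points are above the graph. -/
theorem IsLipschitzDomain.interior_closure_subset {d : ℕ} {Ω : Set (Space d)}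
    (hΩ : IsLipschitzDomain Ω) : interior (closure Ω) ⊆ Ω := by
  intro x hx
  by_contra hxΩ
  have hxf : x ∈ frontier Ω := hΩ.mem_frontier_iff.2 ⟨interior_subset hx, hxΩ⟩
  obtain ⟨e, g, L, r, he, hg, hge, hr, h⟩ := hΩ.graph x hxf
  have hcont : Continuous fun c : ℝ => x + c • e := by fun_prop
  have hopen : IsOpen (interior (closure Ω) ∩ Metric.ball x r) :=
    isOpen_interior.inter Metric.isOpen_ball
  have h0 : x + (0 : ℝ) • e ∈ interior (closure Ω) ∩ Metric.ball x r := by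
    simpa using ⟨hx, hr⟩
  obtain ⟨δ, hδ, hδ'⟩ := Metric.isOpen_iff.1 (hopen.preimage hcont) 0 h0
  have hmem := hδ' (show δ / 2 ∈ Metric.ball (0 : ℝ) δ by
    rw [Metric.mem_ball, Real.dist_0_eq_abs, abs_of_pos (by linarith)]; linarith)
  have h1 := inner_le_of_mem_closure hg.continuous h hmem.2 (interior_subset hmem.1)
  have h2 : g x ≤ inner ℝ x e := by
    by_contra! hlt
    exact hxΩ ((h x (Metric.mem_ball_self hr)).2 hlt)
  rw [hge, inner_add_left, inner_smul_left, real_inner_self_eq_norm_sq, he] at h1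
  simp at h1
  linarith

namespace Cell

variable {d : ℕ} (K : Cell d)

theorem volume_frontier_spaceSet : volume (frontier K.spaceSet) = 0 :=
  K.convex_spaceSet.addHaar_frontier _

theorem volume_frontier_toSet : volume (frontier K.toSet) = 0 :=
  K.convex_toSet.addHaar_frontier _

/-- Convex sets have null boundary. Integrals over a cell can thus be moved to its interior, which
lies in the open domain, without knowing that `∂Ω` is a null set. -/
theorem restrict_interior_spaceSet :
    (volume : Measure (Space d)).restrict (interior K.spaceSet) = volume.restrict K.spaceSet :=
  Measure.restrict_congr_set (interior_ae_eq_of_null_frontier K.volume_frontier_spaceSet)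

theorem restrict_interior_toSet :
    (volume : Measure (ℝ × Space d)).restrict (interior K.toSet) = volume.restrict K.toSet :=
  Measure.restrict_congr_set (interior_ae_eq_of_null_frontier K.volume_frontier_toSet)

theorem interior_spaceSet_subset {Ω : Set (Space d)} (hΩ : IsLipschitzDomain Ω)
    (h : K.spaceSet ⊆ closure Ω) : interior K.spaceSet ⊆ Ω :=
  (interior_mono h).trans hΩ.interior_closure_subset

/-- Take `b = Q - P` with `P` the vertex opposite to the facet and `Q` another vertex. A point `λ P
+ m y` with `y` in the facet reaches the facet at parameter `λ`, where all the weight of `P` has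
been shifted to `Q`. -/
theorem exists_segment_to_facet (hd : 1 ≤ d) (i : Fin (d + 1)) :
    ∃ b : Space d, ‖b‖ ≤ K.hx ∧ ∀ x ∈ K.spaceSet, ∃ s₀ ∈ Icc (0 : ℝ) 1,
      x + s₀ • b ∈ K.facet i ∧ ∀ s ∈ Ioo 0 s₀, x + s • b ∈ K.spaceSet := by
  obtain ⟨i', hi'⟩ : ∃ i' : Fin (d + 1), i' ≠ i := by
    have : Nontrivial (Fin (d + 1)) := Fin.nontrivial_iff_two_le.2 (by omega)
    exact exists_ne i
  set P := K.simplex.points i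
  set Q := K.simplex.points i'
  have hQ : Q ∈ K.simplex.points '' {i}ᶜ := mem_image_of_mem _ hi'
  have hQf : Q ∈ K.facet i := subset_convexHull _ _ hQ
  have hr : range K.simplex.points = insert P (K.simplex.points '' {i}ᶜ) := by
    rw [← image_insert_eq, ← image_univ]
    congr 1
    ext m
    simp [em]
  have hfs : K.facet i ⊆ K.spaceSet := convexHull_mono (image_subset_range _ _)
  have hPs := K.simplex_mem_spaceSet i
  have hQs := K.simplex_mem_spaceSet i'
  refine ⟨Q - P, by rw [← dist_eq_norm]; exact K.dist_le_hx hQs hPs, fun x hx => ?_⟩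
  have hx' := hx
  rw [spaceSet, hr, convexHull_insert ⟨Q, hQ⟩, mem_convexJoin] at hx'
  obtain ⟨P', hP', y, hy, lam, m, hl, hm, hlm, rfl⟩ := hx'
  rw [mem_singleton_iff] at hP'
  subst hP'
  refine ⟨lam, ⟨hl, by linarith⟩, ?_, fun s hs => ?_⟩
  · have : lam • K.simplex.points i + m • y + lam • (Q - P) = lam • Q + m • y := by
      simp only [P]
      module
    rw [this]
    exact convex_convexHull ℝ _ hQf hy hl hm hlm
  · have hseg : ((lam - s) / lam) • P + (s / lam) • Q ∈ K.spaceSet := by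
      refine K.convex_spaceSet hPs hQs ?_ ?_ ?_
      · exact div_nonneg (by linarith [hs.2]) hl
      · exact div_nonneg hs.1.le hl
      · have : lam ≠ 0 := by linarith [hs.1, hs.2]
        field_simp
        ring
    have : lam • K.simplex.points i + m • y + s • (Q - P) =
        lam • (((lam - s) / lam) • P + (s / lam) • Q) + m • y := by
      have h2 : lam ≠ 0 := by linarith [hs.1, hs.2]
      rw [smul_add, smul_smul, smul_smul, mul_div_cancel₀ _ h2, mul_div_cancel₀ _ h2]
      simp only [P]
      module
    rw [this]
    exact K.convex_spaceSet hseg (hfs hy) hl hm hlm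

/-- Friedrichs inequality on a simplex with a facet on the boundary. -/
theorem eLpNorm_le_of_facet_subset (hd : 1 ≤ d) {Ω : Set (Space d)} (hΩ : IsLipschitzDomain Ω)
    (h : K.spaceSet ⊆ closure Ω) {i : Fin (d + 1)} (hi : K.facet i ⊆ frontier Ω)
    {u : Space d → ℝ} {g : Space d → Space d} (hu : HasH10Grad Ω u g) :
    eLpNorm u 2 (volume.restrict K.spaceSet) ≤
      ENNReal.ofReal K.hx * eLpNorm g 2 (volume.restrict K.spaceSet) := by
  obtain ⟨b, hb, hseg⟩ := K.exists_segment_to_facet hd i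
  rw [← restrict_interior_spaceSet]
  refine (hu.eLpNorm_le hΩ.isOpen.measurableSet isOpen_interior.measurableSet
    K.isCompact_spaceSet.measurableSet (K.interior_spaceSet_subset hΩ h) b fun x hx => ?_).trans ?_
  · obtain ⟨s₀, hs₀, h1, h2⟩ := hseg x (interior_subset hx)
    exact ⟨s₀, hs₀, (hΩ.mem_frontier_iff.1 (hi h1)).2, h2⟩
  · rw [restrict_interior_spaceSet]
    gcongr
    · rw [← ofReal_norm]
      exact ENNReal.ofReal_le_ofReal hb
    · exact inter_subset_left

end Cell

theorem Mesh.toSet_subset {d : ℕ} {T : ℝ} {Ω : Set (Space d)} (M : Mesh d T Ω) {K : Cell d}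
    (hK : K ∈ M.cells) : K.toSet ⊆ Icc 0 T ×ˢ closure Ω := by
  rw [← M.cover]
  exact subset_biUnion_of_mem (u := fun K : Cell d => K.toSet) hK

theorem Mesh.timeSet_subset {d : ℕ} {T : ℝ} {Ω : Set (Space d)} (M : Mesh d T Ω) {K : Cell d}
    (hK : K ∈ M.cells) : K.timeSet ⊆ Icc 0 T := fun t ht =>
  (M.toSet_subset hK (show (t, K.simplex.points 0) ∈ K.toSet from
    ⟨ht, K.simplex_mem_spaceSet 0⟩)).1

theorem Mesh.spaceSet_subset {d : ℕ} {T : ℝ} {Ω : Set (Space d)} (M : Mesh d T Ω) {K : Cell d}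
    (hK : K ∈ M.cells) : K.spaceSet ⊆ closure Ω := fun x hx =>
  (M.toSet_subset hK (show (K.a, x) ∈ K.toSet from ⟨left_mem_Icc.2 K.lt.le, hx⟩)).2

theorem Mesh.interior_toSet_subset {d : ℕ} {T : ℝ} {Ω : Set (Space d)} (hΩ : IsLipschitzDomain Ω)
    (M : Mesh d T Ω) {K : Cell d} (hK : K ∈ M.cells) : interior K.toSet ⊆ Ioo 0 T ×ˢ Ω := by
  rw [K.interior_toSet, ← interior_Icc (a := K.a), ← interior_Icc (a := (0 : ℝ))]
  exact Set.prod_mono (interior_mono (M.timeSet_subset hK))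
    (K.interior_spaceSet_subset hΩ (M.spaceSet_subset hK))

theorem Mesh.memLp_of_memLp {d : ℕ} {T : ℝ} {Ω : Set (Space d)} (hΩ : IsLipschitzDomain Ω)
    (M : Mesh d T Ω) {K : Cell d} (hK : K ∈ M.cells) {F : Type*} [NormedAddCommGroup F]
    {v : ℝ × Space d → F} (hv : MemLp v 2 (volume.restrict (Icc 0 T ×ˢ Ω))) :
    MemLp v 2 (volume.restrict K.toSet) := by
  rw [← K.restrict_interior_toSet]
  exact hv.mono_measure (Measure.restrict_mono
    ((M.interior_toSet_subset hΩ hK).trans (Set.prod_mono Ioo_subset_Icc_self subset_rfl)) le_rfl)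

theorem Mesh.ae_eq_of_ae_eq {d : ℕ} {T : ℝ} {Ω : Set (Space d)} (hΩ : IsLipschitzDomain Ω)
    (M : Mesh d T Ω) {K : Cell d} (hK : K ∈ M.cells) {F : Type*}
    {u v : ℝ × Space d → F} (h : u =ᵐ[volume.restrict (Icc 0 T ×ˢ Ω)] v) :
    u =ᵐ[volume.restrict K.toSet] v := by
  rw [← K.restrict_interior_toSet]
  exact ae_restrict_of_ae_restrict_of_subset
    ((M.interior_toSet_subset hΩ hK).trans (Set.prod_mono Ioo_subset_Icc_self subset_rfl)) h

/-- A function in `H¹₀(Ω)` that is continuous on the closure vanishes on the boundary. -/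
theorem HasH10Grad.eq_zero_of_mem_frontier {d : ℕ} {Ω : Set (Space d)} (hΩ : IsLipschitzDomain Ω)
    {u : Space d → ℝ} {g : Space d → Space d} (h : HasH10Grad Ω u g)
    (hu : ContinuousOn u (closure Ω)) {p : Space d} (hp : p ∈ frontier Ω) : u p = 0 := by
  by_contra hne
  obtain ⟨e, γ, L, r, he, hγ, hγe, hr, hgr⟩ := hΩ.graph p hp
  obtain ⟨hpc, hpΩ⟩ := hΩ.mem_frontier_iff.1 hp
  set c : ℝ := |u p| / 2 with hc
  have hc0 : 0 < c := half_pos (abs_pos.2 hne)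
  obtain ⟨ρ₀, hρ₀, hlow⟩ : ∃ ρ₀ > 0, ∀ x ∈ closure Ω, dist x p < ρ₀ → c ≤ |u x| := by
    obtain ⟨ρ₀, hρ₀, h1⟩ := Metric.continuousOn_iff.1 hu p hpc c hc0
    refine ⟨ρ₀, hρ₀, fun x hx hxp => ?_⟩
    have h2 := h1 x hx hxp
    rw [Real.dist_eq, abs_sub_comm] at h2
    have h3 := abs_sub_abs_le_abs_sub (u p) (u x)
    linarith
  set R := min ρ₀ r with hR
  have hR0 : 0 < R := lt_min hρ₀ hr
  have hL : (0 : ℝ) ≤ L := L.2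
  set ρ := R / (2 * (L + 2)) with hρ
  have hρ0 : 0 < ρ := by positivity
  have hρR : (L + 2) * ρ < R := by
    rw [hρ]
    have : ((L : ℝ) + 2) * (R / (2 * (L + 2))) = R / 2 := by field_simp
    linarith
  set D := (L + 1) * ρ with hD
  have hD0 : 0 < D := by positivity
  have hinner : ∀ x (s : ℝ), inner ℝ (x + s • e) e = inner ℝ x e + s := fun x s => by
    rw [inner_add_left, inner_smul_left, real_inner_self_eq_norm_sq, he]
    simp
  -- Near `p` the domain lies at depth at most `D` below the graph, because `p` is not below it and
  -- `γ` is Lipschitz.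
  have hdepth : ∀ x ∈ Metric.ball p ρ, γ x - inner ℝ x e ≤ D := by
    intro x hx
    have h1 : γ p ≤ inner ℝ p e := by
      by_contra! hlt
      exact hpΩ ((hgr p (Metric.mem_ball_self hr)).2 hlt)
    have h2 : γ x - γ p ≤ L * dist x p := (le_abs_self _).trans (hγ.dist_le_mul x p)
    have h3 : inner ℝ (p - x) e ≤ dist x p := by
      refine (real_inner_le_norm _ _).trans ?_
      rw [he, mul_one, ← dist_eq_norm, dist_comm]
    rw [inner_sub_left] at h3
    have h4 : dist x p ≤ ρ := (Metric.mem_ball.1 hx).le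
    have h5 : (L : ℝ) * dist x p ≤ L * ρ := mul_le_mul_of_nonneg_left h4 hL
    rw [hD]
    linarith
  set m := volume (Metric.ball p ρ ∩ Ω) with hm
  have hm0 : m ≠ 0 := by
    refine (Metric.isOpen_ball.inter hΩ.isOpen).measure_ne_zero _ ?_
    obtain ⟨y, hy, hyp⟩ := Metric.mem_closure_iff.1 hpc ρ hρ0
    exact ⟨y, by rwa [Metric.mem_ball, dist_comm], hy⟩
  have hmt : m ≠ ⊤ := ((measure_mono inter_subset_left).trans_lt measure_ball_lt_top).ne
  set G := eLpNorm g 2 (volume.restrict Ω) with hG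
  have hGt : G ≠ ⊤ := h.2.1.eLpNorm_ne_top
  -- Let `S` be the points of `Ω` near `p` that leave `Ω` under the shift by `δ e`, `δ = D / N`. By
  -- the Friedrichs inequality `∫_S u² ≤ δ² G²`, while `|u| ≥ c` on `S`. As `N` translates of `S`
  -- cover `B(p, ρ) ∩ Ω`, the measure `m` is at most `N |S|`. The bound `N δ² G² = D² G² / N` tends
  -- to zero, which is absurd.
  have key : ∀ N : ℕ, 0 < N → ENNReal.ofReal c ^ 2 * m ≤
      N * (ENNReal.ofReal (D / N) ^ 2 * G ^ 2) := by
    intro N hN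
    have hN' : (0 : ℝ) < N := by exact_mod_cast hN
    set δ := D / N with hδ
    have hδ0 : 0 < δ := by positivity
    have hNδ : N * δ = D := by rw [hδ]; field_simp
    set S : Set (Space d) := (Metric.ball p R ∩ Ω) ∩ (fun x => x + δ • e) ⁻¹' Ωᶜ with hS
    have hSm : MeasurableSet S := (Metric.isOpen_ball.inter hΩ.isOpen).measurableSet.inter
      ((hΩ.isOpen.isClosed_compl.preimage (by fun_prop)).measurableSet)
    have h1 : m ≤ N * volume S := by
      have hcov : Metric.ball p ρ ∩ Ω ⊆
          ⋃ k ∈ Finset.range N, (fun x => x + ((k : ℝ) * δ) • e) ⁻¹' S := by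
        rintro x ⟨hxB, hxΩ⟩
        have hballsub : ∀ s : ℝ, 0 ≤ s → s ≤ D → x + s • e ∈ Metric.ball p R := by
          intro s hs0 hs1
          rw [Metric.mem_ball]
          have h2 : dist (x + s • e) x ≤ D := by
            rw [dist_eq_norm, add_sub_cancel_left, norm_smul, he, mul_one, Real.norm_of_nonneg hs0]
            exact hs1
          have h3 := dist_triangle (x + s • e) x p
          have h4 := Metric.mem_ball.1 hxB
          rw [hD] at h2
          linarith
        have hxr : x ∈ Metric.ball p r := by
          have := hballsub 0 le_rfl hD0.le
          rw [zero_smul, add_zero] at this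
          exact Metric.ball_subset_ball (min_le_right _ _) this
        have hpos : 0 < γ x - inner ℝ x e := sub_pos.2 ((hgr x hxr).1 hxΩ)
        have hle := hdepth x hxB
        set t := γ x - inner ℝ x e with ht
        -- With `k = n - 1`, shifting `x` by `kδ e` leaves it below the graph, and one more shift by
        -- `δ e` does not.
        set n := ⌈t / δ⌉₊ with hn
        have hn1 : 0 < n := Nat.ceil_pos.2 (by positivity)
        obtain ⟨k, hk⟩ : ∃ k, n = k + 1 := ⟨n - 1, by omega⟩
        have hk1 : t ≤ (k + 1 : ℝ) * δ := by
          have := Nat.le_ceil (t / δ)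
          rw [← hn, hk, div_le_iff₀ hδ0] at this
          exact_mod_cast this
        have hk2 : k * δ < t := by
          have := Nat.ceil_lt_add_one (show 0 ≤ t / δ by positivity)
          rw [← hn, hk] at this
          push_cast at this
          rw [← lt_div_iff₀ hδ0]
          linarith
        have hkN : k < N := by
          have : (k : ℝ) * δ < N * δ := by rw [hNδ]; linarith
          exact_mod_cast lt_of_mul_lt_mul_right this hδ0.le
        have hkD : ((k : ℝ) + 1) * δ ≤ D := by
          rw [← hNδ]
          refine mul_le_mul_of_nonneg_right ?_ hδ0.le
          exact_mod_cast hkN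
        have hk0 : 0 ≤ (k : ℝ) * δ := by positivity
        simp only [mem_iUnion, Finset.mem_range]
        refine ⟨k, hkN, ⟨hballsub _ hk0 (by linarith), ?_⟩, ?_⟩
        · refine (hgr _ (Metric.ball_subset_ball (min_le_right _ _)
            (hballsub _ hk0 (by linarith)))).2 ?_
          rw [hinner, hγe]
          linarith
        · have e1 : x + ((k : ℝ) * δ) • e + δ • e = x + (((k : ℝ) + 1) * δ) • e := by module
          rw [mem_preimage, e1]
          intro hmem
          have := (hgr _ (Metric.ball_subset_ball (min_le_right _ _)
            (hballsub _ (by positivity) hkD))).1 hmem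
          rw [hinner, hγe] at this
          linarith
      calc m ≤ ∑ k ∈ Finset.range N, volume ((fun x => x + ((k : ℝ) * δ) • e) ⁻¹' S) :=
            (measure_mono hcov).trans (measure_biUnion_finset_le _ _)
        _ = N * volume S := by
            simp [measure_preimage_add_right]
    have h2 : ENNReal.ofReal c ^ 2 * volume S ≤ ENNReal.ofReal δ ^ 2 * G ^ 2 := by
      have h3 := h.eLpNorm_le hΩ.isOpen.measurableSet hSm MeasurableSet.univ
        (fun x hx => hx.1.2) (δ • e) fun x hx => ⟨1, by simp, by simpa using hx.2, by simp⟩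
      rw [univ_inter, ← ENNReal.pow_le_pow_left_iff two_ne_zero, mul_pow, eLpNorm_two_sq] at h3
      rw [enorm_smul, ← ofReal_norm e, he, ENNReal.ofReal_one, mul_one,
        Real.enorm_of_nonneg hδ0.le] at h3
      refine le_trans ?_ h3
      rw [← setLIntegral_const]
      refine setLIntegral_mono' hSm fun x hx => ?_
      rw [Real.enorm_eq_ofReal_abs]
      gcongr
      exact hlow x (subset_closure hx.1.2)
        ((Metric.mem_ball.1 hx.1.1).trans_le (min_le_left _ _))
    calc ENNReal.ofReal c ^ 2 * m ≤ ENNReal.ofReal c ^ 2 * (N * volume S) := by gcongr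
      _ = N * (ENNReal.ofReal c ^ 2 * volume S) := by ring
      _ ≤ _ := by gcongr
  have key' : ∀ N : ℕ, 0 < N → N * (c ^ 2 * m.toReal) ≤ D ^ 2 * G.toReal ^ 2 := by
    intro N hN
    have hN' : (0 : ℝ) < N := by exact_mod_cast hN
    have := ENNReal.toReal_mono (by finiteness) (key N hN)
    simp only [ENNReal.toReal_mul, ENNReal.toReal_pow, ENNReal.toReal_natCast,
      ENNReal.toReal_ofReal hc0.le, ENNReal.toReal_ofReal (div_pos hD0 hN').le] at this
    calc N * (c ^ 2 * m.toReal) ≤ N * (N * ((D / N) ^ 2 * G.toReal ^ 2)) := by gcongr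
      _ = _ := by field_simp
  have ha : 0 < c ^ 2 * m.toReal := mul_pos (by positivity) (ENNReal.toReal_pos hm0 hmt)
  obtain ⟨N, hN⟩ := exists_nat_gt (D ^ 2 * G.toReal ^ 2 / (c ^ 2 * m.toReal))
  rw [div_lt_iff₀ ha] at hN
  have h1 := key' (N + 1) (Nat.succ_pos _)
  push_cast at h1
  linarith

/-! ### The function spaces are closed under linear combinations -/

theorem IsTestFun.add {F : Type*} [NormedAddCommGroup F] [NormedSpace ℝ F] {U : Set F}
    {φ χ : F → ℝ} (hφ : IsTestFun U φ) (hχ : IsTestFun U χ) : IsTestFun U (φ + χ) :=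
  ⟨hφ.contDiff.add hχ.contDiff, hφ.hasCompactSupport.add hχ.hasCompactSupport,
    (tsupport_add φ χ).trans (union_subset hφ.tsupport_subset hχ.tsupport_subset)⟩

theorem IsTestFun.const_smul {F : Type*} [NormedAddCommGroup F] [NormedSpace ℝ F] {U : Set F}
    {φ : F → ℝ} (hφ : IsTestFun U φ) (c : ℝ) : IsTestFun U (c • φ) :=
  ⟨contDiff_const.smul hφ.contDiff, hφ.hasCompactSupport.smul_left (f := fun _ => c),
    (tsupport_smul_subset_right (fun _ => c) φ).trans hφ.tsupport_subset⟩

theorem isTestFun_zero {F : Type*} [NormedAddCommGroup F] [NormedSpace ℝ F] {U : Set F} :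
    IsTestFun U (0 : F → ℝ) :=
  ⟨contDiff_const, HasCompactSupport.zero, by simp [tsupport]⟩

theorem gradient_add {d : ℕ} {ψ χ : Space d → ℝ} {x : Space d} (hψ : DifferentiableAt ℝ ψ x)
    (hχ : DifferentiableAt ℝ χ x) : gradient (ψ + χ) x = gradient ψ x + gradient χ x := by
  rw [gradient, fderiv_add hψ hχ, map_add]; rfl

theorem gradient_const_smul {d : ℕ} {ψ : Space d → ℝ} {x : Space d} (hψ : DifferentiableAt ℝ ψ x)
    (c : ℝ) : gradient (c • ψ) x = c • gradient ψ x := by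
  rw [gradient, fderiv_const_smul hψ, map_smulₛₗ]; rfl

theorem gradient_zero {d : ℕ} (x : Space d) : gradient (0 : Space d → ℝ) x = 0 := by
  have : fderiv ℝ (0 : Space d → ℝ) x = 0 := by
    rw [show (0 : Space d → ℝ) = fun _ => (0 : ℝ) from rfl, fderiv_fun_const]; rfl
  rw [gradient, this, map_zero]

theorem IsTestFun.differentiableAt {F : Type*} [NormedAddCommGroup F] [NormedSpace ℝ F] {U : Set F}
    {φ : F → ℝ} (hφ : IsTestFun U φ) (x : F) : DifferentiableAt ℝ φ x :=
  hφ.contDiff_one.differentiable one_ne_zero x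

section

variable {d : ℕ} {Ω : Set (Space d)}

theorem HasH10Grad.add {u u' : Space d → ℝ} {g g' : Space d → Space d} (h : HasH10Grad Ω u g)
    (h' : HasH10Grad Ω u' g') : HasH10Grad Ω (u + u') (g + g') := by
  obtain ⟨hu, hg, ψ, hψ, h1, h2⟩ := h
  obtain ⟨hu', hg', ψ', hψ', h1', h2'⟩ := h'
  refine ⟨hu.add hu', hg.add hg', fun n => ψ n + ψ' n, fun n => (hψ n).add (hψ' n), ?_, ?_⟩
  · refine tendsto_of_tendsto_of_tendsto_of_le_of_le tendsto_const_nhds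
      (by simpa using h1.add h1') (fun _ => zero_le) fun n => ?_
    have e : (fun x => (u + u') x - (ψ n + ψ' n) x) =
        (fun x => u x - ψ n x) + fun x => u' x - ψ' n x := by
      funext x; simp only [Pi.add_apply]; ring
    simp only [e]
    exact eLpNorm_add_le (hu.sub (hψ n).memLp).1 (hu'.sub (hψ' n).memLp).1 (by norm_num)
  · refine tendsto_of_tendsto_of_tendsto_of_le_of_le tendsto_const_nhds
      (by simpa using h2.add h2') (fun _ => zero_le) fun n => ?_
    have e : (fun x => (g + g') x - gradient (ψ n + ψ' n) x) =
        (fun x => g x - gradient (ψ n) x) + fun x => g' x - gradient (ψ' n) x := by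
      funext x
      rw [gradient_add ((hψ n).differentiableAt x) ((hψ' n).differentiableAt x)]
      simp only [Pi.add_apply]
      abel
    simp only [e]
    exact eLpNorm_add_le (hg.sub ((hψ n).memLp_gradient.restrict Ω)).1
      (hg'.sub ((hψ' n).memLp_gradient.restrict Ω)).1 (by norm_num)

theorem HasH10Grad.const_smul {u : Space d → ℝ} {g : Space d → Space d} (h : HasH10Grad Ω u g)
    (c : ℝ) : HasH10Grad Ω (c • u) (c • g) := by
  obtain ⟨hu, hg, ψ, hψ, h1, h2⟩ := h
  refine ⟨hu.const_smul c, hg.const_smul c, fun n => c • ψ n, fun n => (hψ n).const_smul c, ?_, ?_⟩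
  · have e : ∀ n, (fun x => (c • u) x - (c • ψ n) x) = c • fun x => u x - ψ n x := fun n => by
      funext x; simp only [Pi.smul_apply, smul_sub]
    simp only [e, eLpNorm_const_smul]
    simpa using ENNReal.Tendsto.const_mul h1 (Or.inr (enorm_ne_top (x := c)))
  · have e : ∀ n, (fun x => (c • g) x - gradient (c • ψ n) x) =
        c • fun x => g x - gradient (ψ n) x := fun n => by
      funext x
      rw [gradient_const_smul ((hψ n).differentiableAt x)]
      simp only [Pi.smul_apply, smul_sub]
    simp only [e, eLpNorm_const_smul]
    simpa using ENNReal.Tendsto.const_mul h2 (Or.inr (enorm_ne_top (x := c)))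

theorem hasH10Grad_zero : HasH10Grad Ω (0 : Space d → ℝ) 0 :=
  ⟨MemLp.zero, MemLp.zero, fun _ => 0, fun _ => isTestFun_zero, by simp, by
    simp [gradient_zero]⟩

variable {T : ℝ}

theorem MemL2H10.add {u v : ℝ × Space d → ℝ} (hu : MemL2H10 T Ω u) (hv : MemL2H10 T Ω v) :
    MemL2H10 T Ω (u + v) := by
  obtain ⟨h1, G, hG, h2⟩ := hu
  obtain ⟨h1', G', hG', h2'⟩ := hv
  refine ⟨h1.add h1', G + G', hG.add hG', ?_⟩
  filter_upwards [h2, h2'] with t ht ht'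
  exact ht.add ht'

theorem MemL2H10.const_smul {u : ℝ × Space d → ℝ} (hu : MemL2H10 T Ω u) (c : ℝ) :
    MemL2H10 T Ω (c • u) := by
  obtain ⟨h1, G, hG, h2⟩ := hu
  refine ⟨h1.const_smul c, c • G, hG.const_smul c, ?_⟩
  filter_upwards [h2] with t ht
  exact ht.const_smul c

theorem memL2H10_zero : MemL2H10 T Ω (0 : ℝ × Space d → ℝ) :=
  ⟨MemLp.zero, 0, MemLp.zero, ae_of_all _ fun _ => hasH10Grad_zero⟩

theorem integrable_integral_mul_mul {v : ℝ × Space d → ℝ}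
    (hv : MemLp v 2 (volume.restrict (Icc 0 T ×ˢ Ω))) (hΩ : volume Ω ≠ ⊤) {ψ : Space d → ℝ}
    {V : Set (Space d)} (hψ : IsTestFun V ψ) {η : ℝ → ℝ} (hη : Continuous η) :
    Integrable (fun t => (∫ x in Ω, v (t, x) * ψ x) * η t) (volume.restrict (Icc 0 T)) := by
  have : IsFiniteMeasure ((volume : Measure (ℝ × Space d)).restrict (Icc 0 T ×ˢ Ω)) := by
    refine ⟨?_⟩
    rw [Measure.restrict_apply_univ, Measure.volume_eq_prod, Measure.prod_prod]
    exact ENNReal.mul_lt_top measure_Icc_lt_top hΩ.lt_top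
  obtain ⟨C, hC⟩ := hψ.exists_bound
  have hcont := hψ.continuous
  have h1 : Integrable (fun z : ℝ × Space d => v z * ψ z.2) (volume.restrict (Icc 0 T ×ˢ Ω)) :=
    (hv.integrable (by norm_num)).mul_bdd (c := C)
      (by apply Continuous.aestronglyMeasurable; fun_prop) (ae_of_all _ fun z => hC _)
  rw [Measure.volume_eq_prod, ← Measure.prod_restrict] at h1
  obtain ⟨C', hC'⟩ := isCompact_Icc.exists_bound_of_continuousOn (hη.continuousOn (s := Icc 0 T))
  exact h1.integral_prod_left.mul_bdd (c := C') hη.aestronglyMeasurable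
    ((ae_restrict_iff' measurableSet_Icc).2 (ae_of_all _ hC'))

theorem integrable_apply_mul {ξ : ℝ → (Space d → ℝ) → ℝ} {N : ℝ → ℝ}
    (hN : MemLp N 2 (volume.restrict (Icc 0 T))) (hξ : ∀ t ∈ Icc 0 T, IsHMinusOne Ω (ξ t) (N t))
    {ψ : Space d → ℝ} (hψ : IsTestFun Ω ψ)
    (hm : AEStronglyMeasurable (fun t => ξ t ψ) (volume.restrict (Icc 0 T)))
    {η : ℝ → ℝ} {V : Set ℝ} (hη : IsTestFun V η) :
    Integrable (fun t => ξ t ψ * η t) (volume.restrict (Icc 0 T)) := by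
  obtain ⟨C, hC⟩ := hη.exists_bound
  refine Integrable.mul_bdd (c := C) ?_ hη.continuous.aestronglyMeasurable (ae_of_all _ hC)
  refine Integrable.mono' ((hN.integrable (by norm_num)).mul_const
    (eLpNorm (gradient ψ) 2 (volume.restrict Ω)).toReal) hm ?_
  exact (ae_restrict_iff' measurableSet_Icc).2 (ae_of_all _ fun t ht => (hξ t ht).bound ψ hψ)

theorem MemX.add (hΩ : volume Ω ≠ ⊤) {u v : ℝ × Space d → ℝ} (hu : MemX T Ω u)
    (hv : MemX T Ω v) : MemX T Ω (u + v) := by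
  refine ⟨hu.1.add hv.1, ?_⟩
  obtain ⟨⟨hu2, G, hG, huG⟩, ξ, N, hN, hξ, h⟩ := hu
  obtain ⟨⟨hv2, G', hG', hvG⟩, ξ', N', hN', hξ', h'⟩ := hv
  refine ⟨fun t => ξ t + ξ' t, N + N', hN.add hN', fun t ht => ⟨fun ψ χ hψ hχ => ?_,
    fun c ψ hψ => ?_, fun ψ hψ => ?_⟩, fun ψ hψ => ⟨(h ψ hψ).1.add (h' ψ hψ).1, fun η hη => ?_⟩⟩
  · simp only [Pi.add_apply]
    rw [(hξ t ht).map_add ψ χ hψ hχ, (hξ' t ht).map_add ψ χ hψ hχ]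
    ring
  · simp only [Pi.add_apply]
    rw [(hξ t ht).map_smul c ψ hψ, (hξ' t ht).map_smul c ψ hψ]
    ring
  · simp only [Pi.add_apply]
    refine (abs_add_le _ _).trans ((add_le_add ((hξ t ht).bound ψ hψ) ((hξ' t ht).bound ψ hψ)).trans
      (le_of_eq ?_))
    ring
  · have e1 := (h ψ hψ).2 η hη
    have e2 := (h' ψ hψ).2 η hη
    have i1 := integrable_apply_mul hN hξ hψ (h ψ hψ).1 hη
    have i2 := integrable_apply_mul hN' hξ' hψ (h' ψ hψ).1 hη
    have hηc : Continuous (deriv η) := hη.contDiff_one.continuous_deriv (by simp)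
    have i3 := integrable_integral_mul_mul hu2 hΩ hψ hηc
    have i4 := integrable_integral_mul_mul hv2 hΩ hψ hηc
    simp only [Pi.add_apply, add_mul]
    rw [integral_add i1 i2, neg_add, ← e1, ← e2, ← integral_add i3 i4]
    refine integral_congr_ae ?_
    -- Splitting the spatial integral needs integrable slices, which is known for almost every `t`.
    filter_upwards [huG, hvG] with t h1 h2
    have e3 := integral_add (h1.1.integrable_mul (hψ.memLp (μ := volume.restrict Ω) (p := 2)))
      (h2.1.integrable_mul (hψ.memLp (μ := volume.restrict Ω) (p := 2)))
    simp only [Pi.mul_apply] at e3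
    rw [e3, add_mul]

theorem MemX.const_smul {u : ℝ × Space d → ℝ} (hu : MemX T Ω u) (a : ℝ) :
    MemX T Ω (a • u) := by
  refine ⟨hu.1.const_smul a, ?_⟩
  obtain ⟨-, ξ, N, hN, hξ, h⟩ := hu
  refine ⟨fun t => a • ξ t, |a| • N, hN.const_smul _, fun t ht => ⟨fun ψ χ hψ hχ => ?_,
    fun c ψ hψ => ?_, fun ψ hψ => ?_⟩, fun ψ hψ => ⟨(h ψ hψ).1.const_smul a, fun η hη => ?_⟩⟩
  · simp only [Pi.smul_apply, smul_eq_mul]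
    rw [(hξ t ht).map_add ψ χ hψ hχ]
    ring
  · simp only [Pi.smul_apply, smul_eq_mul]
    rw [(hξ t ht).map_smul c ψ hψ]
    ring
  · simp only [Pi.smul_apply, smul_eq_mul]
    rw [abs_mul, mul_assoc]
    exact mul_le_mul_of_nonneg_left ((hξ t ht).bound ψ hψ) (abs_nonneg _)
  · have e1 := (h ψ hψ).2 η hη
    simp only [Pi.smul_apply, smul_eq_mul, mul_assoc, integral_const_mul]
    rw [e1]
    ring

theorem memX_zero : MemX T Ω (0 : ℝ × Space d → ℝ) :=
  ⟨memL2H10_zero, 0, 0, MemLp.zero, fun t _ => ⟨by simp, by simp, by simp⟩,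
    fun ψ _ => ⟨aestronglyMeasurable_const, fun η _ => by simp⟩⟩

theorem IsLipschitzDomain.volume_ne_top (hΩ : IsLipschitzDomain Ω) : volume Ω ≠ ⊤ :=
  hΩ.isBounded.measure_lt_top.ne

end

/-! ### Algebraic properties of the interpolation operator -/

namespace Mesh

variable {d : ℕ} {T : ℝ} {Ω : Set (Space d)} {M : Mesh d T Ω} {k ℓ : ℕ}

/-- Functions that are continuous on each of finitely many closed sets are continuous on the union.
-/
theorem continuousOn_of_mem_Sh {w : ℝ × Space d → ℝ} (hw : w ∈ M.Sh k ℓ) :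
    ContinuousOn w (Icc 0 T ×ˢ closure Ω) := by
  rw [← M.cover]
  have h := (locallyFinite_of_finite fun K : M.cells => K.1.toSet).continuousOn_iUnion (g := w)
    (fun K => K.1.isCompact_toSet.isClosed) fun K => by
      obtain ⟨p, hp, hwp⟩ := hw K.1 K.2
      exact (continuous_of_mem_tensorPoly hp).continuousOn.congr hwp
  rwa [iUnion_subtype] at h

theorem zero_mem_Sh : (0 : ℝ × Space d → ℝ) ∈ M.Sh k ℓ := fun _ _ =>
  ⟨0, Submodule.zero_mem _, fun _ _ => rfl⟩

theorem add_mem_Sh {u v : ℝ × Space d → ℝ} (hu : u ∈ M.Sh k ℓ) (hv : v ∈ M.Sh k ℓ) :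
    u + v ∈ M.Sh k ℓ := fun K hK => by
  obtain ⟨p, hp, h⟩ := hu K hK
  obtain ⟨q, hq, h'⟩ := hv K hK
  exact ⟨p + q, Submodule.add_mem _ hp hq, fun z hz => congrArg₂ (· + ·) (h hz) (h' hz)⟩

theorem smul_mem_Sh {u : ℝ × Space d → ℝ} (hu : u ∈ M.Sh k ℓ) (c : ℝ) : c • u ∈ M.Sh k ℓ :=
  fun K hK => by
    obtain ⟨p, hp, h⟩ := hu K hK
    exact ⟨c • p, Submodule.smul_mem _ _ hp, fun z hz => congrArg (c • ·) (h hz)⟩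

/-- For almost every `t` the slice is in `H¹₀(Ω)` and continuous up to `∂Ω`, so it vanishes there.
Continuity in time extends this to all times, including the endpoints. -/
theorem eq_zero_of_mem_Xh (hT : 0 < T) (hΩ : IsLipschitzDomain Ω) {w : ℝ × Space d → ℝ}
    (hw : w ∈ M.Xh k ℓ) {z : ℝ × Space d} (hz1 : z.1 ∈ Icc 0 T) (hz2 : z.2 ∈ frontier Ω) :
    w z = 0 := by
  obtain ⟨-, G, -, hG⟩ := hw.2.1
  have hc := continuousOn_of_mem_Sh hw.1
  have hzc : z.2 ∈ closure Ω := frontier_subset_closure hz2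
  have hcx : ContinuousOn (fun t => w (t, z.2)) (Icc 0 T) :=
    hc.comp (by fun_prop) fun t ht => ⟨ht, hzc⟩
  have hae : (fun t => w (t, z.2)) =ᵐ[volume.restrict (Icc 0 T)] fun _ => 0 := by
    filter_upwards [hG, ae_restrict_mem measurableSet_Icc] with t ht htI
    exact ht.eq_zero_of_mem_frontier hΩ
      (hc.comp (f := fun x => (t, x)) (by fun_prop) fun x hx => ⟨htI, hx⟩) hz2
  exact Measure.eqOn_Icc_of_ae_eq volume hT.ne hae hcx continuousOn_const hz1

namespace Dofs

variable {D : M.Dofs k ℓ} {loc : ℝ × Space d → Cell d}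

theorem interp_eq (v : ℝ × Space d → ℝ) :
    D.interp loc v = ∑ j ∈ D.nodes, D.nodalValue loc v j • D.basis j := by
  funext z
  simp [interp]

theorem interp_node (v : ℝ × Space d → ℝ) {j : ℝ × Space d} (hj : j ∈ D.nodes) :
    D.interp loc v j = D.nodalValue loc v j := by
  rw [interp, Finset.sum_eq_single_of_mem j hj, D.basis_self j hj, mul_one]
  intro i hi hij
  rw [D.basis_ne j hj i hi hij.symm, mul_zero]

theorem nodalValue_of_frontier (v : ℝ × Space d → ℝ) {j : ℝ × Space d} (hj : j.2 ∈ frontier Ω) :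
    D.nodalValue loc v j = 0 := by
  rw [nodalValue, if_neg fun h => h.2 hj]

theorem nodalValue_of_notMem_frontier (v : ℝ × Space d → ℝ) {j : ℝ × Space d} (hj : j ∈ D.nodes)
    (hj' : j.2 ∉ frontier Ω) : D.nodalValue loc v j = l2Proj k ℓ (loc j).toSet v j := by
  rw [nodalValue, if_pos ⟨hj, hj'⟩]

theorem interp_mem_Xh (hΩ : IsLipschitzDomain Ω) (v : ℝ × Space d → ℝ) :
    D.interp loc v ∈ M.Xh k ℓ := by
  rw [interp_eq]
  refine Finset.sum_induction _ (fun w => w ∈ M.Xh k ℓ) (fun u v hu hv =>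
    ⟨add_mem_Sh hu.1 hv.1, hu.2.add hΩ.volume_ne_top hv.2⟩) ⟨zero_mem_Sh, memX_zero⟩ fun j hj => ?_
  by_cases hjf : j.2 ∈ frontier Ω
  · rw [nodalValue_of_frontier v hjf, zero_smul]
    exact ⟨zero_mem_Sh, memX_zero⟩
  · have := D.basis_mem_Xh j hj hjf
    exact ⟨smul_mem_Sh this.1 _, this.2.const_smul _⟩

theorem interp_congr_ae (hΩ : IsLipschitzDomain Ω)
    (hloc : ∀ j ∈ D.nodes, loc j ∈ M.cells ∧ j ∈ (loc j).toSet)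
    {u v : ℝ × Space d → ℝ} (h : u =ᵐ[volume.restrict (Icc 0 T ×ˢ Ω)] v) :
    D.interp loc u = D.interp loc v := by
  rw [interp_eq, interp_eq]
  refine Finset.sum_congr rfl fun j hj => ?_
  have := l2Proj_congr_ae (k := k) (ℓ := ℓ) (M.ae_eq_of_ae_eq hΩ (hloc j hj).1 h)
  rw [nodalValue, nodalValue, this]

theorem interp_lincomb (hd : 1 ≤ d) {κ : ℝ} (hκ : 1 ≤ κ) (hD : D.IsRegular κ) (hΩ : IsLipschitzDomain Ω)
    (hloc : ∀ j ∈ D.nodes, loc j ∈ M.cells ∧ j ∈ (loc j).toSet)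
    {u v : ℝ × Space d → ℝ} (hu : MemX T Ω u) (hv : MemX T Ω v) (a b : ℝ) :
    D.interp loc (a • u + b • v) = a • D.interp loc u + b • D.interp loc v := by
  rw [interp_eq, interp_eq, interp_eq, Finset.smul_sum, Finset.smul_sum, ← Finset.sum_add_distrib]
  refine Finset.sum_congr rfl fun j hj => ?_
  have hK := (hloc j hj).1
  rw [smul_smul, smul_smul, ← add_smul]
  congr 1
  by_cases hjf : j.2 ∈ frontier Ω
  · simp [nodalValue_of_frontier _ hjf]
  · rw [nodalValue_of_notMem_frontier _ hj hjf, nodalValue_of_notMem_frontier _ hj hjf,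
      nodalValue_of_notMem_frontier _ hj hjf, l2Proj_lincomb (loc j).isCompact_toSet
      (Cell.ShapeRegular.interior_toSet_nonempty hd hκ (hD.shape _ hK))
      (M.memLp_of_memLp hΩ hK hu.1.1) (M.memLp_of_memLp hΩ hK hv.1.1)]
    rfl

/-- The nodal values agree: on `K(j)` the function is a polynomial, which the projection reproduces,
and at lateral nodes both values are zero. -/
theorem interp_eqOn (hd : 1 ≤ d) {κ : ℝ} (hκ : 1 ≤ κ) (hD : D.IsRegular κ) (hΩ : IsLipschitzDomain Ω)
    (hloc : ∀ j ∈ D.nodes, loc j ∈ M.cells ∧ j ∈ (loc j).toSet)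
    (hT : 0 < T) {w : ℝ × Space d → ℝ} (hw : w ∈ M.Xh k ℓ) :
    EqOn (D.interp loc w) w (Icc 0 T ×ˢ closure Ω) := by
  intro z hz
  rw [D.expand w hw.1 z hz, interp]
  refine Finset.sum_congr rfl fun j hj => ?_
  congr 1
  have hjc := D.nodes_subset j hj
  by_cases hjf : j.2 ∈ frontier Ω
  · rw [nodalValue_of_frontier _ hjf, eq_zero_of_mem_Xh hT hΩ hw hjc.1 hjf]
  · obtain ⟨hK, hjK⟩ := hloc j hj
    obtain ⟨p, hp, hwp⟩ := hw.1 _ hK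
    rw [nodalValue_of_notMem_frontier _ hj hjf, l2Proj_eq_of_eqOn (loc j).isCompact_toSet
      (Cell.ShapeRegular.interior_toSet_nonempty hd hκ (hD.shape _ hK)) hp hwp, hwp hjK]

end Dofs

end Mesh

/-! ### Supports of the nodal basis functions -/

namespace Mesh

namespace Dofs

variable {d : ℕ} {T : ℝ} {Ω : Set (Space d)} {M : Mesh d T Ω} {k ℓ : ℕ} {D : M.Dofs k ℓ}

theorem supp_subset (j : ℝ × Space d) : D.supp j ⊆ Icc 0 T ×ˢ closure Ω :=
  closure_minimal (fun _ hz => hz.1) (isClosed_Icc.prod isClosed_closure)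

/-- If some point of `K` were outside the closed support, `φ_j` would vanish on an open part of `K`,
hence on all of `K`, as it is a polynomial there. -/
theorem subset_supp (hne : ∀ K ∈ M.cells, (interior K.toSet).Nonempty) {K : Cell d}
    (hK : K ∈ M.cells) {j z : ℝ × Space d} (hj : j ∈ D.nodes) (hz : z ∈ K.toSet)
    (hjz : D.basis j z ≠ 0) : K.toSet ⊆ D.supp j := by
  obtain ⟨p, hp, hpK⟩ := D.basis_mem j hj K hK
  intro y hy
  by_contra hys
  have hopen : IsOpen (D.supp j)ᶜ := isClosed_closure.isOpen_compl
  have hycl : y ∈ closure (interior K.toSet) := by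
    rw [K.convex_toSet.closure_interior_eq_closure_of_nonempty_interior (hne K hK)]
    exact subset_closure hy
  obtain ⟨x, hx1, hx2⟩ := mem_closure_iff.1 hycl _ hopen hys
  have h0 : EqOn p 0 ((D.supp j)ᶜ ∩ interior K.toSet) := by
    rintro x ⟨hx, hxK⟩
    have hxK' := interior_subset hxK
    rw [← hpK hxK']
    by_contra hne
    exact hx (subset_closure ⟨M.toSet_subset hK hxK', hne⟩)
  have hp0 := eq_zero_of_mem_tensorPoly hp (hopen.inter isOpen_interior) ⟨x, hx1, hx2⟩ h0
  rw [hpK hz, hp0] at hjz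
  exact hjz rfl

theorem subset_supp_of_mem (hne : ∀ K ∈ M.cells, (interior K.toSet).Nonempty) {K : Cell d}
    (hK : K ∈ M.cells) {j : ℝ × Space d} (hj : j ∈ D.nodes) (hjK : j ∈ K.toSet) :
    K.toSet ⊆ D.supp j :=
  subset_supp hne hK hj hjK (by rw [D.basis_self j hj]; exact one_ne_zero)

theorem exists_cell_of_mem_supp {j z : ℝ × Space d} (hz : z ∈ D.supp j) :
    ∃ K ∈ M.cells, z ∈ K.toSet ∧ ∃ y ∈ K.toSet, D.basis j y ≠ 0 := by
  classical
  set s := M.cells.filter fun K => ∃ y ∈ K.toSet, D.basis j y ≠ 0 with hs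
  have hcl : IsClosed (⋃ K ∈ s, K.toSet) :=
    s.finite_toSet.isClosed_biUnion fun K _ => K.isCompact_toSet.isClosed
  have hsub : D.supp j ⊆ ⋃ K ∈ s, K.toSet := by
    refine closure_minimal ?_ hcl
    rintro y ⟨hy, hy0⟩
    rw [← M.cover] at hy
    simp only [mem_iUnion, exists_prop] at hy ⊢
    obtain ⟨K, hK, hyK⟩ := hy
    exact ⟨K, Finset.mem_filter.2 ⟨hK, y, hyK, hy0⟩, hyK⟩
  have := hsub hz
  simp only [mem_iUnion, exists_prop] at this
  obtain ⟨K, hK, hzK⟩ := this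
  obtain ⟨hK1, hK2⟩ := Finset.mem_filter.1 hK
  exact ⟨K, hK1, hzK, hK2⟩

/-- If the restriction of `φ_j` to a set of times is a discrete function that vanishes at `j`, then
it vanishes. -/
theorem basis_eq_zero_of_indicator_mem {j : ℝ × Space d} (hj : j ∈ D.nodes) {A : Set ℝ}
    (hA : (fun z : ℝ × Space d => A.indicator 1 z.1 * D.basis j z) ∈ M.Sh k ℓ) (hjA : j.1 ∉ A)
    {z : ℝ × Space d} (hz : z ∈ Icc 0 T ×ˢ closure Ω) (hzA : z.1 ∈ A) : D.basis j z = 0 := by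
  have h := D.expand _ hA z hz
  rw [Finset.sum_eq_zero] at h
  · simpa [hzA] using h
  · intro i hi
    by_cases hij : i = j
    · subst hij
      simp [hjA]
    · simp [D.basis_ne i hi j hj hij]

/-- Suppose the support skips the time `τ`. Then no cell on which `φ_j` is nonzero meets this time,
and cutting `φ_j` off at `τ` gives an element of `S_h`. The part on the side away from `j` vanishes
at all nodes, hence everywhere, contrary to the support reaching both sides. -/
theorem ordConnected_fst_image_supp (hne : ∀ K ∈ M.cells, (interior K.toSet).Nonempty)
    {j : ℝ × Space d} (hj : j ∈ D.nodes) : (Prod.fst '' D.supp j).OrdConnected := by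
  refine ⟨?_⟩
  rintro _ ⟨z, hz, rfl⟩ _ ⟨z', hz', rfl⟩ τ ⟨h1, h2⟩
  by_contra hτ
  have hcell : ∀ K ∈ M.cells, (∃ y ∈ K.toSet, D.basis j y ≠ 0) → K.b < τ ∨ τ < K.a := by
    rintro K hK ⟨y, hy, hy0⟩
    by_contra! hcon
    exact hτ ⟨(τ, y.2), subset_supp hne hK hj hy hy0 ⟨⟨hcon.2, hcon.1⟩, hy.2⟩, rfl⟩
  have hmem : ∀ A : Set ℝ, (A = Iio τ ∨ A = Ioi τ) →
      (fun z : ℝ × Space d => A.indicator 1 z.1 * D.basis j z) ∈ M.Sh k ℓ := by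
    intro A hA K hK
    by_cases h0 : ∃ y ∈ K.toSet, D.basis j y ≠ 0
    · have hin : (∀ t ∈ K.timeSet, t ∈ A) ∨ (∀ t ∈ K.timeSet, t ∉ A) := by
        rcases hA with rfl | rfl <;> rcases hcell K hK h0 with h | h
        · exact Or.inl fun t ht => lt_of_le_of_lt ht.2 h
        · exact Or.inr fun t ht => not_lt.2 (h.le.trans ht.1)
        · exact Or.inr fun t ht => not_lt.2 (ht.2.trans h.le)
        · exact Or.inl fun t ht => lt_of_lt_of_le h ht.1
      rcases hin with h | h
      · obtain ⟨p, hp, hpK⟩ := D.basis_mem j hj K hK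
        refine ⟨p, hp, fun y hy => ?_⟩
        simp only [indicator_of_mem (h y.1 hy.1), Pi.one_apply, one_mul]
        exact hpK hy
      · refine ⟨0, Submodule.zero_mem _, fun y hy => ?_⟩
        simp [indicator_of_notMem (h y.1 hy.1)]
    · push Not at h0
      exact ⟨0, Submodule.zero_mem _, fun y hy => by simp [h0 y hy]⟩
  obtain ⟨K, hK, hzK, y, hyK, hy0⟩ := exists_cell_of_mem_supp hz
  obtain ⟨K', hK', hzK', y', hyK', hy0'⟩ := exists_cell_of_mem_supp hz'
  have hKlt : K.b < τ := (hcell K hK ⟨y, hyK, hy0⟩).resolve_right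
    fun h => absurd (hzK.1.1.trans h1) (not_le.2 h)
  have hKlt' : τ < K'.a := (hcell K' hK' ⟨y', hyK', hy0'⟩).resolve_left
    fun h => absurd (h2.trans hzK'.1.2) (not_le.2 h)
  -- Keep the part after `τ` if `j` is not after it, and the part before `τ` otherwise.
  rcases le_or_gt j.1 τ with h | h
  · exact hy0' (basis_eq_zero_of_indicator_mem hj (hmem (Ioi τ) (Or.inr rfl)) (not_lt.2 h)
      (M.toSet_subset hK' hyK') (lt_of_lt_of_le hKlt' hyK'.1.1))
  · exact hy0 (basis_eq_zero_of_indicator_mem hj (hmem (Iio τ) (Or.inl rfl)) (not_lt.2 h.le)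
      (M.toSet_subset hK hyK) (lt_of_le_of_lt hyK.1.2 hKlt))

open Classical in
/-- The nodes `j` with `K ⊆ supp φ_j`. -/
def activeNodes (D : M.Dofs k ℓ) (K : Cell d) : Finset (ℝ × Space d) :=
  D.nodes.filter fun j => K.toSet ⊆ D.supp j

theorem mem_activeNodes {K : Cell d} {j : ℝ × Space d} :
    j ∈ D.activeNodes K ↔ j ∈ D.nodes ∧ K.toSet ⊆ D.supp j := by
  simp [activeNodes]

theorem supp_subset_suppUnion {K : Cell d} {j : ℝ × Space d} (hj : j ∈ D.activeNodes K) :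
    D.supp j ⊆ D.suppUnion K :=
  subset_biUnion_of_mem (u := fun j => D.supp j)
    (show j ∈ {j | j ∈ D.nodes ∧ K.toSet ⊆ D.supp j} from mem_activeNodes.1 hj)

theorem suppUnion_subset_patch (K : Cell d) : D.suppUnion K ⊆ D.patch K := fun _ hz =>
  ⟨mem_image_of_mem _ hz, mem_image_of_mem _ hz⟩

theorem supp_subset_patch {K : Cell d} {j : ℝ × Space d} (hj : j ∈ D.activeNodes K) :
    D.supp j ⊆ D.patch K :=
  (supp_subset_suppUnion hj).trans (suppUnion_subset_patch K)

theorem suppUnion_subset (K : Cell d) : D.suppUnion K ⊆ Icc 0 T ×ˢ closure Ω :=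
  iUnion₂_subset fun j _ => supp_subset j

theorem patch_subset (K : Cell d) : D.patch K ⊆ Icc 0 T ×ˢ closure Ω := by
  rintro ⟨t, x⟩ ⟨⟨z, hz, rfl⟩, ⟨z', hz', rfl⟩⟩
  exact ⟨(suppUnion_subset K hz).1, (suppUnion_subset K hz').2⟩

theorem basis_eq_zero_of_notMem_activeNodes (hne : ∀ K ∈ M.cells, (interior K.toSet).Nonempty)
    {K : Cell d} (hK : K ∈ M.cells) {j : ℝ × Space d} (hj : j ∈ D.nodes)
    (hj' : j ∉ D.activeNodes K) {z : ℝ × Space d} (hz : z ∈ K.toSet) : D.basis j z = 0 := by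
  by_contra h
  exact hj' (mem_activeNodes.2 ⟨hj, subset_supp hne hK hj hz h⟩)

theorem sum_activeNodes (hne : ∀ K ∈ M.cells, (interior K.toSet).Nonempty)
    {K : Cell d} (hK : K ∈ M.cells) (a : ℝ × Space d → ℝ) {z : ℝ × Space d} (hz : z ∈ K.toSet) :
    ∑ j ∈ D.nodes, a j * D.basis j z = ∑ j ∈ D.activeNodes K, a j * D.basis j z := by
  symm
  refine Finset.sum_subset (fun j hj => (mem_activeNodes.1 hj).1) fun j hj hj' => ?_
  rw [basis_eq_zero_of_notMem_activeNodes hne hK hj hj' hz, mul_zero]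

/-- The constant one is in `S_h`, without boundary conditions, so its nodal expansion applies. This
is the reason for including the lateral nodes. -/
theorem sum_basis_eq_one (hne : ∀ K ∈ M.cells, (interior K.toSet).Nonempty)
    {K : Cell d} (hK : K ∈ M.cells) {z : ℝ × Space d} (hz : z ∈ K.toSet) :
    ∑ j ∈ D.activeNodes K, D.basis j z = 1 := by
  have h : (fun _ => (1 : ℝ)) ∈ M.Sh k ℓ := fun K _ =>
    ⟨fun _ => 1, const_mem_tensorPoly _ _ _ _, fun _ _ => rfl⟩
  have h1 := D.expand _ h z (M.toSet_subset hK hz)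
  rw [sum_activeNodes hne hK (fun _ => 1) hz] at h1
  simpa using h1.symm

theorem toSet_subset_patch (hne : ∀ K ∈ M.cells, (interior K.toSet).Nonempty)
    {K : Cell d} (hK : K ∈ M.cells) : K.toSet ⊆ D.patch K := by
  obtain ⟨z, hz⟩ := hne K hK
  have h1 := sum_basis_eq_one (D := D) hne hK (interior_subset hz)
  have : (D.activeNodes K).Nonempty := by
    by_contra hcon
    rw [Finset.not_nonempty_iff_eq_empty] at hcon
    simp [hcon] at h1
  obtain ⟨j, hj⟩ := this
  exact (mem_activeNodes.1 hj).2.trans (supp_subset_patch hj)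

/-- The time projections of the supports are intervals that share the point `K.a`. -/
theorem ordConnected_patchT (hne : ∀ K ∈ M.cells, (interior K.toSet).Nonempty)
    (K : Cell d) : (D.patchT K).OrdConnected := by
  rw [← isPreconnected_iff_ordConnected, patchT, suppUnion, image_iUnion₂, ← sUnion_image]
  refine isPreconnected_sUnion K.a _ ?_ ?_
  · rintro _ ⟨j, hj, rfl⟩
    exact ⟨(K.a, K.simplex.points 0), hj.2 ⟨left_mem_Icc.2 K.lt.le, K.simplex_mem_spaceSet 0⟩, rfl⟩
  · rintro _ ⟨j, hj, rfl⟩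
    exact (ordConnected_fst_image_supp hne hj.1).isPreconnected

/-- As `φ_j(j) = 1`, the support of `φ_j` contains every cell through `j`. In particular `K(j)` lies
in the patch. -/
theorem loc_subset_patch (hne : ∀ K ∈ M.cells, (interior K.toSet).Nonempty) {K K' : Cell d}
    (hK' : K' ∈ M.cells) {j : ℝ × Space d} (hj : j ∈ D.activeNodes K) (hjK : j ∈ K'.toSet) :
    K'.toSet ⊆ D.patch K :=
  (subset_supp_of_mem hne hK' (mem_activeNodes.1 hj).1 hjK).trans (supp_subset_patch hj)

/-- The number of nodes in a cell is at most the dimension of the polynomial space. -/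
theorem card_nodes_le {K : Cell d} (hK : K ∈ M.cells) {s : Finset (ℝ × Space d)}
    (hs : s ⊆ D.nodes) (hsK : ∀ j ∈ s, j ∈ K.toSet) :
    s.card ≤ Module.finrank ℝ (tensorPoly d k ℓ) := by
  choose! p hp hpK using fun j hj => D.basis_mem j hj K hK
  have hli : LinearIndependent ℝ fun j : s => (⟨p j.1, hp _ (hs j.2)⟩ : tensorPoly d k ℓ) := by
    rw [Fintype.linearIndependent_iff]
    intro c hc i
    have h1 := congrFun (congrArg Subtype.val hc) i.1
    rw [Submodule.coe_sum, Finset.sum_apply, Finset.sum_eq_single i] at h1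
    · have h2 : p i.1 i.1 = 1 := by
        rw [← hpK _ (hs i.2) (hsK _ i.2), D.basis_self _ (hs i.2)]
      simpa [h2] using h1
    · intro j _ hji
      have h2 : p j.1 i.1 = 0 := by
        rw [← hpK _ (hs j.2) (hsK _ i.2), D.basis_ne _ (hs i.2) _ (hs j.2)
          fun h => hji (Subtype.ext h.symm)]
      simp [h2]
    · simp
  simpa using hli.fintype_card_le_finrank

end Dofs

end Mesh

/-! ### Boundary facets -/

/-- A point of the simplex that is not interior has a vanishing barycentric coordinate. -/
theorem Cell.exists_mem_facet {d : ℕ} (K : Cell d) {x : Space d} (hx : x ∈ K.spaceSet)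
    (hx' : x ∉ interior K.spaceSet) : ∃ i, x ∈ K.facet i := by
  classical
  have htop : affineSpan ℝ (range K.simplex.points) = ⊤ := by
    rw [K.simplex.independent.affineSpan_eq_top_iff_card_eq_finrank_add_one]
    simp
  let b : AffineBasis (Fin (d + 1)) ℝ (Space d) := ⟨K.simplex.points, K.simplex.independent, htop⟩
  have hb : K.spaceSet = convexHull ℝ (range b) := rfl
  rw [hb] at hx hx'
  rw [b.interior_convexHull] at hx'
  rw [b.convexHull_eq_nonneg_coord] at hx
  simp only [mem_ofPred_eq, not_forall, not_lt] at hx hx'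
  obtain ⟨i, hi⟩ := hx'
  have hi0 : b.coord i x = 0 := le_antisymm hi (hx i)
  refine ⟨i, ?_⟩
  have h1 : ∑ m ∈ Finset.univ.erase i, b.coord m x = 1 := by
    rw [← b.sum_coord_apply_eq_one x, ← Finset.add_sum_erase _ _ (Finset.mem_univ i), hi0, zero_add]
  have h2 : ∑ m ∈ Finset.univ.erase i, b.coord m x • b m = x := by
    conv_rhs => rw [← b.linear_combination_coord_eq_self x]
    rw [← Finset.add_sum_erase _ _ (Finset.mem_univ i), hi0, zero_smul, zero_add]
  rw [← h2]
  exact (convex_convexHull ℝ _).sum_mem (fun m _ => hx m) h1 fun m hm =>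
    subset_convexHull _ _ (mem_image_of_mem _ (Finset.ne_of_mem_erase hm))

/-- The orthogonal projection along `e` does not increase Hausdorff measure, and it maps the
boundary near `p` onto a set containing a ball of the hyperplane `e^⊥`, which has dimension `d - 1`.
-/
theorem IsLipschitzDomain.hausdorffMeasure_frontier_inter_ball_ne_zero {d : ℕ} (hd : 1 ≤ d)
    {Ω : Set (Space d)} (hΩ : IsLipschitzDomain Ω) {p : Space d} (hp : p ∈ frontier Ω) {δ : ℝ}
    (hδ : 0 < δ) :
    Measure.hausdorffMeasure ((d : ℝ) - 1) (frontier Ω ∩ Metric.ball p δ) ≠ 0 := by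
  obtain ⟨e, γ, L, r, he, hγ, hγe, hr, hgr⟩ := hΩ.graph p hp
  obtain ⟨hpc, hpΩ⟩ := hΩ.mem_frontier_iff.1 hp
  have he0 : e ≠ 0 := by rintro rfl; simp at he
  set V : Submodule ℝ (Space d) := (Submodule.span ℝ {e})ᗮ with hV
  have hfin : (Module.finrank ℝ V : ℝ) = (d : ℝ) - 1 := by
    have h1 := Submodule.finrank_add_finrank_orthogonal (Submodule.span ℝ {e})
    rw [finrank_span_singleton he0, finrank_euclideanSpace, Fintype.card_fin] at h1
    have h2 : (1 : ℝ) + Module.finrank ℝ V = d := by exact_mod_cast h1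
    linarith
  have hd1 : (0 : ℝ) ≤ (d : ℝ) - 1 := by
    rw [sub_nonneg]
    exact_mod_cast hd
  set P := V.orthogonalProjectionOnto with hP
  have hPp : ((P p : V) : Space d) = p - inner ℝ p e • e := by
    have h1 := Submodule.starProjection_orthogonal_val (K := Submodule.span ℝ {e}) p
    rw [Submodule.starProjection_unit_singleton ℝ he, Submodule.starProjection_apply] at h1
    rw [h1, real_inner_comm]
  -- A point of the hyperplane within `ε` of the projection of `p` lifts to the graph at distance
  -- less than `(1 + L) ε = min δ r` from `p`.
  set ε := min δ r / (L + 1) with hε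
  have hL : (0 : ℝ) < L + 1 := by positivity
  have hmin : 0 < min δ r := lt_min hδ hr
  have hε0 : 0 < ε := by positivity
  have hip : γ p = inner ℝ p e := by
    refine le_antisymm ?_ (inner_le_of_mem_closure hγ.continuous hgr (Metric.mem_ball_self hr) hpc)
    by_contra! hlt
    exact hpΩ ((hgr p (Metric.mem_ball_self hr)).2 hlt)
  have hsub : Metric.ball (P p) ε ⊆ P '' (frontier Ω ∩ Metric.ball p δ) := by
    intro y hy
    have hye : inner ℝ (y : Space d) e = 0 := by
      rw [real_inner_comm]
      exact Submodule.mem_orthogonal_singleton_iff_inner_right.1 y.2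
    set x : Space d := y + γ y • e with hx
    have hγx : γ x = γ y := hγe _ _
    have hxe : inner ℝ x e = γ x := by
      rw [hγx, hx, inner_add_left, hye, inner_smul_left, real_inner_self_eq_norm_sq, he]
      simp
    have hγp : γ (P p : V) = γ p := by
      rw [hPp, sub_eq_add_neg, ← neg_smul, hγe]
    have hdist : dist x p < min δ r := by
      have e1 : x - p = ((y - P p : V) : Space d) + (γ y - γ p) • e := by
        rw [hx, Submodule.coe_sub, hPp, hip]
        module
      have h1 : ‖((y - P p : V) : Space d)‖ < ε := by
        rw [Submodule.norm_coe, ← dist_eq_norm]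
        exact hy
      have h2 : |γ y - γ p| ≤ L * ε := by
        rw [← hγp, ← Real.dist_eq]
        refine (hγ.dist_le_mul _ _).trans (mul_le_mul_of_nonneg_left ?_ L.2)
        rw [dist_eq_norm, ← Submodule.coe_sub]
        exact h1.le
      rw [dist_eq_norm, e1]
      refine (norm_add_le _ _).trans_lt ?_
      rw [norm_smul, he, mul_one, Real.norm_eq_abs]
      have h3 : ε * (L + 1) = min δ r := by rw [hε]; field_simp
      linarith
    have hxr : x ∈ Metric.ball p r := hdist.trans_le (min_le_right _ _)
    have hxΩ : x ∉ Ω := fun h => by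
      have := (hgr x hxr).1 h
      rw [hxe] at this
      exact lt_irrefl _ this
    have hxc : x ∈ closure Ω := by
      have ht : Tendsto (fun c : ℝ => x + (-c) • e) (𝓝[>] 0) (𝓝 x) := by
        have h1 : Continuous fun c : ℝ => x + (-c) • e := by fun_prop
        have h2 := (h1.tendsto 0).mono_left (nhdsWithin_le_nhds (s := Ioi 0))
        simpa using h2
      refine mem_closure_of_tendsto ht ?_
      filter_upwards [ht (Metric.isOpen_ball.mem_nhds hxr), self_mem_nhdsWithin] with c hc hc0
      refine (hgr _ hc).2 ?_
      rw [hγe, inner_add_left, hxe, inner_smul_left, real_inner_self_eq_norm_sq, he]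
      simp only [mem_Ioi] at hc0
      simpa using hc0
    refine ⟨x, ⟨hΩ.mem_frontier_iff.2 ⟨hxc, hxΩ⟩, hdist.trans_le (min_le_left _ _)⟩, ?_⟩
    rw [hx, map_add, map_smul]
    have h1 : P (y : Space d) = y := Submodule.orthogonalProjectionOnto_mem_subspace_eq_self y
    have h2 : P e = 0 :=
      Submodule.orthogonalProjectionOnto_orthogonalComplement_singleton_eq_zero e
    rw [h1, h2, smul_zero, add_zero]
  intro h0
  have hlip : LipschitzWith 1 P := Submodule.lipschitzWith_orthogonalProjectionOnto V
  have h1 := hlip.hausdorffMeasure_image_le hd1 (frontier Ω ∩ Metric.ball p δ)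
  rw [h0, mul_zero, ← hfin] at h1
  have h2 := (measure_mono hsub).trans h1
  exact (Metric.measure_ball_pos (Measure.hausdorffMeasure (Module.finrank ℝ V : ℝ)) (P p)
    hε0).not_ge h2

namespace Mesh

namespace Dofs

variable {d : ℕ} {T : ℝ} {Ω : Set (Space d)} {M : Mesh d T Ω} {k ℓ : ℕ} {D : M.Dofs k ℓ}

/-- A patch with a node on the lateral boundary contains a cell with a facet on the boundary. -/
theorem exists_boundary_cell (hd : 1 ≤ d) {κ : ℝ} (hD : D.IsRegular κ) (hΩ : IsLipschitzDomain Ω)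
    (hne : ∀ K ∈ M.cells, (interior K.toSet).Nonempty) {K : Cell d} {j : ℝ × Space d}
    (hj : j ∈ D.activeNodes K) (hjf : j.2 ∈ frontier Ω) :
    ∃ K' ∈ M.cells, K'.toSet ⊆ D.patch K ∧ ∃ i, K'.facet i ⊆ frontier Ω := by
  classical
  have hjn := (mem_activeNodes.1 hj).1
  by_contra! hcon
  set s := M.cells.filter fun K' => j ∉ K'.toSet with hs
  have hcl : IsClosed (⋃ K' ∈ s, K'.toSet) :=
    s.finite_toSet.isClosed_biUnion fun K _ => K.isCompact_toSet.isClosed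
  have hjs : j ∈ (⋃ K' ∈ s, K'.toSet)ᶜ := by
    simp [hs]
  obtain ⟨δ, hδ, hball⟩ := Metric.isOpen_iff.1 hcl.isOpen_compl j hjs
  refine hΩ.hausdorffMeasure_frontier_inter_ball_ne_zero hd hjf hδ ?_
  set s' := M.cells.filter fun K' => j ∈ K'.toSet with hs'
  -- Near `j` only cells containing `j` occur, and these lie in the patch. Cell interiors project
  -- into `Ω`, so boundary points lie on facets. If no such facet were contained in `∂Ω`, this part
  -- of the boundary would be a null set.
  have hsub : frontier Ω ∩ Metric.ball j.2 δ ⊆ ⋃ K' ∈ s', ⋃ i, (K'.facet i ∩ frontier Ω) := by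
    rintro x ⟨hxf, hxb⟩
    have hz : (j.1, x) ∈ Icc 0 T ×ˢ closure Ω :=
      ⟨(D.nodes_subset j hjn).1, frontier_subset_closure hxf⟩
    have hzb : (j.1, x) ∈ Metric.ball j δ := by
      rw [Metric.mem_ball, Prod.dist_eq]
      exact max_lt (by simpa using hδ) hxb
    have hz' := hz
    rw [← M.cover] at hz'
    simp only [mem_iUnion, exists_prop] at hz' ⊢
    obtain ⟨K', hK', hzK'⟩ := hz'
    have hjK' : j ∈ K'.toSet := by
      by_contra hj'
      exact hball hzb (mem_biUnion (show K' ∈ s from Finset.mem_filter.2 ⟨hK', hj'⟩) hzK')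
    obtain ⟨i, hi⟩ := K'.exists_mem_facet hzK'.2 fun h =>
      (hΩ.mem_frontier_iff.1 hxf).2 (K'.interior_spaceSet_subset hΩ (M.spaceSet_subset hK') h)
    exact ⟨K', Finset.mem_filter.2 ⟨hK', hjK'⟩, i, hi, hxf⟩
  refine measure_mono_null hsub ?_
  refine (measure_biUnion_null_iff s'.countable_toSet).2 fun K' hK' => measure_iUnion_null fun i => ?_
  obtain ⟨hK'c, hjK'⟩ := Finset.mem_filter.1 hK'
  exact (hD.boundary K' hK'c i).resolve_left
    (hcon K' hK'c (loc_subset_patch hne hK'c hj hjK') i)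

end Dofs

end Mesh

/-! ### Volumes and cardinalities -/

/-- The volume of the unit ball of `ℝᵈ`. -/
def ballVol (d : ℕ) : ℝ := (volume (Metric.ball (0 : Space d) 1)).toReal

theorem ballVol_pos (d : ℕ) : 0 < ballVol d :=
  ENNReal.toReal_pos (Metric.measure_ball_pos volume _ one_pos).ne' measure_ball_lt_top.ne

theorem volume_ball_eq {d : ℕ} (x : Space d) {r : ℝ} (hr : 0 < r) :
    volume (Metric.ball x r) = ENNReal.ofReal (r ^ d * ballVol d) := by
  rw [Measure.addHaar_ball_of_pos volume x hr, ENNReal.ofReal_mul (by positivity), ballVol,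
    ENNReal.ofReal_toReal measure_ball_lt_top.ne]
  simp

theorem ofReal_le_volume_of_subset {d : ℕ} {a b ρ v : ℝ} {x : Space d} {A : Set (ℝ × Space d)}
    (hab : a ≤ b) (hρ : 0 < ρ) (hA : Ioo a b ×ˢ Metric.ball x ρ ⊆ A)
    (hv : v ≤ (b - a) * (ρ ^ d * ballVol d)) : ENNReal.ofReal v ≤ volume A := by
  refine le_trans ?_ (measure_mono hA)
  rw [Measure.volume_eq_prod, Measure.prod_prod, Real.volume_Ioo, volume_ball_eq x hρ,
    ← ENNReal.ofReal_mul (sub_nonneg.2 hab)]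
  exact ENNReal.ofReal_le_ofReal hv

theorem card_mul_le_measure {ι α : Type*} [MeasurableSpace α] {μ : Measure α} {s : Finset ι}
    {A : ι → Set α} {P : Set α} {m : ℝ≥0∞} (hd : (s : Set ι).PairwiseDisjoint A)
    (hA : ∀ i ∈ s, MeasurableSet (A i)) (hP : ∀ i ∈ s, A i ⊆ P) (hm : ∀ i ∈ s, m ≤ μ (A i)) :
    s.card * m ≤ μ P := by
  calc (s.card : ℝ≥0∞) * m = ∑ i ∈ s, m := by rw [Finset.sum_const, nsmul_eq_mul]
    _ ≤ ∑ i ∈ s, μ (A i) := Finset.sum_le_sum hm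
    _ = μ (⋃ i ∈ s, A i) := (measure_biUnion_finset hd hA).symm
    _ ≤ μ P := measure_mono (iUnion₂_subset hP)

/-- A separated set of points whose surrounding balls lie in a set of finite volume is finite. -/
theorem card_le_of_separated {d : ℕ} {P : Set (Space d)} {ε V : ℝ} (hε : 0 < ε)
    (hV : volume P ≤ ENNReal.ofReal (V * ε ^ d)) (hV0 : 0 ≤ V) {s : Finset (Space d)}
    (hs : ∀ x ∈ s, Metric.ball x (ε / 2) ⊆ P)
    (hsep : ∀ x ∈ s, ∀ y ∈ s, x ≠ y → ε ≤ dist x y) :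
    s.card ≤ ⌊2 ^ d * V / ballVol d⌋₊ := by
  have h1 := card_mul_le_measure (μ := volume) (s := s) (A := fun x => Metric.ball x (ε / 2))
    (P := P) (m := ENNReal.ofReal ((ε / 2) ^ d * ballVol d))
    (fun x hx y hy hxy => Metric.ball_disjoint_ball (by
      have := hsep x hx y hy hxy
      linarith))
    (fun x _ => measurableSet_ball) hs fun x _ => (volume_ball_eq x (by positivity)).ge
  have h2 := h1.trans hV
  have hb := ballVol_pos d
  rw [← ENNReal.ofReal_natCast, ← ENNReal.ofReal_mul (by positivity),
    ENNReal.ofReal_le_ofReal_iff (by positivity)] at h2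
  rw [Nat.le_floor_iff (by positivity), le_div_iff₀ hb]
  rw [div_pow] at h2
  have hεd : 0 < ε ^ d := by positivity
  have h3 : (s.card : ℝ) * (ε ^ d / 2 ^ d * ballVol d) = (s.card * ballVol d) * ε ^ d / 2 ^ d := by
    ring
  rw [h3, div_le_iff₀ (by positivity)] at h2
  refine le_of_mul_le_mul_right ?_ hεd
  linarith

theorem Cell.ShapeRegular.ofReal_le_volume {d : ℕ} (hd : 1 ≤ d) {κ : ℝ} (hκ : 1 ≤ κ) {K : Cell d}
    (hK : K.ShapeRegular κ) {v : ℝ} (hv : v ≤ K.ht * ((K.hx / κ) ^ d * ballVol d)) :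
    ENNReal.ofReal v ≤ volume (interior K.toSet) := by
  obtain ⟨c, hc⟩ := hK
  rw [K.interior_toSet]
  exact ofReal_le_volume_of_subset (x := c) K.lt.le
    (div_pos (K.hx_pos hd) (zero_lt_one.trans_le hκ))
    (Set.prod_mono_right (interior_maximal (Metric.ball_subset_closedBall.trans hc)
      Metric.isOpen_ball)) hv

namespace Mesh

namespace Dofs

variable {d : ℕ} {T : ℝ} {Ω : Set (Space d)} {M : Mesh d T Ω} {k ℓ : ℕ} {D : M.Dofs k ℓ} {κ : ℝ}

theorem IsRegular.interior_nonempty (hd : 1 ≤ d) (hκ : 1 ≤ κ) (hD : D.IsRegular κ) :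
    ∀ K ∈ M.cells, (interior K.toSet).Nonempty := fun K hK =>
  Cell.ShapeRegular.interior_toSet_nonempty hd hκ (hD.shape K hK)

theorem abs_sub_le_of_mem_patchT (hκ : 1 ≤ κ) (hD : D.IsRegular κ)
    (hne : ∀ K ∈ M.cells, (interior K.toSet).Nonempty) {K : Cell d}
    (hK : K ∈ M.cells) {s t : ℝ} (hs : s ∈ D.patchT K) (ht : t ∈ D.patchT K) :
    |t - s| ≤ κ * K.ht := by
  wlog hst : s ≤ t generalizing s t
  · rw [abs_sub_comm]
    exact this ht hs (le_of_not_ge hst)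
  rw [abs_of_nonneg (sub_nonneg.2 hst)]
  have h1 := (measure_mono ((ordConnected_patchT hne K).out hs ht)).trans (hD.patchT_le K hK)
  rw [Real.volume_Icc, ENNReal.ofReal_le_ofReal_iff] at h1
  · exact h1
  · have := K.ht_pos
    positivity

theorem volume_patch_le (hκ : 1 ≤ κ) (hD : D.IsRegular κ) {K : Cell d} (hK : K ∈ M.cells) :
    volume (D.patch K) ≤ ENNReal.ofReal (κ ^ (d + 1) * (K.ht * K.hx ^ d)) := by
  have := K.ht_pos
  rw [patch, Measure.volume_eq_prod, Measure.prod_prod]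
  refine (mul_le_mul' (hD.patchT_le K hK) (hD.patchX_le K hK)).trans ?_
  rw [← ENNReal.ofReal_mul (by positivity)]
  exact ENNReal.ofReal_le_ofReal (le_of_eq (by ring))

open Classical in
-- The interiors of the cells are disjoint, and by shape regularity and grading each occupies a
-- fixed fraction of the volume of the patch.
theorem card_cells_le (hd : 1 ≤ d) (hκ : 1 ≤ κ) (hD : D.IsRegular κ) {K : Cell d}
    (hK : K ∈ M.cells) :
    (M.cells.filter fun K' => K'.toSet ⊆ D.patch K).card ≤
      ⌊κ ^ (d + 1) * (κ * (κ ^ 2) ^ d) / ballVol d⌋₊ := by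
  have hht := K.ht_pos
  have hhx := K.hx_pos hd
  have hb := ballVol_pos d
  have hκ0 : 0 < κ := by linarith
  have h1 := card_mul_le_measure (μ := volume) (s := M.cells.filter fun K' => K'.toSet ⊆ D.patch K)
    (A := fun K' => interior K'.toSet) (P := D.patch K)
    (m := ENNReal.ofReal ((K.ht / κ) * ((K.hx / κ ^ 2) ^ d * ballVol d)))
    (fun K₁ h₁ K₂ h₂ h => M.disjoint K₁ (Finset.mem_filter.1 h₁).1 K₂ (Finset.mem_filter.1 h₂).1 h)
    (fun K' _ => isOpen_interior.measurableSet)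
    (fun K' h => interior_subset.trans (Finset.mem_filter.1 h).2) fun K' h => by
      obtain ⟨hK', hKs⟩ := Finset.mem_filter.1 h
      refine Cell.ShapeRegular.ofReal_le_volume hd hκ (hD.shape K' hK') ?_
      have h1 := (hD.grading_t K hK K' hK' hKs).2
      have h2 := (hD.grading_x K hK K' hK' hKs).2
      have := K'.hx_pos hd
      have := K'.ht_pos
      have h3 : K.hx / κ ^ 2 ≤ K'.hx / κ := by
        rw [div_le_div_iff₀ (by positivity) hκ0]
        nlinarith
      have h4 : K.ht / κ ≤ K'.ht := by
        rw [div_le_iff₀ hκ0]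
        linarith
      gcongr
  have h2 := h1.trans (volume_patch_le hκ hD hK)
  rw [← ENNReal.ofReal_natCast, ← ENNReal.ofReal_mul (by positivity),
    ENNReal.ofReal_le_ofReal_iff (by positivity)] at h2
  rw [Nat.le_floor_iff (by positivity), le_div_iff₀ hb]
  have h3 : 0 < K.ht * K.hx ^ d := by positivity
  refine le_of_mul_le_mul_right ?_ h3
  refine le_trans (le_of_eq ?_) (mul_le_mul_of_nonneg_right h2
    (show 0 ≤ κ * (κ ^ 2) ^ d by positivity)) |>.trans (le_of_eq (by ring))
  rw [div_pow]
  field_simp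

/-- Sort the nodes by the cell `K(j)`. These cells lie in the patch, so their number is bounded, and
each contains at most as many nodes as the dimension of the polynomial space. -/
theorem exists_card_activeNodes_le (d k ℓ : ℕ) (hd : 1 ≤ d) (hκ : 1 ≤ κ) :
    ∃ n : ℕ, ∀ {T : ℝ} {Ω : Set (Space d)} {M : Mesh d T Ω} {D : M.Dofs k ℓ}, D.IsRegular κ →
      ∀ loc : ℝ × Space d → Cell d, (∀ j ∈ D.nodes, loc j ∈ M.cells ∧ j ∈ (loc j).toSet) →
      ∀ K ∈ M.cells, (D.activeNodes K).card ≤ n := by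
  classical
  refine ⟨Module.finrank ℝ (tensorPoly d k ℓ) *
    ⌊κ ^ (d + 1) * (κ * (κ ^ 2) ^ d) / ballVol d⌋₊, fun {T Ω M D} hD loc hloc K hK => ?_⟩
  refine (Finset.card_le_mul_card_image_of_maps_to (f := loc)
    (t := M.cells.filter fun K' => K'.toSet ⊆ D.patch K) (fun j hj => ?_) _ fun K' hK' => ?_).trans
    (Nat.mul_le_mul_left _ (card_cells_le hd hκ hD hK))
  · have h := hloc j (mem_activeNodes.1 hj).1
    exact Finset.mem_filter.2 ⟨h.1, loc_subset_patch (hD.interior_nonempty hd hκ) h.1 hj h.2⟩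
  · refine card_nodes_le (D := D) (Finset.mem_filter.1 hK').1
      (fun j hj => (mem_activeNodes.1 (Finset.mem_filter.1 hj).1).1) fun j hj => ?_
    obtain ⟨h1, rfl⟩ := Finset.mem_filter.1 hj
    exact (hloc j (mem_activeNodes.1 h1).1).2

end Dofs

end Mesh

theorem Cell.cond_interior_toSet {d : ℕ} (K : Cell d) :
    ProbabilityTheory.cond (volume : Measure (ℝ × Space d)) (interior K.toSet) =
      ProbabilityTheory.cond volume K.toSet := by
  have h := K.restrict_interior_toSet
  have h1 : volume (interior K.toSet) = volume K.toSet := by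
    simpa using congrArg (fun μ : Measure (ℝ × Space d) => μ univ) h
  rw [ProbabilityTheory.cond, ProbabilityTheory.cond, h, h1]

/-- Homothety with centre `x` and ratio `θ`. It is used to move the inscribed ball of a simplex
close to a given point of the simplex. -/
theorem ball_subset_of_closedBall_subset {d : ℕ} {S : Set (Space d)} {c : Space d} {ρ θ : ℝ}
    (x : Space d) (hc : Metric.closedBall c ρ ⊆ S) (hθ : 0 < θ) :
    Metric.ball (x + θ • (c - x)) (θ * ρ) ⊆ {z | ∃ p ∈ S, z = x + θ • (p - x)} := by
  intro z hz
  refine ⟨x + θ⁻¹ • (z - x), hc ?_, ?_⟩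
  · rw [Metric.mem_ball, dist_eq_norm] at hz
    rw [Metric.mem_closedBall, dist_eq_norm]
    have h1 : x + θ⁻¹ • (z - x) - c = θ⁻¹ • (z - (x + θ • (c - x))) := by
      rw [smul_sub, smul_sub, smul_add, smul_smul, inv_mul_cancel₀ hθ.ne']
      module
    rw [h1, norm_smul, Real.norm_of_nonneg (inv_nonneg.2 hθ.le), inv_mul_le_iff₀ hθ]
    exact hz.le
  · rw [add_sub_cancel_left, smul_smul, mul_inv_cancel₀ hθ.ne', one_smul]
    abel

/-! ### The Poincaré inequality on patches. -/

namespace Mesh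

namespace Dofs

variable {κ : ℝ}

/-- A Poincaré-type inequality on patches: the mean square difference between two cells of a patch
is bounded by the anisotropic seminorm. -/
theorem exists_msd_cells_le (d : ℕ) (hd : 1 ≤ d) (hκ : 1 ≤ κ) :
    ∃ C : ℝ≥0, ∀ {T : ℝ} {Ω : Set (Space d)} {M : Mesh d T Ω} {k ℓ : ℕ} {D : M.Dofs k ℓ},
      D.IsRegular κ → ∀ K ∈ M.cells, ∀ {w f : ℝ × Space d → ℝ} {g : ℝ × Space d → Space d},
      IsWeakTriple (interior (D.patch K)) w f g → ∀ K₁ ∈ M.cells, ∀ K₂ ∈ M.cells,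
      K₁.toSet ⊆ D.patch K → K₂.toSet ⊆ D.patch K →
      msd w (ProbabilityTheory.cond volume K₁.toSet) (ProbabilityTheory.cond volume K₂.toSet) ≤
        C * (energy (interior (D.patch K)) K.ht K.hx f g / ENNReal.ofReal (K.ht * K.hx ^ d)) := by
  have hκ0 : 0 < κ := by linarith
  have hb := ballVol_pos d
  -- The smallest sets compared below have time length at least `h_t / κ` and contain a spatial ball
  -- of radius `h_x / (4 κ⁴)`, which determines `α`. The number `N` bounds the sets in `Γ` separated
  -- by `h_x / (2κ)`, since the surrounding balls lie in a patch of volume at most `(κ h_x)^d`.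
  obtain ⟨C, hC⟩ := exists_msd_cond_le d (Λ := 2 * κ)
    (α := κ⁻¹ * ((1 / (4 * κ ^ 4)) ^ d * ballVol d)) (by positivity) (by positivity)
  set N := ⌊2 ^ d * (2 * κ ^ 2) ^ d / ballVol d⌋₊ with hN
  refine ⟨24 * C + 4 * (4 ^ (2 * N + 2) * C), fun {T Ω M k ℓ D} hD K hK {w f g} hw => ?_⟩
  have hne := hD.interior_nonempty hd hκ
  have hht := K.ht_pos
  have hhx := K.hx_pos hd
  set O := interior (D.patch K) with hO
  set q : ℝ≥0∞ := C * (energy O K.ht K.hx f g / ENNReal.ofReal (K.ht * K.hx ^ d)) with hq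
  obtain ⟨Γ, hΓ, hΓb, hΓK⟩ := hD.joined K hK
  have hpf : volume (D.patch K) ≠ ⊤ :=
    ((volume_patch_le hκ hD hK).trans_lt ENNReal.ofReal_lt_top).ne
  set I := interior (D.patchT K) with hI
  have hIconv : Convex ℝ I := (ordConnected_patchT hne K).convex.interior
  have hIopen : IsOpen I := isOpen_interior
  have hcI : ∀ K' : Cell d, K'.toSet ⊆ D.patch K → Ioo K'.a K'.b ⊆ I := fun K' hK' =>
    interior_maximal (fun t ht => (hK' (show (t, K'.simplex.points 0) ∈ K'.toSet from
      ⟨Ioo_subset_Icc_self ht, K'.simplex_mem_spaceSet 0⟩)).1) isOpen_Ioo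
  have hKp := toSet_subset_patch (D := D) hne hK
  set v := κ⁻¹ * ((1 / (4 * κ ^ 4)) ^ d * ballVol d) * (K.ht * K.hx ^ d) with hv
  have hvpos : 0 < v := by positivity
  have step : ∀ {U A B : Set (ℝ × Space d)}, IsOpen U → Convex ℝ U → U ⊆ D.patch K → A ⊆ U →
      B ⊆ U → MeasurableSet A → MeasurableSet B →
      (∀ x ∈ A, ∀ y ∈ B, ‖y.2 - x.2‖ ≤ 2 * κ * K.hx) → ENNReal.ofReal v ≤ volume A →
      ENNReal.ofReal v ≤ volume B →
      msd w (ProbabilityTheory.cond volume A) (ProbabilityTheory.cond volume B) ≤ q := by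
    intro U A B hU hUc hUp hAU hBU hA hB hAB hvA hvB
    refine hC hw hU hUc (interior_maximal hUp hU) (measure_ne_top_of_subset hUp hpf) hht hhx hAU hBU
      hA hB (fun x hx y hy => ?_) hAB hvA hvB
    have := abs_sub_le_of_mem_patchT hκ hD hne hK (hUp (hAU hx)).1 (hUp (hBU hy)).1
    nlinarith
  have hprob : ∀ {A : Set (ℝ × Space d)}, A ⊆ D.patch K → ENNReal.ofReal v ≤ volume A →
      IsProbabilityMeasure (ProbabilityTheory.cond (volume : Measure (ℝ × Space d)) A) :=
    fun hA hvA => ProbabilityTheory.cond_isProbabilityMeasure_of_finite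
      ((ENNReal.ofReal_pos.2 hvpos).trans_le hvA).ne' (measure_ne_top_of_subset hA hpf)
  have hvol : ∀ {a b ρ : ℝ} {x : Space d} {A : Set (ℝ × Space d)}, Ioo a b ×ˢ Metric.ball x ρ ⊆ A →
      a ≤ b → K.ht ≤ κ * (b - a) → K.hx / (4 * κ ^ 4) ≤ ρ → ENNReal.ofReal v ≤ volume A := by
    intro a b ρ x A hA hab hab' hρ
    have hρ0 : 0 < K.hx / (4 * κ ^ 4) := by positivity
    refine ofReal_le_volume_of_subset hab (hρ0.trans_le hρ) hA ?_
    have h1 : v = (K.ht / κ) * ((K.hx / (4 * κ ^ 4)) ^ d * ballVol d) := by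
      rw [hv, div_pow, div_pow, one_pow]
      field_simp
    rw [h1]
    have h2 : K.ht / κ ≤ b - a := by rw [div_le_iff₀ hκ0]; linarith
    have h3 : 0 ≤ b - a := sub_nonneg.2 hab
    gcongr
  set r := K.hx / κ with hr
  have hr0 : 0 < r := by positivity
  have hrx : r ≤ K.hx := div_le_self hhx.le hκ
  have hκ3 : 1 ≤ κ ^ 3 := one_le_pow₀ hκ
  have hr2 : K.hx / (4 * κ ^ 4) ≤ r / 2 := by
    rw [hr, div_div, div_le_div_iff₀ (by positivity) (by positivity)]
    have : κ * 2 ≤ 4 * κ ^ 4 := by nlinarith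
    gcongr
  -- the cylinders around the points of the connecting set
  set Z : Space d → Set (ℝ × Space d) := fun x => I ×ˢ Metric.ball x (r / 2) with hZ
  set Y : Space d → Set (ℝ × Space d) := fun x => I ×ˢ Metric.ball x r with hY
  have hYp : ∀ x ∈ Γ, Y x ⊆ D.patch K := fun x hx =>
    Set.prod_mono interior_subset (Metric.ball_subset_closedBall.trans (hΓb x hx))
  have hYo : ∀ x, IsOpen (Y x) := fun x => hIopen.prod Metric.isOpen_ball
  have hYc : ∀ x, Convex ℝ (Y x) := fun x => hIconv.prod (convex_ball _ _)
  have hZY : ∀ x, Z x ⊆ Y x := fun x =>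
    Set.prod_mono_right (Metric.ball_subset_ball (by linarith))
  have hZm : ∀ x, MeasurableSet (Z x) := fun x =>
    hIopen.measurableSet.prod measurableSet_ball
  have hZv : ∀ x, ENNReal.ofReal v ≤ volume (Z x) := fun x =>
    hvol (a := K.a) (b := K.b) (x := x) (ρ := r / 2) (Set.prod_mono_left (hcI K hKp)) K.lt.le
      (by change K.ht ≤ κ * K.ht; nlinarith) hr2
  have hZp : ∀ x ∈ Γ, IsProbabilityMeasure
      (ProbabilityTheory.cond (volume : Measure (ℝ × Space d)) (Z x)) :=
    fun x hx => hprob ((hZY x).trans (hYp x hx)) (hZv x)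
  have hchain : ∀ x ∈ Γ, ∀ y ∈ Γ, msd w (ProbabilityTheory.cond volume (Z x))
      (ProbabilityTheory.cond volume (Z y)) ≤ 4 ^ (2 * N + 2) * q := by
    intro x hx
    refine chain_le (Γ := Γ) (ε := r / 2) (N := N) (q := q)
      (e := fun x y => msd w (ProbabilityTheory.cond volume (Z x))
        (ProbabilityTheory.cond volume (Z y))) hΓ.isPreconnected (by positivity)
      (fun s hs hsep => ?_) (fun x hx y hy hxy => ?_) (fun x hx y hy z hz => ?_) hx
    · refine card_le_of_separated (P := D.patchX K) (ε := r / 2) (by positivity) ?_ (by positivity)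
        (fun y hy => (Metric.ball_subset_closedBall.trans
          (Metric.closedBall_subset_closedBall (by linarith))).trans (hΓb y (hs hy))) hsep
      refine (hD.patchX_le K hK).trans (ENNReal.ofReal_le_ofReal (le_of_eq ?_))
      rw [← mul_pow, hr]
      congr 1
      field_simp
    · refine step (hYo x) (hYc x) (hYp x hx) (hZY x) ?_ (hZm x) (hZm y) (fun z hz z' hz' => ?_)
        (hZv x) (hZv y)
      · refine Set.prod_mono_right fun z hz => ?_
        have h1 := Metric.mem_ball.1 hz
        have := dist_triangle z y x
        rw [dist_comm y x] at this
        exact Metric.mem_ball.2 (by linarith)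
      · have h1 := Metric.mem_ball.1 hz.2
        have h2 := Metric.mem_ball.1 hz'.2
        have h3 := dist_triangle4 z'.2 y x z.2
        rw [dist_comm y x, dist_comm x z.2] at h3
        rw [← dist_eq_norm]
        nlinarith
    · have := hZp x hx
      have := hZp y hy
      have := hZp z hz
      exact msd_triangle hw.measurable
  have hKv : ∀ K' ∈ M.cells, K'.toSet ⊆ D.patch K → ENNReal.ofReal v ≤ volume (interior K'.toSet) := by
    intro K' hK' hK'p
    obtain ⟨c, hc⟩ := hD.shape K' hK'
    rw [K'.interior_toSet]
    have h2 := (hD.grading_x K hK K' hK' hK'p).2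
    refine hvol (x := c) (ρ := K'.hx / κ) (Set.prod_mono_right (interior_maximal
      (Metric.ball_subset_closedBall.trans hc) Metric.isOpen_ball)) K'.lt.le
      (hD.grading_t K hK K' hK' hK'p).2 ?_
    rw [div_le_div_iff₀ (by positivity) hκ0]
    have := K'.hx_pos hd
    nlinarith [mul_nonneg this.le (sub_nonneg.2 hκ3), mul_pos hκ0 this, mul_pos hκ0 hκ0]
  have hKp : ∀ K' ∈ M.cells, K'.toSet ⊆ D.patch K → IsProbabilityMeasure
      (ProbabilityTheory.cond (volume : Measure (ℝ × Space d)) K'.toSet) := by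
    intro K' hK' hK'p
    rw [← K'.cond_interior_toSet]
    exact hprob (interior_subset.trans hK'p) (hKv K' hK' hK'p)
  -- from a cell to a cylinder
  have hcell : ∀ K' ∈ M.cells, K'.toSet ⊆ D.patch K → ∃ x ∈ Γ,
      msd w (ProbabilityTheory.cond volume K'.toSet) (ProbabilityTheory.cond volume (Z x)) ≤
        4 * q := by
    intro K' hK' hK'p
    obtain ⟨x, hxΓ, hxK⟩ := hΓK K' hK' hK'p
    refine ⟨x, hxΓ, ?_⟩
    obtain ⟨c, hc⟩ := hD.shape K' hK'
    have hhx' := K'.hx_pos hd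
    obtain ⟨hg1, hg2⟩ := hD.grading_x K hK K' hK' hK'p
    -- As `K'_x` has diameter at most `κ h_x`, shrinking it towards `x` by `θ` leaves it within `r /
    -- 4` of `x`. The image `W` of the inscribed ball, times the interval, thus lies both in the
    -- cell and in `Z x`, and two convex comparisons suffice.
    set θ := 1 / (4 * κ ^ 2) with hθ
    have hκ2 : 1 ≤ κ ^ 2 := one_le_pow₀ hκ
    have hθ0 : 0 < θ := by positivity
    have hθ1 : θ ≤ 1 := by rw [hθ, div_le_one (by positivity)]; linarith
    have hsub := ball_subset_of_closedBall_subset x hc hθ0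
    set c' := x + θ • (c - x) with hc'
    set W := Ioo K'.a K'.b ×ˢ Metric.ball c' (θ * (K'.hx / κ)) with hW
    have hW1 : W ⊆ interior K'.toSet := by
      rw [K'.interior_toSet]
      refine Set.prod_mono_right (interior_maximal (hsub.trans ?_) Metric.isOpen_ball)
      rintro _ ⟨p, hp, rfl⟩
      exact K'.convex_spaceSet.add_smul_sub_mem hxK hp ⟨hθ0.le, hθ1⟩
    have hW2 : W ⊆ Z x := by
      refine Set.prod_mono (hcI K' hK'p) (hsub.trans ?_)
      rintro _ ⟨p, hp, rfl⟩
      rw [Metric.mem_ball, dist_eq_norm, add_sub_cancel_left, norm_smul, Real.norm_of_nonneg hθ0.le,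
        ← dist_eq_norm]
      have h1 := K'.dist_le_hx hp hxK
      have h2 : θ * (κ * K.hx) = r / 4 := by rw [hθ, hr]; field_simp
      have h3 : θ * dist p x ≤ θ * (κ * K.hx) := by gcongr; linarith
      linarith
    have hWm : MeasurableSet W := measurableSet_Ioo.prod measurableSet_ball
    have hWv : ENNReal.ofReal v ≤ volume W := by
      refine hvol (x := c') (ρ := θ * (K'.hx / κ)) subset_rfl K'.lt.le
        (hD.grading_t K hK K' hK' hK'p).2 ?_
      have h1 : θ * (K'.hx / κ) = K'.hx / (4 * κ ^ 3) := by rw [hθ]; field_simp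
      rw [h1, div_le_div_iff₀ (by positivity) (by positivity)]
      calc K.hx * (4 * κ ^ 3) ≤ (κ * K'.hx) * (4 * κ ^ 3) := by gcongr
        _ = K'.hx * (4 * κ ^ 4) := by ring
    have := hKp K' hK' hK'p
    have := hZp x hxΓ
    have := hprob ((hW2.trans (hZY x)).trans (hYp x hxΓ)) hWv
    have h1 : msd w (ProbabilityTheory.cond volume K'.toSet) (ProbabilityTheory.cond volume W) ≤
        q := by
      rw [← K'.cond_interior_toSet]
      refine step isOpen_interior K'.convex_toSet.interior (interior_subset.trans hK'p) subset_rfl hW1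
        isOpen_interior.measurableSet hWm (fun y hy z hz => ?_) (hKv K' hK' hK'p) hWv
      rw [← dist_eq_norm]
      have := K'.dist_le_hx (interior_subset (hW1 hz)).2 (interior_subset hy).2
      nlinarith
    have h2 : msd w (ProbabilityTheory.cond volume W) (ProbabilityTheory.cond volume (Z x)) ≤
        q := by
      refine step (hYo x) (hYc x) (hYp x hxΓ) (hW2.trans (hZY x)) (hZY x) hWm (hZm x)
        (fun y hy z hz => ?_) hWv (hZv x)
      have h1 := Metric.mem_ball.1 (hW2 hy).2
      have h2 := Metric.mem_ball.1 hz.2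
      have h3 := dist_triangle_right z.2 y.2 x
      rw [← dist_eq_norm]
      nlinarith
    calc _ ≤ 2 * q + 2 * q := (msd_triangle hw.measurable).trans (by gcongr)
      _ = 4 * q := by ring
  intro K₁ hK₁ K₂ hK₂ h₁ h₂
  obtain ⟨x, hx, hx1⟩ := hcell K₁ hK₁ h₁
  obtain ⟨y, hy, hy1⟩ := hcell K₂ hK₂ h₂
  have := hKp K₁ hK₁ h₁
  have := hKp K₂ hK₂ h₂
  have := hZp x hx
  have := hZp y hy
  rw [msd_comm hw.measurable] at hy1
  calc msd w (ProbabilityTheory.cond volume K₁.toSet) (ProbabilityTheory.cond volume K₂.toSet)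
      ≤ 2 * (4 * q) + 2 * (2 * (4 ^ (2 * N + 2) * q) + 2 * (4 * q)) :=
        (msd_triangle (ν := ProbabilityTheory.cond volume (Z x)) hw.measurable).trans
          (add_le_add (by gcongr) (mul_le_mul' le_rfl
            ((msd_triangle (ν := ProbabilityTheory.cond volume (Z y)) hw.measurable).trans
              (add_le_add (mul_le_mul' le_rfl (hchain x hx y hy)) (by gcongr)))))
    _ ≤ _ := by
      rw [hq]
      push_cast
      refine le_of_eq ?_
      ring

end Dofs

end Mesh

/-! ### Calculus of weak derivatives -/

/-- `h` is the weak derivative of `w` in the direction `e` on `U`. -/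
def HasWeakDirDeriv {d : ℕ} (U : Set (ℝ × Space d)) (w h : ℝ × Space d → ℝ) (e : ℝ × Space d) :
    Prop :=
  LocallyIntegrableOn w U ∧ LocallyIntegrableOn h U ∧
    ∀ φ, IsTestFun U φ → ∫ z in U, w z * fderiv ℝ φ z e = - ∫ z in U, h z * φ z

theorem hasWeakDt_iff {d : ℕ} {U : Set (ℝ × Space d)} {w h : ℝ × Space d → ℝ} :
    HasWeakDt U w h ↔ HasWeakDirDeriv U w h (1, 0) := Iff.rfl

theorem locallyIntegrableOn_apply {d : ℕ} {U : Set (ℝ × Space d)} {g : ℝ × Space d → Space d}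
    (hg : LocallyIntegrableOn g U) (i : Fin d) : LocallyIntegrableOn (fun z => g z i) U :=
  fun x hx => by
    obtain ⟨s, hs, h⟩ := hg x hx
    exact ⟨s, hs, (EuclideanSpace.proj (𝕜 := ℝ) i : Space d →L[ℝ] ℝ).integrable_comp h⟩

theorem hasWeakGradX_iff {d : ℕ} {U : Set (ℝ × Space d)} {w : ℝ × Space d → ℝ}
    {g : ℝ × Space d → Space d} :
    HasWeakGradX U w g ↔ LocallyIntegrableOn w U ∧ LocallyIntegrableOn g U ∧
      ∀ i, HasWeakDirDeriv U w (fun z => g z i) (0, EuclideanSpace.single i 1) :=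
  ⟨fun h => ⟨h.1, h.2.1, fun i => ⟨h.1, locallyIntegrableOn_apply h.2.1 i,
    fun φ hφ => h.2.2 φ hφ i⟩⟩, fun h => ⟨h.1, h.2.1, fun φ hφ i => (h.2.2 i).2.2 φ hφ⟩⟩

theorem locallyIntegrableOn_congr {α F : Type*} [TopologicalSpace α] [MeasurableSpace α]
    [NormedAddCommGroup F] {μ : Measure α} {U : Set α} {u v : α → F}
    (hu : LocallyIntegrableOn u U μ) (h : u =ᵐ[μ.restrict U] v) : LocallyIntegrableOn v U μ :=
  fun x hx => by
    obtain ⟨s, hs, hi⟩ := hu x hx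
    exact ⟨s ∩ U, inter_mem hs self_mem_nhdsWithin, (hi.mono_set inter_subset_left).congr_fun_ae
      (ae_restrict_of_ae_restrict_of_subset inter_subset_right h)⟩

theorem integrable_mul_of_tsupport_subset {d : ℕ} {U : Set (ℝ × Space d)} {w ψ : ℝ × Space d → ℝ}
    (hw : LocallyIntegrableOn w U) (hψ : Continuous ψ) (hc : HasCompactSupport ψ)
    (hU : tsupport ψ ⊆ U) : Integrable fun z => w z * ψ z := by
  obtain ⟨C, hC⟩ := hc.exists_bound_of_continuous hψ
  rw [← integrableOn_iff_integrable_of_support_subset (s := tsupport ψ)]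
  · exact (hw.integrableOn_compact_subset hU hc).mul_bdd (c := C)
      hψ.aestronglyMeasurable (ae_of_all _ hC)
  · exact (Function.support_mul_subset_right _ _).trans (subset_tsupport ψ)

namespace HasWeakDirDeriv

variable {d : ℕ} {U V : Set (ℝ × Space d)} {w w' h h' : ℝ × Space d → ℝ} {e : ℝ × Space d}

theorem mono (H : HasWeakDirDeriv U w h e) (hVU : V ⊆ U) : HasWeakDirDeriv V w h e := by
  refine ⟨H.1.mono_set hVU, H.2.1.mono_set hVU, fun φ hφ => ?_⟩
  have h1 := H.2.2 φ (hφ.mono hVU)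
  rw [setIntegral_mul_eq_integral_indicator_mul hVU fun z hz => by simp [hφ.fderiv_eq_zero hz],
    setIntegral_mul_eq_integral_indicator_mul hVU fun z hz => hφ.eq_zero hz] at h1
  rwa [setIntegral_mul_eq_integral_indicator_mul subset_rfl fun z hz => by
      simp [hφ.fderiv_eq_zero hz],
    setIntegral_mul_eq_integral_indicator_mul subset_rfl fun z hz => hφ.eq_zero hz]

theorem congr (H : HasWeakDirDeriv U w h e) 
    (hw : w =ᵐ[volume.restrict U] w') (hh : h =ᵐ[volume.restrict U] h') :
    HasWeakDirDeriv U w' h' e := by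
  refine ⟨locallyIntegrableOn_congr H.1 hw, locallyIntegrableOn_congr H.2.1 hh, fun φ hφ => ?_⟩
  have e1 : ∫ z in U, w' z * fderiv ℝ φ z e = ∫ z in U, w z * fderiv ℝ φ z e :=
    integral_congr_ae (hw.mono fun z hz => by simp only [hz])
  have e2 : ∫ z in U, h' z * φ z = ∫ z in U, h z * φ z :=
    integral_congr_ae (hh.mono fun z hz => by simp only [hz])
  rw [e1, e2, H.2.2 φ hφ]

theorem sub (H : HasWeakDirDeriv U w h e) (H' : HasWeakDirDeriv U w' h' e) :
    HasWeakDirDeriv U (w - w') (h - h') e := by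
  refine ⟨H.1.sub H'.1, H.2.1.sub H'.2.1, fun φ hφ => ?_⟩
  have i1 : ∀ {v : ℝ × Space d → ℝ}, LocallyIntegrableOn v U →
      Integrable (fun z => v z * φ z) (volume.restrict U) := fun hv =>
    (integrable_mul_of_tsupport_subset hv hφ.continuous hφ.hasCompactSupport
      hφ.tsupport_subset).restrict
  have i2 : ∀ {v : ℝ × Space d → ℝ}, LocallyIntegrableOn v U →
      Integrable (fun z => v z * fderiv ℝ φ z e) (volume.restrict U) := fun hv =>
    (integrable_mul_of_tsupport_subset hv (hφ.continuous_fderiv.clm_apply continuous_const)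
      (hφ.hasCompactSupport.fderiv_apply ℝ e)
      ((tsupport_fderiv_apply_subset ℝ e).trans hφ.tsupport_subset)).restrict
  simp only [Pi.sub_apply, sub_mul]
  rw [integral_sub (i2 H.1) (i2 H'.1), integral_sub (i1 H.2.1) (i1 H'.2.1), H.2.2 φ hφ,
    H'.2.2 φ hφ]
  ring

/-- The difference of two weak derivatives is orthogonal to all test functions, so it vanishes by
the fundamental lemma of the calculus of variations. -/
theorem unique (H : HasWeakDirDeriv U w h e) (hU : IsOpen U) (H' : HasWeakDirDeriv U w h' e) :
    h =ᵐ[volume.restrict U] h' := by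
  have hs := H.sub H'
  rw [Filter.EventuallyEq, ae_restrict_iff' hU.measurableSet]
  have key := hU.ae_eq_zero_of_integral_contDiff_smul_eq_zero hs.2.1 fun φ h1 h2 h3 => by
    have hφ : IsTestFun U φ := ⟨h1, h2, h3⟩
    have := hs.2.2 φ hφ
    rw [sub_self] at this
    simp only [Pi.zero_apply, zero_mul, integral_zero, zero_eq_neg] at this
    rw [← this, setIntegral_eq_integral_of_forall_compl_eq_zero fun z hz => by
      rw [hφ.eq_zero hz, mul_zero]]
    simp only [smul_eq_mul, mul_comm]
  filter_upwards [key] with z hz hzU using sub_eq_zero.1 (hz hzU)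

theorem of_contDiff (U : Set (ℝ × Space d)) {p : ℝ × Space d → ℝ} (hp : ContDiff ℝ 1 p)
    (e : ℝ × Space d) : HasWeakDirDeriv U p (fun z => fderiv ℝ p z e) e := by
  have hc : Continuous fun z => fderiv ℝ p z e :=
    (hp.continuous_fderiv one_ne_zero).clm_apply continuous_const
  refine ⟨hp.continuous.locallyIntegrable.locallyIntegrableOn U,
    hc.locallyIntegrable.locallyIntegrableOn U, fun φ hφ => ?_⟩
  rw [setIntegral_eq_integral_of_forall_compl_eq_zero fun z hz => by
      rw [hφ.fderiv_eq_zero hz, zero_apply, mul_zero],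
    setIntegral_eq_integral_of_forall_compl_eq_zero fun z hz => by rw [hφ.eq_zero hz, mul_zero]]
  refine integral_mul_fderiv_eq_neg_fderiv_mul_of_integrable ?_ ?_ ?_
    (fun z _ => hp.differentiable one_ne_zero z) (fun z _ => hφ.differentiableAt z)
  · exact integrable_mul_of_tsupport_subset (U := univ) (hc.locallyIntegrable.locallyIntegrableOn _)
      hφ.continuous hφ.hasCompactSupport (subset_univ _)
  · exact integrable_mul_of_tsupport_subset (U := univ)
      (hp.continuous.locallyIntegrable.locallyIntegrableOn _)
      (hφ.continuous_fderiv.clm_apply continuous_const)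
      (hφ.hasCompactSupport.fderiv_apply ℝ e) (subset_univ _)
  · exact integrable_mul_of_tsupport_subset (U := univ)
      (hp.continuous.locallyIntegrable.locallyIntegrableOn _)
      hφ.continuous hφ.hasCompactSupport (subset_univ _)

end HasWeakDirDeriv

namespace HasWeakGradX

variable {d : ℕ} {U V : Set (ℝ × Space d)} {w w' : ℝ × Space d → ℝ} {g g' : ℝ × Space d → Space d}

theorem mono (H : HasWeakGradX U w g) (hVU : V ⊆ U) : HasWeakGradX V w g := by
  rw [hasWeakGradX_iff] at H ⊢
  exact ⟨H.1.mono_set hVU, H.2.1.mono_set hVU, fun i => (H.2.2 i).mono hVU⟩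

theorem congr (H : HasWeakGradX U w g) (hw : w =ᵐ[volume.restrict U] w')
    (hg : g =ᵐ[volume.restrict U] g') : HasWeakGradX U w' g' := by
  rw [hasWeakGradX_iff] at H ⊢
  exact ⟨locallyIntegrableOn_congr H.1 hw, locallyIntegrableOn_congr H.2.1 hg, fun i => (H.2.2 i).congr hw
    (hg.mono fun z hz => by simp only [hz])⟩

theorem sub (H : HasWeakGradX U w g) (H' : HasWeakGradX U w' g') :
    HasWeakGradX U (w - w') (g - g') := by
  rw [hasWeakGradX_iff] at H H' ⊢
  exact ⟨H.1.sub H'.1, H.2.1.sub H'.2.1, fun i => (H.2.2 i).sub (H'.2.2 i)⟩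

theorem unique (H : HasWeakGradX U w g) (hU : IsOpen U) (H' : HasWeakGradX U w g') :
    g =ᵐ[volume.restrict U] g' := by
  rw [hasWeakGradX_iff] at H H'
  have := ae_all_iff.2 fun i => (H.2.2 i).unique hU (H'.2.2 i)
  filter_upwards [this] with z hz
  exact PiLp.ext hz

theorem of_contDiff (U : Set (ℝ × Space d)) {p : ℝ × Space d → ℝ} (hp : ContDiff ℝ 1 p) :
    HasWeakGradX U p (gradX p) := by
  rw [hasWeakGradX_iff]
  refine ⟨hp.continuous.locallyIntegrable.locallyIntegrableOn U,
    (continuous_gradX hp).locallyIntegrable.locallyIntegrableOn U, fun i => ?_⟩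
  simp only [gradX_apply]
  exact .of_contDiff U hp _

end HasWeakGradX

theorem isTestFun_slice {d : ℕ} {U : Set (ℝ × Space d)} {φ : ℝ × Space d → ℝ}
    (hφ : IsTestFun U φ) (t : ℝ) : IsTestFun univ fun x : Space d => φ (t, x) := by
  refine ⟨hφ.contDiff.comp (contDiff_prodMk_right t), ?_, subset_univ _⟩
  refine HasCompactSupport.intro (hφ.hasCompactSupport.isCompact.image continuous_snd)
    fun x hx => ?_
  exact image_eq_zero_of_notMem_tsupport fun h => hx ⟨(t, x), h, rfl⟩

theorem fderiv_slice {d : ℕ} {U : Set (ℝ × Space d)} {φ : ℝ × Space d → ℝ}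
    (hφ : IsTestFun U φ) (t : ℝ) (x e : Space d) :
    fderiv ℝ (fun x : Space d => φ (t, x)) x e = fderiv ℝ φ (t, x) (0, e) := by
  have h1 : HasFDerivAt (fun x : Space d => ((t, x) : ℝ × Space d))
      (ContinuousLinearMap.inr ℝ ℝ (Space d)) x := hasFDerivAt_prodMk_right t x
  have h2 := (hφ.differentiableAt (t, x)).hasFDerivAt.comp x h1
  have h3 : fderiv ℝ (fun x : Space d => φ (t, x)) x =
      (fderiv ℝ φ (t, x)).comp (ContinuousLinearMap.inr ℝ ℝ (Space d)) := h2.fderiv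
  rw [h3]
  simp

/-- The gradient field of an element of `L²(J; H¹₀(Ω))` is a weak gradient on `J × Ω`. -/
theorem hasWeakGradX_of_hasH10Grad {d : ℕ} {T : ℝ} {Ω : Set (Space d)} {v : ℝ × Space d → ℝ}
    {G : ℝ × Space d → Space d} (hΩ : volume Ω ≠ ⊤)
    (hv : MemLp v 2 (volume.restrict (Icc 0 T ×ˢ Ω)))
    (hG : MemLp G 2 (volume.restrict (Icc 0 T ×ˢ Ω)))
    (h : ∀ᵐ t ∂(volume.restrict (Icc 0 T)),
      HasH10Grad Ω (fun x => v (t, x)) (fun x => G (t, x))) :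
    HasWeakGradX (Ioo 0 T ×ˢ Ω) v G := by
  have hμ : (volume : Measure (ℝ × Space d)).restrict (Ioo 0 T ×ˢ Ω) =
      volume.restrict (Icc 0 T ×ˢ Ω) := by
    rw [Measure.volume_eq_prod, ← Measure.prod_restrict, ← Measure.prod_restrict,
      restrict_Ioo_eq_restrict_Icc]
  have hfin : IsFiniteMeasure ((volume : Measure (ℝ × Space d)).restrict (Icc 0 T ×ˢ Ω)) := by
    refine ⟨?_⟩
    rw [Measure.restrict_apply_univ, Measure.volume_eq_prod, Measure.prod_prod]
    exact ENNReal.mul_lt_top (by simp) hΩ.lt_top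
  have loc : ∀ {F : Type} [NormedAddCommGroup F] {u : ℝ × Space d → F},
      MemLp u 2 (volume.restrict (Icc 0 T ×ˢ Ω)) → LocallyIntegrableOn u (Ioo 0 T ×ˢ Ω) := by
    intro F _ u hu
    refine IntegrableOn.locallyIntegrableOn ?_
    rw [IntegrableOn, hμ]
    exact hu.integrable (by norm_num)
  refine ⟨loc hv, loc hG, fun φ hφ i => ?_⟩
  have hGi : MemLp (fun z => G z i) 2 (volume.restrict (Icc 0 T ×ˢ Ω)) :=
    (EuclideanSpace.proj (𝕜 := ℝ) i : Space d →L[ℝ] ℝ).comp_memLp' hG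
  have e1 := (hv.integrable_mul (hφ.memLp_fderiv_apply (μ := volume.restrict (Icc 0 T ×ˢ Ω))
    (0, EuclideanSpace.single i 1) (p := 2)))
  have e2 := (hGi.integrable_mul (hφ.memLp (μ := volume.restrict (Icc 0 T ×ˢ Ω)) (p := 2)))
  rw [hμ]
  rw [Measure.volume_eq_prod, ← Measure.prod_restrict] at e1 e2 ⊢
  have e1' := integral_prod _ e1
  have e2' := integral_prod _ e2
  simp only [Pi.mul_apply] at e1' e2'
  rw [e1', e2', ← integral_neg]
  refine integral_congr_ae ?_
  filter_upwards [h] with t ht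
  have := ht.integral_mul_fderiv (isTestFun_slice hφ t) i
  simp only [fderiv_slice hφ] at this
  exact this

/-! ### Approximation by constants on patches -/

theorem lintegral_cond {α : Type*} [MeasurableSpace α] (μ : Measure α) (A : Set α) (F : α → ℝ≥0∞) :
    ∫⁻ x, F x ∂(ProbabilityTheory.cond μ A) = (μ A)⁻¹ * ∫⁻ x in A, F x ∂μ := by
  rw [ProbabilityTheory.cond, lintegral_smul_measure, smul_eq_mul]

/-- Friedrichs' inequality on a cell with a facet on the boundary. -/
theorem Mesh.lintegral_sq_le_of_facet_subset {d : ℕ} (hd : 1 ≤ d) {T : ℝ} {Ω : Set (Space d)}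
    (hΩ : IsLipschitzDomain Ω) (M : Mesh d T Ω) {K : Cell d} (hK : K ∈ M.cells) {i : Fin (d + 1)}
    (hi : K.facet i ⊆ frontier Ω) {v : ℝ × Space d → ℝ} {G : ℝ × Space d → Space d}
    (hv : MemLp v 2 (volume.restrict (Icc 0 T ×ˢ Ω)))
    (hG : MemLp G 2 (volume.restrict (Icc 0 T ×ˢ Ω)))
    (h : ∀ᵐ t ∂(volume.restrict (Icc 0 T)),
      HasH10Grad Ω (fun x => v (t, x)) (fun x => G (t, x))) :
    ∫⁻ z in K.toSet, ‖v z‖ₑ ^ 2 ≤ ENNReal.ofReal K.hx ^ 2 * ∫⁻ z in K.toSet, ‖G z‖ₑ ^ 2 := by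
  have hv' := (M.memLp_of_memLp hΩ hK hv).aestronglyMeasurable.enorm.pow_const 2
  have hG' := (M.memLp_of_memLp hΩ hK hG).aestronglyMeasurable.enorm.pow_const 2
  rw [Cell.toSet, Measure.volume_eq_prod, ← Measure.prod_restrict] at hv' hG' ⊢
  rw [lintegral_prod _ hv', lintegral_prod _ hG', ← lintegral_const_mul' _ _ (by finiteness)]
  refine lintegral_mono_ae ?_
  filter_upwards [ae_restrict_of_ae_restrict_of_subset (M.timeSet_subset hK) h] with t ht
  have := K.eLpNorm_le_of_facet_subset hd hΩ (M.spaceSet_subset hK) hi ht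
  rw [← eLpNorm_two_sq, ← eLpNorm_two_sq, ← mul_pow]
  gcongr

namespace Mesh

namespace Dofs

variable {d : ℕ} {T : ℝ} {Ω : Set (Space d)} {M : Mesh d T Ω} {k ℓ : ℕ} {D : M.Dofs k ℓ} {κ : ℝ}

theorem interior_patch_subset (hΩ : IsLipschitzDomain Ω) (K : Cell d) :
    interior (D.patch K) ⊆ Ioo 0 T ×ˢ Ω := by
  refine (interior_mono (patch_subset K)).trans ?_
  rw [interior_prod_eq, interior_Icc]
  exact Set.prod_mono_right hΩ.interior_closure_subset

theorem ofReal_le_volume_cell (hd : 1 ≤ d) (hκ : 1 ≤ κ) (hD : D.IsRegular κ) {K K' : Cell d}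
    (hK : K ∈ M.cells) (hK' : K' ∈ M.cells) (hKs : K'.toSet ⊆ D.patch K) :
    ENNReal.ofReal (κ⁻¹ * ((κ ^ 2)⁻¹ ^ d * ballVol d) * (K.ht * K.hx ^ d)) ≤ volume K'.toSet := by
  refine le_trans ?_ (measure_mono interior_subset)
  refine Cell.ShapeRegular.ofReal_le_volume hd hκ (hD.shape K' hK') ?_
  have h1 := (hD.grading_t K hK K' hK' hKs).2
  have h2 := (hD.grading_x K hK K' hK' hKs).2
  have := K'.hx_pos hd
  have := K'.ht_pos
  have := K.hx_pos hd
  have := K.ht_pos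
  have hκ0 : 0 < κ := by linarith
  have hb := ballVol_pos d
  have h3 : K.hx / κ ^ 2 ≤ K'.hx / κ := by
    rw [div_le_div_iff₀ (by positivity) hκ0]
    nlinarith
  have h4 : K.ht / κ ≤ K'.ht := by
    rw [div_le_iff₀ hκ0]
    linarith
  calc κ⁻¹ * ((κ ^ 2)⁻¹ ^ d * ballVol d) * (K.ht * K.hx ^ d)
      = K.ht / κ * ((K.hx / κ ^ 2) ^ d * ballVol d) := by
        rw [div_pow, inv_pow]
        field_simp
    _ ≤ _ := by gcongr

theorem isProbabilityMeasure_cond (hne : ∀ K ∈ M.cells, (interior K.toSet).Nonempty)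
    {K : Cell d} (hK : K ∈ M.cells) :
    IsProbabilityMeasure (ProbabilityTheory.cond (volume : Measure (ℝ × Space d)) K.toSet) := by
  refine ProbabilityTheory.cond_isProbabilityMeasure_of_finite ?_ K.isCompact_toSet.measure_ne_top
  exact ((isOpen_interior.measure_pos _ (hne K hK)).trans_le (measure_mono interior_subset)).ne'

/-- Approximation by a constant, which is zero if the patch has a node on the boundary. -/
theorem exists_const_approx (d k ℓ : ℕ) (hd : 1 ≤ d) (hκ : 1 ≤ κ) :
    ∃ C : ℝ≥0, ∀ {T : ℝ} {Ω : Set (Space d)} {M : Mesh d T Ω} {D : M.Dofs k ℓ},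
      IsLipschitzDomain Ω → D.IsRegular κ →
      ∀ loc : ℝ × Space d → Cell d, (∀ j ∈ D.nodes, loc j ∈ M.cells ∧ j ∈ (loc j).toSet) →
      ∀ K ∈ M.cells, ∀ {v w f : ℝ × Space d → ℝ} {g : ℝ × Space d → Space d},
      MemL2H10 T Ω v → IsWeakTriple (interior (D.patch K)) w f g →
      v =ᵐ[volume.restrict (interior (D.patch K))] w →
      ∃ c : ℝ, (∀ j ∈ D.activeNodes K, j.2 ∈ frontier Ω → c = 0) ∧ ∀ j ∈ D.activeNodes K,
        ∫⁻ z, ‖w z - c‖ₑ ^ 2 ∂(ProbabilityTheory.cond volume (loc j).toSet) ≤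
        C * (energy (interior (D.patch K)) K.ht K.hx f g / ENNReal.ofReal (K.ht * K.hx ^ d)) := by
  have hκ0 : 0 < κ := by linarith
  have hb := ballVol_pos d
  obtain ⟨C, hC⟩ := exists_msd_cells_le d hd hκ
  obtain ⟨n, hn⟩ := exists_card_activeNodes_le d k ℓ hd hκ
  set α : ℝ := κ⁻¹ * ((κ ^ 2)⁻¹ ^ d * ballVol d) with hα
  have hα0 : 0 < α := by positivity
  refine ⟨n * C + (2 * C + 2 * (α⁻¹ * κ ^ 2).toNNReal),
    fun {T Ω M D} hΩ hD loc hloc K hK {v w f g} hv hw hvw => ?_⟩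
  have hne := hD.interior_nonempty hd hκ
  have hht := K.ht_pos
  have hhx := K.hx_pos hd
  set O := interior (D.patch K) with hO
  set q : ℝ≥0∞ := energy O K.ht K.hx f g / ENNReal.ofReal (K.ht * K.hx ^ d) with hq
  have hlocp : ∀ j ∈ D.activeNodes K, loc j ∈ M.cells ∧ (loc j).toSet ⊆ D.patch K := fun j hj => by
    have h := hloc j (mem_activeNodes.1 hj).1
    exact ⟨h.1, loc_subset_patch hne h.1 hj h.2⟩
  have hwm := hw.measurable
  -- With a lateral node, `c = 0` and Friedrichs' inequality on a boundary cell is transferred to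
  -- the cells `K(j)` by the patch inequality. Without one, the constant is free.
  by_cases hbd : ∃ j ∈ D.activeNodes K, j.2 ∈ frontier Ω
  · refine ⟨0, fun _ _ _ => rfl, fun j hj => ?_⟩
    obtain ⟨j₀, hj₀, hj₀f⟩ := hbd
    obtain ⟨K', hK', hK'p, i, hi⟩ := exists_boundary_cell hd hD hΩ hne hj₀ hj₀f
    obtain ⟨hv1, G, hG1, hG2⟩ := hv
    have hKO : interior K'.toSet ⊆ O := interior_mono hK'p
    -- The given weak gradient `g` and the slicewise gradient `G` agree by uniqueness.
    have hgG : g =ᵐ[volume.restrict K'.toSet] G := by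
      rw [← K'.restrict_interior_toSet]
      have h1 := (hasWeakGradX_of_hasH10Grad hΩ.volume_ne_top hv1 hG1 hG2).mono
        (interior_patch_subset (D := D) hΩ K)
      have h2 : HasWeakGradX O w G := h1.congr hvw (ae_eq_refl _)
      exact ae_restrict_of_ae_restrict_of_subset hKO (hw.hasWeakGradX.unique isOpen_interior h2)
    have hvw' : v =ᵐ[volume.restrict K'.toSet] w := by
      rw [← K'.restrict_interior_toSet]
      exact ae_restrict_of_ae_restrict_of_subset hKO hvw
    have h1 : ∫⁻ z in K'.toSet, ‖w z‖ₑ ^ 2 ≤ ENNReal.ofReal (κ ^ 2) * energy O K.ht K.hx f g := by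
      calc ∫⁻ z in K'.toSet, ‖w z‖ₑ ^ 2 = ∫⁻ z in K'.toSet, ‖v z‖ₑ ^ 2 :=
            lintegral_congr_ae (hvw'.mono fun z hz => by simp only [hz])
        _ ≤ ENNReal.ofReal K'.hx ^ 2 * ∫⁻ z in K'.toSet, ‖G z‖ₑ ^ 2 :=
            M.lintegral_sq_le_of_facet_subset hd hΩ hK' hi hv1 hG1 hG2
        _ = ENNReal.ofReal K'.hx ^ 2 * ∫⁻ z in interior K'.toSet, ‖g z‖ₑ ^ 2 := by
            rw [K'.restrict_interior_toSet]
            congr 1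
            exact lintegral_congr_ae (hgG.mono fun z hz => by simp only [hz])
        _ ≤ ENNReal.ofReal (κ * K.hx) ^ 2 * ∫⁻ z in O, ‖g z‖ₑ ^ 2 := by
            gcongr
            exact (hD.grading_x K hK K' hK' hK'p).1
        _ = ENNReal.ofReal (κ ^ 2) * (ENNReal.ofReal K.hx ^ 2 * ∫⁻ z in O, ‖g z‖ₑ ^ 2) := by
            rw [ENNReal.ofReal_mul hκ0.le, mul_pow, ENNReal.ofReal_pow hκ0.le, mul_assoc]
        _ ≤ ENNReal.ofReal (κ ^ 2) * energy O K.ht K.hx f g := by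
            gcongr
            exact le_add_self
    have h2 : ∫⁻ z, ‖w z‖ₑ ^ 2 ∂(ProbabilityTheory.cond volume K'.toSet) ≤
        (α⁻¹ * κ ^ 2).toNNReal * q := by
      rw [lintegral_cond]
      have h3 := ofReal_le_volume_cell hd hκ hD hK hK' hK'p
      calc (volume K'.toSet)⁻¹ * ∫⁻ z in K'.toSet, ‖w z‖ₑ ^ 2
          ≤ (ENNReal.ofReal (α * (K.ht * K.hx ^ d)))⁻¹ *
            (ENNReal.ofReal (κ ^ 2) * energy O K.ht K.hx f g) := by gcongr
        _ = (α⁻¹ * κ ^ 2).toNNReal * q := by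
            change _ = ENNReal.ofReal (α⁻¹ * κ ^ 2) * q
            rw [hq, ENNReal.div_eq_inv_mul, ENNReal.ofReal_mul hα0.le,
              ENNReal.ofReal_mul (inv_nonneg.2 hα0.le), ENNReal.ofReal_inv_of_pos hα0,
              ENNReal.mul_inv (.inr ENNReal.ofReal_ne_top) (.inl ENNReal.ofReal_ne_top)]
            ring
    obtain ⟨hl1, hl2⟩ := hlocp j hj
    have := isProbabilityMeasure_cond hne hl1
    have := isProbabilityMeasure_cond hne hK'
    simp only [sub_zero]
    calc _ ≤ 2 * (C * q) + 2 * ((α⁻¹ * κ ^ 2).toNNReal * q) := by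
          refine (lintegral_sq_cond_le (B := K'.toSet) hwm).trans ?_
          gcongr
          exact hC hD K hK hw _ hl1 _ hK' hl2 hK'p
      _ ≤ _ := by
          push_cast
          rw [add_mul, add_mul, mul_assoc, mul_assoc, mul_assoc]
          exact le_add_self
  · have := isProbabilityMeasure_cond hne hK
    have hm : Measurable fun y => ∑ j ∈ D.activeNodes K,
        ∫⁻ z, ‖w y - w z‖ₑ ^ 2 ∂(ProbabilityTheory.cond volume (loc j).toSet) := by
      refine Finset.measurable_sum _ fun j hj => ?_
      have := isProbabilityMeasure_cond hne (hlocp j hj).1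
      exact Measurable.lintegral_prod_right' (f := fun p : (ℝ × Space d) × (ℝ × Space d) =>
        ‖w p.1 - w p.2‖ₑ ^ 2) (by fun_prop)
    -- One constant has to serve all `K(j)`. Take `c = w y` at a point `y` where the sum of the mean
    -- square differences to these cells is at most its average over `K`.
    obtain ⟨y, hy⟩ := exists_le_lintegral (μ := ProbabilityTheory.cond volume K.toSet) hm.aemeasurable
    refine ⟨w y, fun j hj hjf => absurd ⟨j, hj, hjf⟩ hbd, fun j hj => ?_⟩
    have h1 : ∫⁻ y, (∑ j ∈ D.activeNodes K, ∫⁻ z, ‖w y - w z‖ₑ ^ 2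
        ∂(ProbabilityTheory.cond volume (loc j).toSet)) ∂(ProbabilityTheory.cond volume K.toSet) ≤
        n * (C * q) := by
      rw [lintegral_finsetSum' _ fun j hj => ?_]
      · calc _ ≤ ∑ j ∈ D.activeNodes K, C * q := Finset.sum_le_sum fun j hj =>
              hC hD K hK hw _ hK _ (hlocp j hj).1 (toSet_subset_patch hne hK) (hlocp j hj).2
          _ = (D.activeNodes K).card * (C * q) := by rw [Finset.sum_const, nsmul_eq_mul]
          _ ≤ n * (C * q) := by
              gcongr
              exact hn hD loc hloc K hK
      · have := isProbabilityMeasure_cond hne (hlocp j hj).1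
        exact (Measurable.lintegral_prod_right' (f := fun p : (ℝ × Space d) × (ℝ × Space d) =>
          ‖w p.1 - w p.2‖ₑ ^ 2) (by fun_prop)).aemeasurable
    calc ∫⁻ z, ‖w z - w y‖ₑ ^ 2 ∂(ProbabilityTheory.cond volume (loc j).toSet)
        = ∫⁻ z, ‖w y - w z‖ₑ ^ 2 ∂(ProbabilityTheory.cond volume (loc j).toSet) := by
          simp only [enorm_sub_rev]
      _ ≤ ∑ j ∈ D.activeNodes K,
          ∫⁻ z, ‖w y - w z‖ₑ ^ 2 ∂(ProbabilityTheory.cond volume (loc j).toSet) :=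
          Finset.single_le_sum (f := fun j => ∫⁻ z, ‖w y - w z‖ₑ ^ 2
            ∂(ProbabilityTheory.cond volume (loc j).toSet)) (fun _ _ => zero_le) hj
      _ ≤ n * (C * q) := hy.trans h1
      _ ≤ _ := by
          push_cast
          rw [add_mul, mul_assoc]
          exact le_self_add

end Dofs

end Mesh

/-! ### Discrete estimates -/

theorem ofReal_integral_sq {α : Type*} [MeasurableSpace α] {μ : Measure α} {u : α → ℝ}
    (hu : MemLp u 2 μ) : ENNReal.ofReal (∫ z, u z ^ 2 ∂μ) = ∫⁻ z, ‖u z‖ₑ ^ 2 ∂μ := by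
  rw [ofReal_integral_eq_lintegral_ofReal hu.integrable_sq (ae_of_all _ fun z => sq_nonneg _)]
  refine lintegral_congr fun z => ?_
  rw [← Real.enorm_eq_ofReal (sq_nonneg _), enorm_pow]

theorem Cell.volume_toSet_le {d : ℕ} (hd : 1 ≤ d) (K : Cell d) :
    volume K.toSet ≤ ENNReal.ofReal (ballVol d * (K.ht * K.hx ^ d)) := by
  have hb := ballVol_pos d
  have hht := K.ht_pos
  have hhx := K.hx_pos hd
  have hsub : K.spaceSet ⊆ Metric.closedBall (K.simplex.points 0) K.hx := fun x hx =>
    Metric.mem_closedBall.2 (K.dist_le_hx hx (K.simplex_mem_spaceSet 0))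
  rw [toSet, timeSet, Measure.volume_eq_prod, Measure.prod_prod, Real.volume_Icc]
  have h1 : volume K.spaceSet ≤ ENNReal.ofReal (K.hx ^ d * ballVol d) := by
    refine (measure_mono hsub).trans ?_
    rw [Measure.addHaar_closedBall _ _ hhx.le, ENNReal.ofReal_mul (by positivity), ballVol,
      ENNReal.ofReal_toReal measure_ball_lt_top.ne]
    simp
  refine (mul_le_mul' le_rfl h1).trans ?_
  rw [← ENNReal.ofReal_mul (sub_nonneg.2 K.lt.le)]
  exact ENNReal.ofReal_le_ofReal (le_of_eq (by rw [ht]; ring))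

/-- The inverse estimate is applied to the polynomial `Π v - c`, whose `L²` norm is at most that of
`v - c`. -/
theorem exists_enorm_l2Proj_sub_le (d k ℓ : ℕ) (hd : 1 ≤ d) {κ : ℝ} (hκ : 1 ≤ κ) :
    ∃ C : ℝ≥0, ∀ K : Cell d, K.ShapeRegular κ → ∀ v : ℝ × Space d → ℝ,
      MemLp v 2 (volume.restrict K.toSet) → ∀ c : ℝ, ∀ z ∈ K.toSet,
      ‖l2Proj k ℓ K.toSet v z - c‖ₑ ^ 2 ≤
        C * ∫⁻ y, ‖v y - c‖ₑ ^ 2 ∂(ProbabilityTheory.cond volume K.toSet) := by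
  obtain ⟨C, hC0, hC⟩ := exists_inverse_estimate d k ℓ hd hκ
  refine ⟨(C * ballVol d).toNNReal, fun K hK v hv c z hz => ?_⟩
  have hb := ballVol_pos d
  have hht := K.ht_pos
  have hhx := K.hx_pos hd
  have hS := K.isCompact_toSet
  have hv' : MemLp (fun y => v y - c) 2 (volume.restrict K.toSet) :=
    hv.sub (memLp_two_of_continuous continuous_const hS hS.measurableSet)
  have h0 : volume K.toSet ≠ 0 := ((isOpen_interior.measure_pos _
    (hK.interior_toSet_nonempty hd hκ)).trans_le (measure_mono interior_subset)).ne'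
  have h1 := (hC K hK _ (Submodule.sub_mem _ (isL2Proj_l2Proj hS k ℓ hv).1
    (const_mem_tensorPoly d k ℓ c)) z hz).1
  simp only [Pi.sub_apply] at h1
  have h2 : (l2Proj k ℓ K.toSet v z - c) ^ 2 ≤
      C * ((K.ht * K.hx ^ d)⁻¹ * ∫ y in K.toSet, (v y - c) ^ 2) := by
    exact h1.trans (mul_le_mul_of_nonneg_left (mul_le_mul_of_nonneg_left
      (integral_l2Proj_sub_const_sq_le hS hv c) (by positivity)) hC0)
  calc ‖l2Proj k ℓ K.toSet v z - c‖ₑ ^ 2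
      = ENNReal.ofReal ((l2Proj k ℓ K.toSet v z - c) ^ 2) := by
        rw [← Real.enorm_eq_ofReal (sq_nonneg _), enorm_pow]
    _ ≤ ENNReal.ofReal (C * ((K.ht * K.hx ^ d)⁻¹ * ∫ y in K.toSet, (v y - c) ^ 2)) :=
        ENNReal.ofReal_le_ofReal h2
    _ = ENNReal.ofReal (C * (K.ht * K.hx ^ d)⁻¹) * ∫⁻ y in K.toSet, ‖v y - c‖ₑ ^ 2 := by
        rw [← mul_assoc, ENNReal.ofReal_mul (by positivity), ofReal_integral_sq hv']
    _ = ENNReal.ofReal (C * (K.ht * K.hx ^ d)⁻¹) * (volume K.toSet *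
          ∫⁻ y, ‖v y - c‖ₑ ^ 2 ∂(ProbabilityTheory.cond volume K.toSet)) := by
        rw [lintegral_cond, ← mul_assoc (volume K.toSet),
          ENNReal.mul_inv_cancel h0 hS.measure_ne_top, one_mul]
    _ ≤ ENNReal.ofReal (C * (K.ht * K.hx ^ d)⁻¹) * (ENNReal.ofReal (ballVol d * (K.ht * K.hx ^ d)) *
          ∫⁻ y, ‖v y - c‖ₑ ^ 2 ∂(ProbabilityTheory.cond volume K.toSet)) := by
        gcongr
        exact K.volume_toSet_le hd
    _ = _ := by
        rw [← mul_assoc, ← ENNReal.ofReal_mul (by positivity)]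
        congr 2
        field_simp

/-- Bounds for the derivatives of a polynomial that is bounded by `s` on a cell. -/
theorem exists_lintegral_deriv_le (d k ℓ : ℕ) (hd : 1 ≤ d) {κ : ℝ} (hκ : 1 ≤ κ) :
    ∃ C : ℝ≥0, ∀ K : Cell d, K.ShapeRegular κ → ∀ p ∈ tensorPoly d k ℓ, ∀ s : ℝ,
      (∀ z ∈ K.toSet, |p z| ≤ s) →
      ENNReal.ofReal K.hx ^ 2 * ∫⁻ z in K.toSet, ‖gradX p z‖ₑ ^ 2 ≤
        C * (ENNReal.ofReal (K.ht * K.hx ^ d) * ‖s‖ₑ ^ 2) ∧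
      ENNReal.ofReal K.ht ^ 2 * ∫⁻ z in K.toSet, ‖fderiv ℝ p z (1, 0)‖ₑ ^ 2 ≤
        C * (ENNReal.ofReal (K.ht * K.hx ^ d) * ‖s‖ₑ ^ 2) := by
  obtain ⟨C, hC0, hC⟩ := exists_inverse_estimate d k ℓ hd hκ
  refine ⟨(C * ballVol d * ballVol d).toNNReal, fun K hK p hp s hs => ?_⟩
  have hb := ballVol_pos d
  have hht := K.ht_pos
  have hhx := K.hx_pos hd
  have hm : 0 < K.ht * K.hx ^ d := by positivity
  have hvol := K.volume_toSet_le hd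
  have h1 : ∫ z in K.toSet, p z ^ 2 ≤ ballVol d * (K.ht * K.hx ^ d) * s ^ 2 := by
    have h2 : ‖∫ z in K.toSet, p z ^ 2‖ ≤ s ^ 2 * (volume.real K.toSet) :=
      norm_setIntegral_le_of_norm_le_const K.isCompact_toSet.measure_lt_top fun z hz => by
        rw [norm_pow, Real.norm_eq_abs]
        exact pow_le_pow_left₀ (abs_nonneg _) (hs z hz) 2
    refine (le_abs_self _).trans (h2.trans ?_)
    rw [mul_comm]
    gcongr
    exact ENNReal.toReal_le_of_le_ofReal (by positivity) hvol
  have h2 : C * ((K.ht * K.hx ^ d)⁻¹ * ∫ z in K.toSet, p z ^ 2) ≤ C * ballVol d * s ^ 2 := by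
    calc _ ≤ C * ((K.ht * K.hx ^ d)⁻¹ * (ballVol d * (K.ht * K.hx ^ d) * s ^ 2)) := by gcongr
      _ = _ := by field_simp
  have key : ∀ {F : Type} [NormedAddCommGroup F] (h : ℝ) (_ : 0 ≤ h) (u : ℝ × Space d → F),
      (∀ z ∈ K.toSet, h ^ 2 * ‖u z‖ ^ 2 ≤ C * ballVol d * s ^ 2) →
      ENNReal.ofReal h ^ 2 * ∫⁻ z in K.toSet, ‖u z‖ₑ ^ 2 ≤
        (C * ballVol d * ballVol d).toNNReal * (ENNReal.ofReal (K.ht * K.hx ^ d) * ‖s‖ₑ ^ 2) := by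
    intro F _ h hh u hu
    rw [← lintegral_const_mul' _ _ (by finiteness)]
    calc ∫⁻ z in K.toSet, ENNReal.ofReal h ^ 2 * ‖u z‖ₑ ^ 2
        ≤ ∫⁻ _z in K.toSet, ENNReal.ofReal (C * ballVol d * s ^ 2) := by
          refine setLIntegral_mono measurable_const fun z hz => ?_
          rw [← ofReal_norm, ← ENNReal.ofReal_pow hh, ← ENNReal.ofReal_pow (norm_nonneg _),
            ← ENNReal.ofReal_mul (by positivity)]
          exact ENNReal.ofReal_le_ofReal (hu z hz)
      _ = ENNReal.ofReal (C * ballVol d * s ^ 2) * volume K.toSet := by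
          rw [lintegral_const, Measure.restrict_apply_univ]
      _ ≤ ENNReal.ofReal (C * ballVol d * s ^ 2) *
          ENNReal.ofReal (ballVol d * (K.ht * K.hx ^ d)) := by gcongr
      _ = _ := by
          change _ = ENNReal.ofReal _ * _
          rw [← enorm_pow, Real.enorm_eq_ofReal (sq_nonneg _), ← ENNReal.ofReal_mul (by positivity),
            ← ENNReal.ofReal_mul hm.le, ← ENNReal.ofReal_mul (by positivity)]
          congr 1
          ring
  exact ⟨key _ hhx.le _ fun z hz => (hC K hK p hp z hz).2.1.trans h2,
    key _ hht.le _ fun z hz => by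
      rw [Real.norm_eq_abs, sq_abs]
      exact (hC K hK p hp z hz).2.2.trans h2⟩

namespace Mesh

namespace Dofs

variable {κ : ℝ}

/-- Local stability of the interpolation operator. -/
theorem exists_interp_deriv_le (d k ℓ : ℕ) (hd : 1 ≤ d) (hκ : 1 ≤ κ) :
    ∃ C : ℝ≥0, ∀ {T : ℝ} {Ω : Set (Space d)} {M : Mesh d T Ω} {D : M.Dofs k ℓ},
      IsLipschitzDomain Ω → D.IsRegular κ →
      ∀ loc : ℝ × Space d → Cell d, (∀ j ∈ D.nodes, loc j ∈ M.cells ∧ j ∈ (loc j).toSet) →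
      ∀ K ∈ M.cells, ∀ {v w f : ℝ × Space d → ℝ} {g : ℝ × Space d → Space d},
      MemL2H10 T Ω v → IsWeakTriple (interior (D.patch K)) w f g →
      v =ᵐ[volume.restrict (interior (D.patch K))] w →
      ∃ p : ℝ × Space d → ℝ, ContDiff ℝ 1 p ∧ EqOn (D.interp loc v) p K.toSet ∧
        ENNReal.ofReal K.hx ^ 2 * ∫⁻ z in K.toSet, ‖gradX p z‖ₑ ^ 2 ≤
          C * energy (interior (D.patch K)) K.ht K.hx f g ∧
        ENNReal.ofReal K.ht ^ 2 * ∫⁻ z in K.toSet, ‖fderiv ℝ p z (1, 0)‖ₑ ^ 2 ≤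
          C * energy (interior (D.patch K)) K.ht K.hx f g := by
  obtain ⟨C₁, hC₁⟩ := exists_const_approx d k ℓ hd hκ
  obtain ⟨C₂, hC₂⟩ := exists_enorm_l2Proj_sub_le d k ℓ hd hκ
  obtain ⟨C₃, hC₃⟩ := exists_lintegral_deriv_le d k ℓ hd hκ
  obtain ⟨n, hn⟩ := exists_card_activeNodes_le d k ℓ hd hκ
  refine ⟨C₃ * (κ.toNNReal ^ 2 * (n * (n * (C₂ * C₁)))),
    fun {T Ω M D} hΩ hD loc hloc K hK {v w f g} hv hw hvw => ?_⟩
  have hκ0 : 0 < κ := by linarith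
  have hne := hD.interior_nonempty hd hκ
  have hht := K.ht_pos
  have hhx := K.hx_pos hd
  set E := energy (interior (D.patch K)) K.ht K.hx f g with hE
  obtain ⟨c, hc0, hc⟩ := hC₁ hΩ hD loc hloc K hK hv hw hvw
  -- At a lateral node both the nodal value and `c` vanish. At the other nodes the bound for the
  -- local projection applies.
  have ha : ∀ j ∈ D.activeNodes K, ‖D.nodalValue loc v j - c‖ₑ ^ 2 ≤
      C₂ * (C₁ * (E / ENNReal.ofReal (K.ht * K.hx ^ d))) := by
    intro j hj
    have hjn := (mem_activeNodes.1 hj).1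
    obtain ⟨hl, hjl⟩ := hloc j hjn
    by_cases hjf : j.2 ∈ frontier Ω
    · rw [nodalValue_of_frontier v hjf, hc0 j hj hjf]
      simp
    · rw [nodalValue_of_notMem_frontier v hjn hjf]
      refine (hC₂ _ (hD.shape _ hl) v (M.memLp_of_memLp hΩ hl hv.1) c j hjl).trans ?_
      gcongr
      refine le_trans (le_of_eq ?_) (hc j hj)
      rw [lintegral_cond, lintegral_cond]
      congr 1
      refine lintegral_congr_ae ?_
      have h1 : v =ᵐ[volume.restrict (loc j).toSet] w := by
        rw [← Cell.restrict_interior_toSet]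
        exact ae_restrict_of_ae_restrict_of_subset
          (interior_mono (loc_subset_patch hne hl hj hjl)) hvw
      exact h1.mono fun z hz => by simp only [hz]
  choose! p hp hpK using fun j hj => D.basis_mem j hj K hK
  -- On `K` this is the interpolant minus `c`, by the partition of unity. It has the same
  -- derivatives and is bounded by `κ ∑ |a_j - c|`.
  set q : ℝ × Space d → ℝ := ∑ j ∈ D.activeNodes K, (D.nodalValue loc v j - c) • p j with hq
  have hqm : q ∈ tensorPoly d k ℓ := Submodule.sum_mem _ fun j hj =>
    Submodule.smul_mem _ _ (hp j (mem_activeNodes.1 hj).1)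
  have hqz : ∀ z ∈ K.toSet, q z =
      ∑ j ∈ D.activeNodes K, (D.nodalValue loc v j - c) * D.basis j z := fun z hz => by
    rw [hq, Finset.sum_apply]
    refine Finset.sum_congr rfl fun j hj => ?_
    rw [Pi.smul_apply, smul_eq_mul, hpK j (mem_activeNodes.1 hj).1 hz]
  set s := ∑ j ∈ D.activeNodes K, |D.nodalValue loc v j - c| with hs
  have hqs : ∀ z ∈ K.toSet, |q z| ≤ κ * s := fun z hz => by
    rw [hqz z hz, hs, Finset.mul_sum]
    refine (Finset.abs_sum_le_sum_abs _ _).trans (Finset.sum_le_sum fun j hj => ?_)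
    rw [abs_mul, mul_comm]
    gcongr
    exact hD.basis_le j (mem_activeNodes.1 hj).1 z (M.toSet_subset hK hz)
  have hm0 : ENNReal.ofReal (K.ht * K.hx ^ d) ≠ 0 := (ENNReal.ofReal_pos.2 (by positivity)).ne'
  have hcard : ((D.activeNodes K).card : ℝ≥0∞) ≤ n := by
    exact_mod_cast hn hD loc hloc K hK
  have hss : ‖s‖ₑ ^ 2 ≤ n * (n * (C₂ * (C₁ * (E / ENNReal.ofReal (K.ht * K.hx ^ d))))) := by
    have h1 : s ^ 2 ≤ (D.activeNodes K).card *
        ∑ j ∈ D.activeNodes K, |D.nodalValue loc v j - c| ^ 2 := sq_sum_le_card_mul_sum_sq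
    calc ‖s‖ₑ ^ 2 = ENNReal.ofReal (s ^ 2) := by
          rw [← enorm_pow, Real.enorm_eq_ofReal (sq_nonneg _)]
      _ ≤ ENNReal.ofReal ((D.activeNodes K).card *
          ∑ j ∈ D.activeNodes K, |D.nodalValue loc v j - c| ^ 2) := ENNReal.ofReal_le_ofReal h1
      _ = (D.activeNodes K).card * ∑ j ∈ D.activeNodes K, ‖D.nodalValue loc v j - c‖ₑ ^ 2 := by
          rw [ENNReal.ofReal_mul (by positivity), ENNReal.ofReal_natCast,
            ENNReal.ofReal_sum_of_nonneg fun _ _ => by positivity]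
          congr 1
          refine Finset.sum_congr rfl fun j hj => ?_
          rw [sq_abs, ← enorm_pow, Real.enorm_eq_ofReal (sq_nonneg _)]
      _ ≤ n * ((D.activeNodes K).card • (C₂ * (C₁ * (E / ENNReal.ofReal (K.ht * K.hx ^ d))))) := by
          gcongr
          exact Finset.sum_le_card_nsmul _ _ _ ha
      _ ≤ _ := by
          rw [nsmul_eq_mul]
          gcongr
  have hfin : (C₃ : ℝ≥0∞) * (ENNReal.ofReal (K.ht * K.hx ^ d) * ‖κ * s‖ₑ ^ 2) ≤
      (C₃ * (κ.toNNReal ^ 2 * (n * (n * (C₂ * C₁)))) : ℝ≥0) * E := by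
    rw [enorm_mul, mul_pow, Real.enorm_eq_ofReal hκ0.le]
    calc _ ≤ (C₃ : ℝ≥0∞) * (ENNReal.ofReal (K.ht * K.hx ^ d) * (ENNReal.ofReal κ ^ 2 *
          (n * (n * (C₂ * (C₁ * (E / ENNReal.ofReal (K.ht * K.hx ^ d)))))))) := by gcongr
      _ = (C₃ : ℝ≥0∞) * (ENNReal.ofReal κ ^ 2 * (n * (n * (C₂ * (C₁ *
          (ENNReal.ofReal (K.ht * K.hx ^ d) * (E / ENNReal.ofReal (K.ht * K.hx ^ d)))))))) := by
          ring
      _ = _ := by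
          rw [ENNReal.mul_div_cancel hm0 ENNReal.ofReal_ne_top]
          push_cast
          rw [ENNReal.ofReal]
          ring
  obtain ⟨h1, h2⟩ := hC₃ K (hD.shape K hK) q hqm _ hqs
  have hfd : ∀ z, fderiv ℝ (fun z => c + q z) z = fderiv ℝ q z := fun z => fderiv_const_add c
  have hgr : ∀ z, gradX (fun z => c + q z) z = gradX q z := fun z =>
    PiLp.ext fun i => by rw [gradX_apply, gradX_apply, hfd]
  refine ⟨fun z => c + q z, contDiff_const.add ((contDiff_of_mem_tensorPoly hqm).of_le (by simp)),
    fun z hz => ?_, ?_, ?_⟩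
  · rw [interp, sum_activeNodes hne hK _ hz]
    simp only [hqz z hz, sub_mul]
    rw [Finset.sum_sub_distrib, ← Finset.mul_sum, sum_basis_eq_one hne hK hz]
    ring
  · simp only [hgr]
    exact h1.trans hfin
  · simp only [hfd]
    exact h2.trans hfin

end Dofs

end Mesh

/-! ### The error estimates -/

/-- The norms of weak derivatives are infima over representatives. Factors that are neither zero nor
infinite pass into the infimum even if the index set is empty, that is, if there is no weak
derivative and the norm is `∞`. -/
theorem le_mul_iInf_add_mul_iInf {ι ι' : Type*} {X c r : ℝ≥0∞} (hc0 : c ≠ 0) (hc : c ≠ ⊤)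
    (hr0 : r ≠ 0) (hr : r ≠ ⊤) {A : ι → ℝ≥0∞} {B : ι' → ℝ≥0∞}
    (h : ∀ i j, X ≤ c * (A i + r * B j)) : X ≤ c * ((⨅ i, A i) + r * ⨅ j, B j) := by
  rw [ENNReal.mul_iInf_of_ne hr0 hr, ENNReal.iInf_add, ENNReal.mul_iInf_of_ne hc0 hc]
  refine le_iInf fun i => ?_
  rw [ENNReal.add_iInf, ENNReal.mul_iInf_of_ne hc0 hc]
  exact le_iInf fun j => h i j

theorem gradXNorm_eq_iInf {d : ℕ} (S : Set (ℝ × Space d)) (w : ℝ × Space d → ℝ) :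
    gradXNorm S w = ⨅ g : {g // HasWeakGradX (interior S) w g},
      eLpNorm g.1 2 (volume.restrict S) := iInf_subtype'

theorem dtNorm_eq_iInf {d : ℕ} (S : Set (ℝ × Space d)) (w : ℝ × Space d → ℝ) :
    dtNorm S w = ⨅ g : {g // HasWeakDt (interior S) w g},
      eLpNorm g.1 2 (volume.restrict S) := iInf_subtype'

theorem gradXNorm_le_of_eqOn {d : ℕ} {S : Set (ℝ × Space d)} {u v : ℝ × Space d → ℝ}
    (h : EqOn u v S) : gradXNorm S v ≤ gradXNorm S u :=
  le_iInf₂ fun g hg => iInf₂_le g (hg.congr ((ae_restrict_iff' isOpen_interior.measurableSet).2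
    (ae_of_all _ fun _ hz => h (interior_subset hz))) (ae_eq_refl _))

theorem dtNorm_le_of_eqOn {d : ℕ} {S : Set (ℝ × Space d)} {u v : ℝ × Space d → ℝ}
    (h : EqOn u v S) : dtNorm S v ≤ dtNorm S u :=
  le_iInf₂ fun g hg => iInf₂_le g ((hasWeakDt_iff.1 hg).congr
    ((ae_restrict_iff' isOpen_interior.measurableSet).2
    (ae_of_all _ fun _ hz => h (interior_subset hz))) (ae_eq_refl _))

/-- An energy bound for a quantity `A`, in the form of a bound by a weighted sum of norms. -/
theorem le_of_sq_le_energy {ht hx : ℝ} (hx0 : 0 < hx) {C : ℝ≥0} {A F G E : ℝ≥0∞}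
    (hA : ENNReal.ofReal hx ^ 2 * A ^ 2 ≤ C * E)
    (hE : E ≤ ENNReal.ofReal ht ^ 2 * F ^ 2 + ENNReal.ofReal hx ^ 2 * G ^ 2) :
    A ≤ (C + 1) * (G + ENNReal.ofReal (ht / hx) * F) := by
  have h0 : ENNReal.ofReal hx ≠ 0 := (ENNReal.ofReal_pos.2 hx0).ne'
  have h1 : ENNReal.ofReal hx * ((C + 1) * (G + ENNReal.ofReal (ht / hx) * F)) =
      (C + 1) * (ENNReal.ofReal ht * F + ENNReal.ofReal hx * G) := by
    have : ENNReal.ofReal ht = ENNReal.ofReal hx * ENNReal.ofReal (ht / hx) := by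
      rw [← ENNReal.ofReal_mul hx0.le, mul_div_cancel₀ _ hx0.ne']
    rw [this]
    ring
  rw [← ENNReal.mul_le_mul_iff_right h0 ENNReal.ofReal_ne_top, h1]
  rw [← ENNReal.pow_le_pow_left_iff two_ne_zero, mul_pow, mul_pow]
  refine hA.trans (mul_le_mul' ?_ (hE.trans ?_))
  · calc (C : ℝ≥0∞) ≤ C + 1 := le_self_add
      _ ≤ (C + 1) * (C + 1) := le_mul_of_one_le_left' le_add_self
      _ = _ := (sq _).symm
  · rw [← mul_pow, ← mul_pow, add_sq]
    calc _ ≤ (ENNReal.ofReal ht * F) ^ 2 + (ENNReal.ofReal hx * G) ^ 2 +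
          2 * (ENNReal.ofReal ht * F) * (ENNReal.ofReal hx * G) := le_self_add
      _ = _ := by ring

namespace Mesh

namespace Dofs

variable {κ : ℝ}

/-- Triangle inequality and local stability: the constant `C + 2` collects `1` from `w` and `C + 1`
from its interpolant. That it is nonzero is needed for passing to infima. -/
theorem exists_sub_interp_le (d k ℓ : ℕ) (hd : 1 ≤ d) (hκ : 1 ≤ κ) :
    ∃ C : ℝ≥0, C ≠ 0 ∧ ∀ {T : ℝ} {Ω : Set (Space d)} {M : Mesh d T Ω} {D : M.Dofs k ℓ},
      IsLipschitzDomain Ω → D.IsRegular κ →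
      ∀ loc : ℝ × Space d → Cell d, (∀ j ∈ D.nodes, loc j ∈ M.cells ∧ j ∈ (loc j).toSet) →
      ∀ K ∈ M.cells, ∀ {w f : ℝ × Space d → ℝ} {g : ℝ × Space d → Space d},
      MemL2H10 T Ω w → HasWeakDt (interior (D.patch K)) w f →
      HasWeakGradX (interior (D.patch K)) w g →
      gradXNorm K.toSet (w - D.interp loc w) ≤
        C * (eLpNorm g 2 (volume.restrict (D.patch K)) +
          ENNReal.ofReal (K.ht / K.hx) * eLpNorm f 2 (volume.restrict (D.patch K))) ∧
      dtNorm K.toSet (w - D.interp loc w) ≤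
        C * (eLpNorm f 2 (volume.restrict (D.patch K)) +
          ENNReal.ofReal (K.hx / K.ht) * eLpNorm g 2 (volume.restrict (D.patch K))) := by
  obtain ⟨C, hC⟩ := exists_interp_deriv_le d k ℓ hd hκ
  refine ⟨C + 2, by positivity, fun {T Ω M D} hΩ hD loc hloc K hK {w f g} hw hf hg => ?_⟩
  have hne := hD.interior_nonempty hd hκ
  have hht := K.ht_pos
  have hhx := K.hx_pos hd
  have hr1 : ENNReal.ofReal (K.ht / K.hx) ≠ 0 := (ENNReal.ofReal_pos.2 (div_pos hht hhx)).ne'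
  have hr2 : ENNReal.ofReal (K.hx / K.ht) ≠ 0 := (ENNReal.ofReal_pos.2 (div_pos hhx hht)).ne'
  have hC0 : ((C + 2 : ℝ≥0) : ℝ≥0∞) ≠ 0 := by
    rw [ENNReal.coe_ne_zero]
    positivity
  set F := eLpNorm f 2 (volume.restrict (D.patch K)) with hF
  set G := eLpNorm g 2 (volume.restrict (D.patch K)) with hG
  by_cases hFt : F = ⊤
  · rw [hFt, ENNReal.mul_top hr1, add_top, top_add, ENNReal.mul_top hC0]
    exact ⟨le_top, le_top⟩
  by_cases hGt : G = ⊤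
  · rw [hGt, ENNReal.mul_top hr2, add_top, top_add, ENNReal.mul_top hC0]
    exact ⟨le_top, le_top⟩
  set O := interior (D.patch K) with hO
  have hOle : (volume : Measure (ℝ × Space d)).restrict O ≤ volume.restrict (D.patch K) :=
    Measure.restrict_mono interior_subset le_rfl
  have hfm : AEStronglyMeasurable f (volume.restrict O) := hf.2.1.aestronglyMeasurable
  have hgm : AEStronglyMeasurable g (volume.restrict O) := hg.2.1.aestronglyMeasurable
  have hwL : MemLp w 2 (volume.restrict O) := hw.1.mono_measure (Measure.restrict_mono
    ((interior_patch_subset (D := D) hΩ K).trans (Set.prod_mono_left Ioo_subset_Icc_self)) le_rfl)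
  have hfL : MemLp f 2 (volume.restrict O) :=
    ⟨hfm, (eLpNorm_mono_measure f hOle).trans_lt (lt_top_iff_ne_top.2 hFt)⟩
  have hgL : MemLp g 2 (volume.restrict O) :=
    ⟨hgm, (eLpNorm_mono_measure g hOle).trans_lt (lt_top_iff_ne_top.2 hGt)⟩
  have hwe := hwL.aestronglyMeasurable.ae_eq_mk
  have hfe := hfm.ae_eq_mk
  have hge := hgm.ae_eq_mk
  -- The Poincaré estimates assume measurable functions. Representatives are taken on the interior
  -- of the patch, while the interpolant remains that of the original `w`.
  have htriple : IsWeakTriple O (hwL.aestronglyMeasurable.mk w) (hfm.mk f) (hgm.mk g) :=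
    ⟨hwL.aestronglyMeasurable.stronglyMeasurable_mk.measurable,
      hfm.stronglyMeasurable_mk.measurable, hgm.stronglyMeasurable_mk.measurable,
      hwL.ae_eq hwe, hfL.ae_eq hfe, hgL.ae_eq hge,
      (hasWeakDt_iff.1 hf).congr hwe hfe, hg.congr hwe hge⟩
  obtain ⟨p, hp, hpe, hp1, hp2⟩ := hC hΩ hD loc hloc K hK hw htriple hwe
  have hE : energy O K.ht K.hx (hfm.mk f) (hgm.mk g) ≤
      ENNReal.ofReal K.ht ^ 2 * F ^ 2 + ENNReal.ofReal K.hx ^ 2 * G ^ 2 := by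
    rw [energy, ← eLpNorm_two_sq, ← eLpNorm_two_sq, ← eLpNorm_congr_ae hfe, ← eLpNorm_congr_ae hge]
    gcongr
    · exact eLpNorm_mono_measure f hOle
    · exact eLpNorm_mono_measure g hOle
  have hKO : interior K.toSet ⊆ O := interior_mono (toSet_subset_patch hne hK)
  have hKle : (volume : Measure (ℝ × Space d)).restrict K.toSet ≤ volume.restrict (D.patch K) :=
    Measure.restrict_mono (toSet_subset_patch hne hK) le_rfl
  have hμ : (volume : Measure (ℝ × Space d)).restrict K.toSet ≤ volume.restrict O := by
    rw [← K.restrict_interior_toSet]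
    exact Measure.restrict_mono hKO le_rfl
  rw [← eLpNorm_two_sq] at hp1 hp2
  have hcast : ((C + 2 : ℝ≥0) : ℝ≥0∞) = 1 + (C + 1) := by
    push_cast
    rw [← one_add_one_eq_two]
    ring
  have heq : EqOn (w - p) (w - D.interp loc w) K.toSet := fun z hz => by
    rw [Pi.sub_apply, Pi.sub_apply, hpe hz]
  constructor
  · have h1 := le_of_sq_le_energy hhx hp1 hE
    calc gradXNorm K.toSet (w - D.interp loc w) ≤ gradXNorm K.toSet (w - p) :=
          gradXNorm_le_of_eqOn heq
      _ ≤ eLpNorm (g - gradX p) 2 (volume.restrict K.toSet) :=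
          iInf₂_le _ ((hg.mono hKO).sub (.of_contDiff _ hp))
      _ ≤ eLpNorm g 2 (volume.restrict K.toSet) + eLpNorm (gradX p) 2 (volume.restrict K.toSet) :=
          eLpNorm_sub_le (hgm.mono_measure hμ) (continuous_gradX hp).aestronglyMeasurable
            one_le_two
      _ ≤ (G + ENNReal.ofReal (K.ht / K.hx) * F) +
          (C + 1) * (G + ENNReal.ofReal (K.ht / K.hx) * F) :=
          add_le_add ((eLpNorm_mono_measure g hKle).trans le_self_add) h1
      _ = _ := by rw [hcast, add_mul 1, one_mul]
  · have h1 := le_of_sq_le_energy hht hp2 (hE.trans (add_comm _ _).le)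
    calc dtNorm K.toSet (w - D.interp loc w) ≤ dtNorm K.toSet (w - p) := dtNorm_le_of_eqOn heq
      _ ≤ eLpNorm (f - fun z => fderiv ℝ p z (1, 0)) 2 (volume.restrict K.toSet) :=
          iInf₂_le (f - fun z => fderiv ℝ p z (1, 0))
            (hasWeakDt_iff.2 (((hasWeakDt_iff.1 hf).mono hKO).sub (.of_contDiff _ hp _)))
      _ ≤ eLpNorm f 2 (volume.restrict K.toSet) +
          eLpNorm (fun z => fderiv ℝ p z (1, 0)) 2 (volume.restrict K.toSet) :=
          eLpNorm_sub_le (hfm.mono_measure hμ) ((hp.continuous_fderiv one_ne_zero).clm_apply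
            continuous_const).aestronglyMeasurable one_le_two
      _ ≤ (F + ENNReal.ofReal (K.hx / K.ht) * G) +
          (C + 1) * (F + ENNReal.ofReal (K.hx / K.ht) * G) :=
          add_le_add ((eLpNorm_mono_measure f hKle).trans le_self_add) h1
      _ = _ := by rw [hcast, add_mul 1, one_mul]

end Dofs

end Mesh

end SpaceTime

end

/-! ### The theorem: reduction of the error bounds to stability. -/

open SpaceTime in
theorem mainTheorem3 (d k ℓ : ℕ) (hd : 1 ≤ d) (hk : 1 ≤ k) (hℓ : 1 ≤ ℓ) (κ : ℝ) (hκ : 1 ≤ κ) :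
    ∃ C : ℝ≥0, ∀ (T : ℝ) (Ω : Set (Space d)), 0 < T → IsLipschitzDomain Ω →
      ∀ (M : Mesh d T Ω) (D : M.Dofs k ℓ), D.IsRegular κ →
      ∀ loc : ℝ × Space d → Cell d,
        (∀ j ∈ D.nodes, loc j ∈ M.cells ∧ j ∈ (loc j).toSet) →
        -- well-defined on classes, linear, with the prescribed nodal values, projection onto `X_h`
        (∀ u v, MemX T Ω u → MemX T Ω v → u =ᵐ[volume.restrict (Icc 0 T ×ˢ Ω)] v →
          D.interp loc u = D.interp loc v) ∧
        (∀ u v, MemX T Ω u → MemX T Ω v → ∀ a b : ℝ,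
          D.interp loc (a • u + b • v) = a • D.interp loc u + b • D.interp loc v) ∧
        (∀ v, MemX T Ω v → D.interp loc v ∈ M.Xh k ℓ ∧
          ∀ j ∈ D.nodes, (j.2 ∈ frontier Ω → D.interp loc v j = 0) ∧
            (j.2 ∉ frontier Ω → D.interp loc v j = l2Proj k ℓ (loc j).toSet v j)) ∧
        (∀ vh ∈ M.Xh k ℓ, EqOn (D.interp loc vh) vh (Icc 0 T ×ˢ closure Ω)) ∧
        -- local error bounds
        (∀ v, MemX T Ω v → ∀ K ∈ M.cells, ∀ vh ∈ M.Xh k ℓ,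
          gradXNorm K.toSet (v - D.interp loc v) ≤
              C * (gradXNorm (D.patch K) (v - vh) +
                ENNReal.ofReal (K.ht / K.hx) * dtNorm (D.patch K) (v - vh)) ∧
          dtNorm K.toSet (v - D.interp loc v) ≤
              C * (dtNorm (D.patch K) (v - vh) +
                ENNReal.ofReal (K.hx / K.ht) * gradXNorm (D.patch K) (v - vh))) := by
  obtain ⟨C, hC0, hC⟩ := Mesh.Dofs.exists_sub_interp_le d k ℓ hd hκ
  refine ⟨C, fun T Ω hT hΩ M D hD loc hloc => ⟨fun u v hu hv h =>
    Mesh.Dofs.interp_congr_ae hΩ hloc h, fun u v hu hv a b =>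
    Mesh.Dofs.interp_lincomb hd hκ hD hΩ hloc hu hv a b, fun v hv =>
    ⟨Mesh.Dofs.interp_mem_Xh hΩ v, fun j hj => ⟨fun hjf => ?_, fun hjf => ?_⟩⟩, fun vh hvh =>
    Mesh.Dofs.interp_eqOn hd hκ hD hΩ hloc hT hvh, fun v hv K hK vh hvh => ?_⟩⟩
  · rw [Mesh.Dofs.interp_node v hj, Mesh.Dofs.nodalValue_of_frontier v hjf]
  · rw [Mesh.Dofs.interp_node v hj, Mesh.Dofs.nodalValue_of_notMem_frontier v hj hjf]
  · have hw : MemX T Ω (v - vh) := by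
      rw [sub_eq_add_neg, ← neg_one_smul ℝ vh]
      exact hv.add hΩ.volume_ne_top (hvh.2.const_smul _)
    have hlin : D.interp loc (v - vh) = D.interp loc v - D.interp loc vh := by
      have := Mesh.Dofs.interp_lincomb hd hκ hD hΩ hloc hv hvh.2 1 (-1)
      simpa [sub_eq_add_neg] using this
    -- By linearity and reproduction of `vh`, subtracting `vh` does not change the error.
    -- Reproduction holds on the closed cylinder only, which contains `K`.
    have heq : EqOn ((v - vh) - D.interp loc (v - vh)) (v - D.interp loc v) K.toSet :=
      fun z hz => by
        have h1 := Mesh.Dofs.interp_eqOn hd hκ hD hΩ hloc hT hvh (M.toSet_subset hK hz)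
        simp only [hlin, Pi.sub_apply, h1]
        ring
    have hht := K.ht_pos
    have hhx := K.hx_pos hd
    have hc0 : (C : ℝ≥0∞) ≠ 0 := by simpa using hC0
    constructor
    · refine (gradXNorm_le_of_eqOn heq).trans ?_
      rw [gradXNorm_eq_iInf (D.patch K), dtNorm_eq_iInf (D.patch K)]
      exact le_mul_iInf_add_mul_iInf hc0 ENNReal.coe_ne_top
        (ENNReal.ofReal_pos.2 (div_pos hht hhx)).ne' ENNReal.ofReal_ne_top fun g f =>
        (hC hΩ hD loc hloc K hK hw.1 f.2 g.2).1
    · refine (dtNorm_le_of_eqOn heq).trans ?_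
      rw [gradXNorm_eq_iInf (D.patch K), dtNorm_eq_iInf (D.patch K)]
      exact le_mul_iInf_add_mul_iInf hc0 ENNReal.coe_ne_top
        (ENNReal.ofReal_pos.2 (div_pos hhx hht)).ne' ENNReal.ofReal_ne_top fun f g =>
        (hC hΩ hD loc hloc K hK hw.1 f.2 g.2).2
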